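/- Let $p,q,r\ge 0$ be integers with $r\le p+q$. Let $V=\mathbb{C}^{p+q}=V^+\oplus V^-$ with $V^+=\mathbb{C}^p\times\{0\}^q$ and $V^-=\{0\}^p\times\mathbb{C}^q$, and let $K=\mathrm{GL}(V^+)\times \mathrm{GL}(V^-)$ act diagonally on $$\mathfrak{X}=\mathrm{Gr}(V,r)\times \mathrm{Fl}(V^+)\times \mathrm{Fl}(V^-),$$ where $\mathrm{Gr}(V,r)$ is the Grassmann variety of $r$-dimensional subspaces of $V$ and $\mathrm{Fl}(V^\pm)$ is the variety of complete flags of $V^\pm$. Let $\mathfrak{T}$ be the set of $(p+q)\times r$ matrices of rank $r$ of the form $\omega=\begin{pmatrix}\tau_1\\ \tau_2\end{pmatrix}$, where $\tau_1$ (of size $p\times r$) and $\tau_2$ (of size $q\times r$) have entries in $\{0,1\}$ with at most one $1$ in each row and in each column. Let $\overline{\mathfrak{T}}=\mathfrak{T}/\mathfrak{S}_r$ be the quotient by permutations of the columns. To $\omega\in\overline{\mathfrak{T}}$ attach a graph $\mathcal{G}(\omega)$ on the vertices $1^+,\dots,p^+,1^-,\dots,q^-$: there is an edge $(i^+,j^-)$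 for each column of $\omega$ with exactly two $1$'s, in positions $i$ (within $\tau_1$) and $p+j$ (within $\tau_2$); there is a mark at $i^+$ (resp. at $j^-$) for each column with exactly one $1$, in position $i$ (resp. $p+j$). The degree of a vertex is $2$ if it is marked, $1$ if it is incident with an edge, and $0$ otherwise. Let * $a^+(\omega)$ be the number of pairs $i<j$ in $\{1,\dots,p\}$ with $\deg(i^+)<\deg(j^+)$, and $a^-(\omega)$ the number of pairs $i<j$ in $\{1,\dots,q\}$ with $\deg(i^-)<\deg(j^-)$; * $b(\omega)$ be the number of edges, and $c(\omega)$ the number of pairs of edges $(i^+,j^-)$, $(k^+,\ell^-)$ with $i<k$ and $j>\ell$; * $r_{i,j}(\omega)$, for $0\le i\le p$ and $0\le j\le q$, be the number of edges and marks contained within the vertices $1^+,\dots,i^+,1^-,\dots,j^-$. Let $[\omega]\subset V$ be the image (column space) of $\omega$, let $\mathcal{F}_0^+=(\mathbb{C}^i\times\{0\}^{p-i}\times\{0\}^q)_{i=0}^p$ and $\mathcal{F}_0^-=(\{0\}^p\times\mathbb{C}^j\times\{0\}^{q-j})_{j=0}^q$ be the standard flags of $V^+$ and $V^-$, and let $\mathbb{O}_\omega=K\cdot([\omega],\mathcal{F}_0^+,\mathcal{F}_0^-)\subset\mathfrak{X}$.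 Then: 1. Every $K$-orbit in $\mathfrak{X}$ is of the form $\mathbb{O}_\omega$ for a unique $\omega\in\overline{\mathfrak{T}}$. 2. $\dim\mathbb{O}_\omega=\frac{p(p-1)}{2}+\frac{q(q-1)}{2}+a^+(\omega)+a^-(\omega)+\frac{b(\omega)(b(\omega)+1)}{2}+c(\omega)$ for all $\omega\in\overline{\mathfrak{T}}$. 3. For all $\omega\in\overline{\mathfrak{T}}$, $\mathbb{O}_\omega$ is the set of triples $(W,(F_i^+)_{i=0}^p,(F_j^-)_{j=0}^q)\in\mathfrak{X}$ such that $\dim W\cap(F_i^++F_j^-)=r_{i,j}(\omega)$ for all $(i,j)\in\{0,\dots,p\}\times\{0,\dots,q\}$. 4. For all $\omega,\omega'\in\overline{\mathfrak{T}}$, $\overline{\mathbb{O}_\omega}\subset\overline{\mathbb{O}_{\omega'}}$ if and only if $r_{i,j}(\omega)\ge r_{i,j}(\omega')$ for all $(i,j)\in\{0,\dots,p\}\times\{0,\dots,q\}$. Dimension and closure are taken in the Zariski topology of the variety $\mathfrak{X}$. -/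

import Mathlib

open scoped MatrixGroups

/-! ### The vector space, complete flags, and the double flag variety -/

/-- A complete flag `0 = F 0 ⊂ F 1 ⊂ ⋯ ⊂ F n = ℂⁿ` of `ℂⁿ`. -/
@[ext]
structure CompleteFlag (n : ℕ) where
  /-- the subspace of dimension `i` -/
  space : Fin (n + 1) → Submodule ℂ (Fin n → ℂ)
  mono : Monotone space
  finrank_eq : ∀ i, Module.finrank ℂ (space i) = (i : ℕ)

/-- The double flag variety `Gr(V, r) × Fl(V⁺) × Fl(V⁻)`, where `V = V⁺ ⊕ V⁻` is realised as
`Fin p ⊕ Fin q → ℂ`, with `V⁺ = ℂᵖ` and `V⁻ = ℂ^q`. -/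
@[ext]
structure DoubleFlagVariety (p q r : ℕ) where
  /-- the `r`-dimensional subspace of `V` -/
  W : Submodule ℂ (Fin p ⊕ Fin q → ℂ)
  finrank_W : Module.finrank ℂ W = r
  /-- the flag of `V⁺` -/
  Fplus : CompleteFlag p
  /-- the flag of `V⁻` -/
  Fminus : CompleteFlag q

/-- The inclusion `ℂᵖ → V`, with image `V⁺ = ℂᵖ × {0}`. -/
def inclPlus (p q : ℕ) : (Fin p → ℂ) →ₗ[ℂ] (Fin p ⊕ Fin q → ℂ) where
  toFun x := Sum.elim x 0
  map_add' x y := by ext (i | i) <;> simp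
  map_smul' c x := by ext (i | i) <;> simp

/-- The inclusion `ℂ^q → V`, with image `V⁻ = {0} × ℂ^q`. -/
def inclMinus (p q : ℕ) : (Fin q → ℂ) →ₗ[ℂ] (Fin p ⊕ Fin q → ℂ) where
  toFun y := Sum.elim 0 y
  map_add' x y := by ext (i | i) <;> simp
  map_smul' c x := by ext (i | i) <;> simp

/-- The subspace `F⁺ᵢ + F⁻ⱼ` of `V`. -/
def DoubleFlagVariety.flagSum {p q r : ℕ} (x : DoubleFlagVariety p q r)
    (i : Fin (p + 1)) (j : Fin (q + 1)) : Submodule ℂ (Fin p ⊕ Fin q → ℂ) :=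
  (x.Fplus.space i).map (inclPlus p q) ⊔ (x.Fminus.space j).map (inclMinus p q)

/-- The standard complete flag `(ℂⁱ × {0}^(n-i))ᵢ` of `ℂⁿ`. -/
def stdFlag (n : ℕ) : CompleteFlag n where
  space i := Submodule.span ℂ
    (Set.range fun k : {k : Fin n // (k : ℕ) < i} => (Pi.single k.1 1 : Fin n → ℂ))
  mono i j hij := by
    apply Submodule.span_mono
    rintro _ ⟨k, rfl⟩
    exact ⟨⟨k.1, lt_of_lt_of_le k.2 hij⟩, rfl⟩
  finrank_eq i := by
    have hli : LinearIndependent ℂ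
        (fun k : {k : Fin n // (k : ℕ) < i} => (Pi.single k.1 1 : Fin n → ℂ)) := by
      have h := (Pi.basisFun ℂ (Fin n)).linearIndependent.comp
        (Subtype.val : {k : Fin n // (k : ℕ) < i} → Fin n) Subtype.val_injective
      convert h using 2 with k
      simp
    rw [finrank_span_eq_card hli, Fintype.card_subtype, Fin.card_filter_val_lt]
    omega

/-! ### The group `K = GL(V⁺) × GL(V⁻)` and its action -/

theorem finrank_map_mulVecLin {ι : Type*} [Fintype ι] [DecidableEq ι] (g : GL ι ℂ)
    (U : Submodule ℂ (ι → ℂ)) :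
    Module.finrank ℂ (U.map (g : Matrix ι ι ℂ).mulVecLin) = Module.finrank ℂ U := by
  refine (LinearEquiv.finrank_eq (Submodule.equivMapOfInjective _ ?_ U)).symm
  exact Matrix.mulVec_injective_iff_isUnit.2 g.isUnit

noncomputable instance (n : ℕ) : MulAction (GL (Fin n) ℂ) (CompleteFlag n) where
  smul g F :=
    { space := fun i => (F.space i).map (g : Matrix (Fin n) (Fin n) ℂ).mulVecLin
      mono := fun _ _ h => Submodule.map_mono (F.mono h)
      finrank_eq := fun i => by rw [finrank_map_mulVecLin, F.finrank_eq] }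
  one_smul F := by
    apply CompleteFlag.ext
    funext i
    change (F.space i).map (Matrix.mulVecLin ((1 : GL (Fin n) ℂ) : Matrix (Fin n) (Fin n) ℂ)) = _
    rw [Units.val_one, Matrix.mulVecLin_one, Submodule.map_id]
  mul_smul g h F := by
    apply CompleteFlag.ext
    funext i
    change (F.space i).map (Matrix.mulVecLin ((g * h : GL (Fin n) ℂ) : Matrix _ _ ℂ)) =
      ((F.space i).map (h : Matrix (Fin n) (Fin n) ℂ).mulVecLin).map
        (g : Matrix (Fin n) (Fin n) ℂ).mulVecLin
    rw [Units.val_mul, Matrix.mulVecLin_mul, Submodule.map_comp]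

/-- The embedding of `K = GL(V⁺) × GL(V⁻)` in `GL(V)` as block-diagonal matrices. -/
def blockDiagGL (p q : ℕ) : GL (Fin p) ℂ × GL (Fin q) ℂ →* GL (Fin p ⊕ Fin q) ℂ where
  toFun k :=
    { val := Matrix.fromBlocks k.1.val 0 0 k.2.val
      inv := Matrix.fromBlocks k.1.inv 0 0 k.2.inv
      val_inv := by simp [Matrix.fromBlocks_multiply]
      inv_val := by simp [Matrix.fromBlocks_multiply] }
  map_one' := by ext1; simp
  map_mul' k l := by ext1; simp [Matrix.fromBlocks_multiply]

/-- The diagonal action of `K` on the double flag variety. -/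
noncomputable instance (p q r : ℕ) :
    MulAction (GL (Fin p) ℂ × GL (Fin q) ℂ) (DoubleFlagVariety p q r) where
  smul k x :=
    { W := x.W.map (blockDiagGL p q k : Matrix (Fin p ⊕ Fin q) (Fin p ⊕ Fin q) ℂ).mulVecLin
      finrank_W := by rw [finrank_map_mulVecLin, x.finrank_W]
      Fplus := k.1 • x.Fplus
      Fminus := k.2 • x.Fminus }
  one_smul x := by
    apply DoubleFlagVariety.ext
    · change x.W.map (Matrix.mulVecLin (blockDiagGL p q 1).val) = _
      rw [map_one, Units.val_one, Matrix.mulVecLin_one, Submodule.map_id]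
    · exact one_smul _ x.Fplus
    · exact one_smul _ x.Fminus
  mul_smul k l x := by
    apply DoubleFlagVariety.ext
    · change x.W.map (Matrix.mulVecLin (blockDiagGL p q (k * l)).val) =
        (x.W.map (Matrix.mulVecLin (blockDiagGL p q l).val)).map
          (Matrix.mulVecLin (blockDiagGL p q k).val)
      rw [map_mul, Units.val_mul, Matrix.mulVecLin_mul, Submodule.map_comp]
    · exact mul_smul k.1 l.1 x.Fplus
    · exact mul_smul k.2 l.2 x.Fminus

/-! ### The Zariski topology

The double flag variety is the geometric quotient of the variety of frames
`{A : rank A = r} × GL_p × GL_q` (a locally closed subset of an affine space) by the group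
`GL_r × B_p × B_q`: a matrix `A` is sent to its column space, and an invertible matrix to the flag
spanned by its first columns. The variety of frames being a Zariski-locally trivial principal
bundle, the Zariski topology of the double flag variety is the quotient topology. -/

/-- The Zariski topology of the affine space `ℂ^ι`: the basic open sets are the sets where a
polynomial does not vanish. -/
@[reducible] def affineZariski (ι : Type) : TopologicalSpace (ι → ℂ) :=
  TopologicalSpace.generateFrom
    {U | ∃ f : MvPolynomial ι ℂ, U = {x | MvPolynomial.eval x f ≠ 0}}

/-- Frames: a `(p+q) × r` matrix of rank `r`, and invertible matrices of sizes `p` and `q`. -/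
abbrev FrameSpace (p q r : ℕ) : Type :=
  {A : Matrix (Fin p ⊕ Fin q) (Fin r) ℂ // A.rank = r} × GL (Fin p) ℂ × GL (Fin q) ℂ

/-- The index set of the matrix entries of a frame. -/
abbrev FrameIndex (p q r : ℕ) : Type :=
  ((Fin p ⊕ Fin q) × Fin r) ⊕ (Fin p × Fin p) ⊕ (Fin q × Fin q)

/-- The matrix entries of a frame. -/
def frameCoords {p q r : ℕ} (f : FrameSpace p q r) : FrameIndex p q r → ℂ :=
  Sum.elim (fun ij => f.1.1 ij.1 ij.2)
    (Sum.elim (fun ij => f.2.1.val ij.1 ij.2) (fun ij => f.2.2.val ij.1 ij.2))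

/-- The quotient map from frames to the double flag variety: the matrix `A` gives the subspace
`Im A`, and `g • stdFlag` is the flag spanned by the first columns of `g`. -/
noncomputable def frameMap {p q r : ℕ} (f : FrameSpace p q r) : DoubleFlagVariety p q r where
  W := LinearMap.range f.1.1.mulVecLin
  finrank_W := f.1.2
  Fplus := f.2.1 • stdFlag p
  Fminus := f.2.2 • stdFlag q

/-- The Zariski topology of the double flag variety. -/
noncomputable instance (p q r : ℕ) : TopologicalSpace (DoubleFlagVariety p q r) :=
  TopologicalSpace.coinduced frameMap
    (TopologicalSpace.induced frameCoords (affineZariski (FrameIndex p q r)))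

/-! ### Pairs of partial permutations -/

/-- A partial permutation matrix: entries `0` or `1`, with at most one `1` in each row and in each
column. -/
structure IsPartialPerm {m r : ℕ} (τ : Matrix (Fin m) (Fin r) ℂ) : Prop where
  zero_or_one : ∀ i c, τ i c = 0 ∨ τ i c = 1
  row : ∀ i c c', τ i c = 1 → τ i c' = 1 → c = c'
  col : ∀ i i' c, τ i c = 1 → τ i' c = 1 → i = i'

/-- The set of `(p+q) × r` matrices of rank `r` made of a partial permutation matrix of size
`p × r` on top of a partial permutation matrix of size `q × r`. -/
structure PartialPermPair (p q r : ℕ) where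
  /-- the underlying matrix -/
  mat : Matrix (Fin p ⊕ Fin q) (Fin r) ℂ
  top : IsPartialPerm mat.toRows₁
  bot : IsPartialPerm mat.toRows₂
  rank_eq : mat.rank = r

/-- Two pairs are equivalent when they differ by a permutation of the columns. -/
instance partialPermPairSetoid (p q r : ℕ) : Setoid (PartialPermPair p q r) where
  r ω ω' := ∃ σ : Equiv.Perm (Fin r), ω'.mat = ω.mat.submatrix id σ
  iseqv :=
    { refl := fun _ => ⟨1, rfl⟩
      symm := by
        rintro ω ω' ⟨σ, h⟩
        exact ⟨σ⁻¹, by rw [h]; ext i c; simp⟩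
      trans := by
        rintro ω ω' ω'' ⟨σ, h⟩ ⟨τ, h'⟩
        exact ⟨σ * τ, by rw [h', h]; ext i c; simp⟩ }

/-- Pairs of partial permutations modulo the action of the symmetric group on the columns. -/
def OrbitParam (p q r : ℕ) : Type := Quotient (partialPermPairSetoid p q r)

namespace OrbitParam

variable {p q r : ℕ}

/-- `(i⁺, j⁻)` is an edge of the graph: some column has its `1`s in positions `i` of the top
block and `j` of the bottom block. -/
def IsEdge (ω : OrbitParam p q r) (i : Fin p) (j : Fin q) : Prop :=
  Quotient.lift
    (fun η : PartialPermPair p q r => ∃ c, η.mat (Sum.inl i) c = 1 ∧ η.mat (Sum.inr j) c = 1)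
    (by
      rintro a b ⟨σ, h⟩
      have h' : ∀ x c, b.mat x c = a.mat x (σ c) := fun x c => by rw [h]; rfl
      simp only [h']
      exact propext ⟨fun ⟨c, hc⟩ => ⟨σ.symm c, by simpa using hc⟩, fun ⟨c, hc⟩ => ⟨σ c, hc⟩⟩) ω

/-- `i⁺` is marked: some column has a single `1`, in position `i` of the top block. -/
def IsMarkedPlus (ω : OrbitParam p q r) (i : Fin p) : Prop :=
  Quotient.lift
    (fun η : PartialPermPair p q r => ∃ c, η.mat (Sum.inl i) c = 1 ∧ ∀ j, η.mat (Sum.inr j) c = 0)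
    (by
      rintro a b ⟨σ, h⟩
      have h' : ∀ x c, b.mat x c = a.mat x (σ c) := fun x c => by rw [h]; rfl
      simp only [h']
      exact propext ⟨fun ⟨c, hc⟩ => ⟨σ.symm c, by simpa using hc⟩, fun ⟨c, hc⟩ => ⟨σ c, hc⟩⟩) ω

/-- `j⁻` is marked: some column has a single `1`, in position `j` of the bottom block. -/
def IsMarkedMinus (ω : OrbitParam p q r) (j : Fin q) : Prop :=
  Quotient.lift
    (fun η : PartialPermPair p q r => ∃ c, η.mat (Sum.inr j) c = 1 ∧ ∀ i, η.mat (Sum.inl i) c = 0)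
    (by
      rintro a b ⟨σ, h⟩
      have h' : ∀ x c, b.mat x c = a.mat x (σ c) := fun x c => by rw [h]; rfl
      simp only [h']
      exact propext ⟨fun ⟨c, hc⟩ => ⟨σ.symm c, by simpa using hc⟩, fun ⟨c, hc⟩ => ⟨σ c, hc⟩⟩) ω

open Classical in
/-- The degree of the vertex `i⁺`: `2` if marked, `1` if incident with an edge, `0` if free. -/
noncomputable def degPlus (ω : OrbitParam p q r) (i : Fin p) : ℕ :=
  if ω.IsMarkedPlus i then 2 else if ∃ j, ω.IsEdge i j then 1 else 0

open Classical in
/-- The degree of the vertex `j⁻`: `2` if marked, `1` if incident with an edge, `0` if free. -/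
noncomputable def degMinus (ω : OrbitParam p q r) (j : Fin q) : ℕ :=
  if ω.IsMarkedMinus j then 2 else if ∃ i, ω.IsEdge i j then 1 else 0

/-- The number of pairs `i < j` of positive vertices with `deg i⁺ < deg j⁺`. -/
noncomputable def aPlus (ω : OrbitParam p q r) : ℕ :=
  (Finset.univ.filter fun x : Fin p × Fin p =>
    x.1 < x.2 ∧ ω.degPlus x.1 < ω.degPlus x.2).card

/-- The number of pairs `i < j` of negative vertices with `deg i⁻ < deg j⁻`. -/
noncomputable def aMinus (ω : OrbitParam p q r) : ℕ :=
  (Finset.univ.filter fun x : Fin q × Fin q =>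
    x.1 < x.2 ∧ ω.degMinus x.1 < ω.degMinus x.2).card

open Classical in
/-- The number of edges. -/
noncomputable def numEdges (ω : OrbitParam p q r) : ℕ :=
  (Finset.univ.filter fun e : Fin p × Fin q => ω.IsEdge e.1 e.2).card

open Classical in
/-- The number of crossings: pairs of edges `(i⁺, j⁻)`, `(k⁺, l⁻)` with `i < k` and `j > l`. -/
noncomputable def numCrossings (ω : OrbitParam p q r) : ℕ :=
  (Finset.univ.filter fun e : (Fin p × Fin q) × (Fin p × Fin q) =>
    ω.IsEdge e.1.1 e.1.2 ∧ ω.IsEdge e.2.1 e.2.2 ∧ e.1.1 < e.2.1 ∧ e.2.2 < e.1.2).card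

open Classical in
/-- The number `r_{i,j}` of edges and marks within the first `i` positive and the first `j` negative
vertices (the vertex numbered `k` from zero is among the first `i` ones when `k < i`). -/
noncomputable def rankMat (ω : OrbitParam p q r) (i : Fin (p + 1)) (j : Fin (q + 1)) : ℕ :=
  (Finset.univ.filter fun e : Fin p × Fin q =>
      (e.1 : ℕ) < i ∧ (e.2 : ℕ) < j ∧ ω.IsEdge e.1 e.2).card
    + (Finset.univ.filter fun k : Fin p => (k : ℕ) < i ∧ ω.IsMarkedPlus k).card
    + (Finset.univ.filter fun l : Fin q => (l : ℕ) < j ∧ ω.IsMarkedMinus l).card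

/-- The point `([ω], F₀⁺, F₀⁻)` of the double flag variety, where `[ω]` is the image of the matrix
and `F₀⁺`, `F₀⁻` are the standard flags. -/
noncomputable def basePoint (ω : OrbitParam p q r) : DoubleFlagVariety p q r :=
  Quotient.lift
    (fun η : PartialPermPair p q r =>
      ({ W := LinearMap.range η.mat.mulVecLin
         finrank_W := η.rank_eq
         Fplus := stdFlag p
         Fminus := stdFlag q } : DoubleFlagVariety p q r))
    (by
      rintro a b ⟨σ, h⟩
      apply DoubleFlagVariety.ext
      · simp only [Matrix.range_mulVecLin, h]
        congr 1
        exact (σ.surjective.range_comp a.mat.col).symm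
      · rfl
      · rfl) ω

/-- The orbit `K · ([ω], F₀⁺, F₀⁻)`. -/
def orbit (ω : OrbitParam p q r) : Set (DoubleFlagVariety p q r) :=
  MulAction.orbit (GL (Fin p) ℂ × GL (Fin q) ℂ) ω.basePoint

end OrbitParam

/-!
# Orbits of `GL_p × GL_q` on the double flag variety `Gr(V, r) × Fl(V⁺) × Fl(V⁻)`

The proof uses linear algebra and elementary properties of the Zariski topology of affine space.

*Orbits and rank conditions.* Climbing the flag of `V⁺`, one finds bases `e` of `V⁺` and `f` of `V⁻`
adapted to the two flags, such that `W` is spanned by vectors of the forms `e a + f b`, `e a`, `f b`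
in which each basis vector is used at most once (`exists_normal_form`). Hence every point lies in
the orbit of some parameter. Parameters are handled as *patterns* `T : Fin r → ℕ × ℕ`, which list
the positions of the `1`s in the columns (`IsPattern`). The dimensions of `W ∩ (F⁺ᵢ + F⁻ⱼ)` are
constant on orbits, equal to the numbers `r_{i,j}` at the base point, and these numbers determine
the parameter (`range_eq_of_patRank_eq`).

*Closures.* The dimension of `W ∩ (F⁺ᵢ + F⁻ⱼ)` is upper semicontinuous (`isClosed_le_finrank_inf`),
which gives one direction. Conversely, if the numbers `r_{i,j}` of `S` dominate those of `T`, then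
`S` is obtained from `T` by a chain of elementary degenerations, which uncross two columns or lower
one end of a column (`exists_patStep_chain`): look at the first place where the patterns differ, and
move there the nearest entry of `T`. Each elementary degeneration is the limit of a line of matrices
whose other points lie in the bigger orbit (`PatStep.basePoint_mem_closure`).

*Dimension.* The dimension of an orbit is the codimension of the isotropy algebra of the base point
`x` in `𝔤𝔩_p × 𝔤𝔩_q` (`IsPattern.topologicalKrullDim_orbit`): if `R` parametrizes a complement of the
isotropy algebra, then `z ↦ (1 + R z) • x` is an open embedding of a nonempty open part of an affine
space in the orbit, because `z` is recovered as the solution of a linear system whose coefficients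
are polynomials in the entries of a frame. A nonempty open part of `ℂ^d` has dimension `d`, and the
dimension of a homogeneous space is that of any of its open parts. The isotropy algebra is cut out
by independent linear equations (`IsPattern.isotropyEquations_surjective`): the entries below the
diagonal and those indexed by vertices of increasing degree vanish, and the two entries indexed by a
pair of edges agree. Counting them gives the formula.
-/


open TopologicalSpace Topology

/-! ### Polynomial functions and the Zariski topology -/

/-- A function on a space with coordinates `c : α → ℂ^ι` is polynomial if it is a polynomial in
these coordinates. -/
def IsPolyFun {α : Type*} {ι : Type} (c : α → ι → ℂ) (F : α → ℂ) : Prop :=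
  ∃ P : MvPolynomial ι ℂ, ∀ a, F a = MvPolynomial.eval (c a) P

namespace IsPolyFun

variable {α : Type*} {ι : Type} {c : α → ι → ℂ} {F G : α → ℂ}

theorem const (z : ℂ) : IsPolyFun c fun _ => z := ⟨MvPolynomial.C z, by simp⟩

theorem coord (i : ι) : IsPolyFun c fun a => c a i := ⟨MvPolynomial.X i, by simp⟩

theorem add (hF : IsPolyFun c F) (hG : IsPolyFun c G) : IsPolyFun c fun a => F a + G a := by
  obtain ⟨P, hP⟩ := hF
  obtain ⟨Q, hQ⟩ := hG
  exact ⟨P + Q, by simp [hP, hQ]⟩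

theorem mul (hF : IsPolyFun c F) (hG : IsPolyFun c G) : IsPolyFun c fun a => F a * G a := by
  obtain ⟨P, hP⟩ := hF
  obtain ⟨Q, hQ⟩ := hG
  exact ⟨P * Q, by simp [hP, hQ]⟩

theorem neg (hF : IsPolyFun c F) : IsPolyFun c fun a => -F a := by
  obtain ⟨P, hP⟩ := hF
  exact ⟨-P, by simp [hP]⟩

theorem sub (hF : IsPolyFun c F) (hG : IsPolyFun c G) : IsPolyFun c fun a => F a - G a := by
  simpa [sub_eq_add_neg] using hF.add hG.neg

theorem pow (hF : IsPolyFun c F) (n : ℕ) : IsPolyFun c fun a => F a ^ n := by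
  obtain ⟨P, hP⟩ := hF
  exact ⟨P ^ n, by simp [hP]⟩

theorem sum {κ : Type*} (s : Finset κ) {H : κ → α → ℂ} (h : ∀ k ∈ s, IsPolyFun c (H k)) :
    IsPolyFun c fun a => ∑ k ∈ s, H k a := by
  classical
  choose! P hP using h
  exact ⟨∑ k ∈ s, P k, fun a => by
    rw [map_sum]; exact Finset.sum_congr rfl fun k hk => hP k hk a⟩

theorem prod {κ : Type*} (s : Finset κ) {H : κ → α → ℂ} (h : ∀ k ∈ s, IsPolyFun c (H k)) :
    IsPolyFun c fun a => ∏ k ∈ s, H k a := by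
  classical
  choose! P hP using h
  exact ⟨∏ k ∈ s, P k, fun a => by
    rw [map_prod]; exact Finset.prod_congr rfl fun k hk => hP k hk a⟩

theorem matrix_mul {l m n : Type*} [Fintype m] {A : α → Matrix l m ℂ} {B : α → Matrix m n ℂ}
    (hA : ∀ i j, IsPolyFun c fun a => A a i j) (hB : ∀ i j, IsPolyFun c fun a => B a i j)
    (i : l) (j : n) :
    IsPolyFun c fun a => (A a * B a) i j := by
  simp only [Matrix.mul_apply]
  exact sum _ fun k _ => (hA i k).mul (hB k j)

theorem det {n : Type*} [Fintype n] [DecidableEq n] {A : α → Matrix n n ℂ}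
    (hA : ∀ i j, IsPolyFun c fun a => A a i j) : IsPolyFun c fun a => (A a).det := by
  simp only [Matrix.det_apply]
  refine sum _ fun σ _ => ?_
  simp only [Units.smul_def, zsmul_eq_mul]
  exact (const _).mul (prod _ fun i _ => hA _ _)

theorem adjugate {n : Type*} [Fintype n] [DecidableEq n] {A : α → Matrix n n ℂ}
    (hA : ∀ i j, IsPolyFun c fun a => A a i j) (i j : n) :
    IsPolyFun c fun a => (A a).adjugate i j := by
  simp only [Matrix.adjugate_apply]
  refine det fun k l => ?_
  by_cases hk : k = j
  · subst hk
    simpa using const _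
  · simpa [hk] using hA k l

/-- Polynomial functions of polynomial functions are polynomial. -/
theorem eval {κ : Type} {f : α → κ → ℂ} (hf : ∀ k, IsPolyFun c fun a => f a k)
    (P : MvPolynomial κ ℂ) : IsPolyFun c fun a => MvPolynomial.eval (f a) P := by
  induction P using MvPolynomial.induction_on with
  | C z => simpa using const z
  | add P Q hP hQ => simpa using hP.add hQ
  | mul_X P k hP => simpa using hP.mul (hf k)

theorem comp {β : Type*} {κ : Type} {d : β → κ → ℂ} {H : β → ℂ} (hH : IsPolyFun d H) {f : α → β}
    (hf : ∀ k, IsPolyFun c fun a => d (f a) k) : IsPolyFun c fun a => H (f a) := by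
  obtain ⟨P, hP⟩ := hH
  simpa only [hP] using eval hf P

/-- A polynomial in fractions with a common denominator is such a fraction. -/
theorem eval_div {κ : Type} {N : κ → α → ℂ} {Q : α → ℂ} (hN : ∀ k, IsPolyFun c (N k))
    (hQ : IsPolyFun c Q) (P : MvPolynomial κ ℂ) :
    ∃ (n : ℕ) (H : α → ℂ), IsPolyFun c H ∧
      ∀ a, Q a ≠ 0 → MvPolynomial.eval (fun k => N k a / Q a) P = H a / Q a ^ n := by
  induction P using MvPolynomial.induction_on with
  | C z => exact ⟨0, _, const z, by simp⟩
  | add P P' hP hP' =>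
    obtain ⟨n, H, hH, h⟩ := hP
    obtain ⟨n', H', hH', h'⟩ := hP'
    refine ⟨n + n', fun a => H a * Q a ^ n' + H' a * Q a ^ n,
      (hH.mul (hQ.pow _)).add (hH'.mul (hQ.pow _)), fun a ha => ?_⟩
    rw [map_add, h a ha, h' a ha]
    field_simp
    ring
  | mul_X P k hP =>
    obtain ⟨n, H, hH, h⟩ := hP
    refine ⟨n + 1, fun a => H a * N k a, hH.mul (hN k), fun a ha => ?_⟩
    rw [map_mul, h a ha, MvPolynomial.eval_X, pow_succ, div_mul_div_comm]

/-- Near a parameter where a linear system with polynomial coefficients has independent columns,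
the columns stay independent, and the solution, if there is one, is a rational function of the
parameter. -/
theorem exists_linear_solution {m n : Type*} [Fintype m] [Fintype n]
    {C : α → Matrix m n ℂ} {v : α → m → ℂ} (hC : ∀ i j, IsPolyFun c fun a => C a i j)
    (hv : ∀ i, IsPolyFun c fun a => v a i) {a₀ : α} (h₀ : Function.Injective (C a₀).mulVec) :
    ∃ (Q : α → ℂ) (N : n → α → ℂ), IsPolyFun c Q ∧ (∀ j, IsPolyFun c (N j)) ∧ Q a₀ ≠ 0 ∧
      ∀ a, Q a ≠ 0 → Function.Injective (C a).mulVec ∧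
        ∀ x, (C a).mulVec x = v a → ∀ j, x j = N j a / Q a := by
  classical
  obtain ⟨g, hg⟩ := ((C a₀).mulVecLin).exists_leftInverse_of_injective
    (LinearMap.ker_eq_bot.2 h₀)
  -- for `L` a left inverse at `a₀`, the square system `L * C a` is solved by the Cramer rule
  set L : Matrix n m ℂ := LinearMap.toMatrix' g with hL
  have hLC : L * C a₀ = 1 := by
    have := congrArg LinearMap.toMatrix' hg
    rwa [LinearMap.toMatrix'_comp, ← Matrix.toLin'_apply', LinearMap.toMatrix'_toLin',
      LinearMap.toMatrix'_id] at this
  have hM : ∀ i j, IsPolyFun c fun a => (L * C a) i j := matrix_mul (fun _ _ => const _) hC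
  refine ⟨fun a => (L * C a).det, fun j a => ((L * C a).adjugate.mulVec (L.mulVec (v a))) j,
    det hM, fun j => ?_, by simp [hLC], fun a ha => ⟨fun x y hxy => ?_, fun x hx j => ?_⟩⟩
  · simp only [Matrix.mulVec, dotProduct]
    exact sum _ fun k _ => (adjugate hM j k).mul (sum _ fun l _ => (const _).mul (hv l))
  · have hu : IsUnit (L * C a) := (Matrix.isUnit_iff_isUnit_det _).2 (isUnit_iff_ne_zero.2 ha)
    apply Matrix.mulVec_injective_iff_isUnit.2 hu
    change (L * C a).mulVec x = (L * C a).mulVec y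
    rw [← Matrix.mulVec_mulVec, ← Matrix.mulVec_mulVec]
    exact congrArg _ hxy
  · rw [eq_div_iff ha]
    dsimp only
    rw [← hx, Matrix.mulVec_mulVec, Matrix.mulVec_mulVec, Matrix.mul_assoc, Matrix.adjugate_mul,
      Matrix.smul_mulVec, Matrix.one_mulVec, Pi.smul_apply, smul_eq_mul, mul_comm]

end IsPolyFun

/-- The Zariski topology of a space with coordinates in `ℂ^ι`. -/
@[reducible] def zariskiOf {α : Type*} {ι : Type} (c : α → ι → ℂ) : TopologicalSpace α :=
  TopologicalSpace.induced c (affineZariski ι)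

theorem isTopologicalBasis_affineZariski (ι : Type) :
    @IsTopologicalBasis (ι → ℂ) (affineZariski ι)
      {U | ∃ f : MvPolynomial ι ℂ, U = {x | MvPolynomial.eval x f ≠ 0}} := by
  let _ := affineZariski ι
  refine ⟨?_, ?_, rfl⟩
  · rintro _ ⟨f, rfl⟩ _ ⟨g, rfl⟩ x hx
    refine ⟨_, ⟨f * g, rfl⟩, ?_, ?_⟩
    · simpa using hx
    · intro y hy
      simpa using hy
  · refine Set.eq_univ_of_forall fun x => ⟨_, ⟨1, rfl⟩, by simp⟩

section

variable {α : Type*} {ι : Type} {c : α → ι → ℂ}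

theorem isTopologicalBasis_zariskiOf (c : α → ι → ℂ) :
    @IsTopologicalBasis α (zariskiOf c) {U | ∃ F, IsPolyFun c F ∧ U = {x | F x ≠ 0}} := by
  let _ := affineZariski ι
  let _ := zariskiOf c
  convert (isTopologicalBasis_affineZariski ι).induced c using 1
  ext U
  constructor
  · rintro ⟨F, ⟨P, hP⟩, rfl⟩
    exact ⟨_, ⟨P, rfl⟩, by ext x; simp [hP]⟩
  · rintro ⟨_, ⟨P, rfl⟩, rfl⟩
    exact ⟨_, ⟨P, fun _ => rfl⟩, rfl⟩

theorem IsPolyFun.isOpen {F : α → ℂ} (hF : IsPolyFun c F) : IsOpen[zariskiOf c] {x | F x ≠ 0} := by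
  let _ := zariskiOf c
  exact (isTopologicalBasis_zariskiOf c).isOpen ⟨F, hF, rfl⟩

theorem continuous_zariskiOf {X : Type*} [TopologicalSpace X] {g : X → α}
    (h : ∀ F, IsPolyFun c F → IsOpen {x | F (g x) ≠ 0}) : @Continuous X α _ (zariskiOf c) g := by
  let _ := zariskiOf c
  rw [(isTopologicalBasis_zariskiOf c).continuous_iff]
  rintro _ ⟨F, hF, rfl⟩
  exact h F hF

theorem continuous_of_isPoly {β : Type*} {κ : Type} {d : β → κ → ℂ} {g : β → α}
    (h : ∀ i, IsPolyFun d fun b => c (g b) i) :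
    @Continuous β α (zariskiOf d) (zariskiOf c) g := by
  let _ := zariskiOf d
  exact continuous_zariskiOf fun F hF => (hF.comp h).isOpen

end

/-- The space `ℂ^ι` with the Zariski topology. -/
def ZariskiSpace (ι : Type) : Type := ι → ℂ

instance (ι : Type) : TopologicalSpace (ZariskiSpace ι) :=
  zariskiOf (α := ι → ℂ) fun x => x

/-- The coordinates of a point of `ZariskiSpace ι`. -/
def ZariskiSpace.coords {ι : Type} (x : ZariskiSpace ι) : ι → ℂ := x

instance (ι : Type) : PreirreducibleSpace (ZariskiSpace ι) := by
  refine ⟨fun u v hu hv => ?_⟩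
  rintro ⟨x, -, hx⟩ ⟨y, -, hy⟩
  obtain ⟨_, ⟨F, ⟨f, hf⟩, rfl⟩, hxf, hfu⟩ :=
    (isTopologicalBasis_zariskiOf (ZariskiSpace.coords (ι := ι))).exists_subset_of_mem_open hx hu
  obtain ⟨_, ⟨G, ⟨g, hg⟩, rfl⟩, hyg, hgv⟩ :=
    (isTopologicalBasis_zariskiOf (ZariskiSpace.coords (ι := ι))).exists_subset_of_mem_open hy hv
  have hf0 : f ≠ 0 := by rintro rfl; simp [hf] at hxf
  have hg0 : g ≠ 0 := by rintro rfl; simp [hg] at hyg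
  by_contra hcon
  apply mul_ne_zero hf0 hg0
  apply MvPolynomial.funext
  intro z
  by_contra hz
  rw [map_zero, map_mul] at hz
  exact hcon ⟨z, trivial, hfu ((hf z).trans_ne (left_ne_zero_of_mul hz)),
    hgv ((hg z).trans_ne (right_ne_zero_of_mul hz))⟩

theorem ZariskiSpace.exists_poly_of_isClosed {ι : Type} {Z : Set (ZariskiSpace ι)} (hZ : IsClosed Z)
    {x : ZariskiSpace ι} (hx : x ∉ Z) :
    ∃ f : MvPolynomial ι ℂ, MvPolynomial.eval x.coords f ≠ 0 ∧
      ∀ z ∈ Z, MvPolynomial.eval (ZariskiSpace.coords z) f = 0 := by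
  obtain ⟨_, ⟨F, ⟨f, hf⟩, rfl⟩, hxf, hfu⟩ :=
    (isTopologicalBasis_zariskiOf (ZariskiSpace.coords (ι := ι))).exists_subset_of_mem_open
      (show x ∈ Zᶜ from hx) hZ.isOpen_compl
  refine ⟨f, by simpa [hf] using hxf, fun z hz => ?_⟩
  by_contra h
  exact hfu (show F z ≠ 0 by rwa [hf]) hz

theorem ZariskiSpace.isOpen_ne {ι : Type} (f : MvPolynomial ι ℂ) :
    IsOpen {x : ZariskiSpace ι | MvPolynomial.eval x.coords f ≠ 0} :=
  IsPolyFun.isOpen (c := ZariskiSpace.coords (ι := ι)) ⟨f, fun _ => rfl⟩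

/-- The prime ideal of polynomials vanishing on an irreducible closed set. -/
def TopologicalSpace.IrreducibleCloseds.primeIdeal {ι : Type}
    (Z : IrreducibleCloseds (ZariskiSpace ι)) : PrimeSpectrum (MvPolynomial ι ℂ) where
  asIdeal :=
    { carrier := {f | ∀ z ∈ Z, MvPolynomial.eval (ZariskiSpace.coords z) f = 0}
      zero_mem' := by simp
      add_mem' := fun hf hg z hz => by simp [hf z hz, hg z hz]
      smul_mem' := fun f g hg z hz => by simp [hg z hz] }
  isPrime := by
    constructor
    · obtain ⟨z, hz⟩ := Z.isIrreducible.nonempty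
      rw [Ideal.ne_top_iff_one]
      intro h
      simpa using h z hz
    · intro f g hfg
      by_contra! hcon
      obtain ⟨hf, hg⟩ := hcon
      simp only [Submodule.mem_mk, AddSubmonoid.mem_mk, Set.mem_ofPred_eq, not_forall,
        AddSubsemigroup.mem_mk] at hf hg
      obtain ⟨x, hx, hxf⟩ := hf
      obtain ⟨y, hy, hyg⟩ := hg
      obtain ⟨z, hz, hzf, hzg⟩ := Z.isIrreducible.isPreirreducible _ _
        (ZariskiSpace.isOpen_ne f) (ZariskiSpace.isOpen_ne g) ⟨x, hx, hxf⟩ ⟨y, hy, hyg⟩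
      have := hfg z hz
      rw [map_mul] at this
      exact mul_ne_zero hzf hzg this

/-- Strict inclusions of irreducible closed subsets give strict inclusions of prime ideals of the
polynomial ring. -/
theorem topologicalKrullDim_zariskiSpace_le (d : ℕ) :
    topologicalKrullDim (ZariskiSpace (Fin d)) ≤ d := by
  have h := MvPolynomial.ringKrullDim_of_isNoetherianRing (R := ℂ) (ι := Fin d)
  rw [ringKrullDim_eq_zero_of_field, zero_add, Nat.card_fin] at h
  rw [← h, ringKrullDim, ← Order.krullDim_orderDual]
  refine Order.krullDim_le_of_strictMono
    (fun Z => OrderDual.toDual (IrreducibleCloseds.primeIdeal Z)) fun Y Z hYZ => ?_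
  rw [OrderDual.toDual_lt_toDual]
  obtain ⟨hle, hne⟩ := SetLike.lt_iff_le_and_exists.1 hYZ
  obtain ⟨x, hx, hxY⟩ := hne
  obtain ⟨f, hfx, hf⟩ := ZariskiSpace.exists_poly_of_isClosed Y.isClosed hxY
  refine lt_of_le_not_ge (fun g hg z hz => hg z (hle hz)) fun h => ?_
  exact hfx (h (show f ∈ (IrreducibleCloseds.primeIdeal Y).asIdeal from hf) x hx)

/-- A nonempty open subset of affine space has the dimension of the affine space: the flag of
coordinate subspaces through one of its points gives a chain of irreducible closed subsets. -/
theorem topologicalKrullDim_of_isOpen {d : ℕ} {U : Set (ZariskiSpace (Fin d))} (hU : IsOpen U)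
    (hne : U.Nonempty) : topologicalKrullDim U = d := by
  refine le_antisymm ((topologicalKrullDim_subspace_le _ U).trans
    (topologicalKrullDim_zariskiSpace_le d)) ?_
  obtain ⟨z₀, hz₀⟩ := hne
  -- the subspace of points sharing with `z₀` all coordinates but the first `i`
  let Y (i : ℕ) : Set (ZariskiSpace (Fin d)) :=
    {z | ∀ j : Fin d, i ≤ j → z.coords j = z₀.coords j}
  have hYc : ∀ i, IsClosed (Y i) := by
    intro i
    have : Y i = ⋂ (j : Fin d) (_ : i ≤ j), {z : ZariskiSpace (Fin d) |
        MvPolynomial.eval z.coords (MvPolynomial.X j - MvPolynomial.C (z₀.coords j)) ≠ 0}ᶜ := by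
      ext z
      simp [Y, sub_eq_zero]
    rw [this]
    exact isClosed_iInter fun j => isClosed_iInter fun _ =>
      (ZariskiSpace.isOpen_ne _).isClosed_compl
  have hYi : ∀ i, IsPreirreducible (Y i) := by
    intro i
    let pr : ZariskiSpace (Fin d) → ZariskiSpace (Fin d) := fun z j =>
      if i ≤ j then z₀.coords j else z.coords j
    have hpr : Continuous pr := by
      refine continuous_of_isPoly (c := ZariskiSpace.coords) (d := ZariskiSpace.coords) fun j => ?_
      by_cases hj : i ≤ (j : ℕ)
      · simpa [pr, hj, ZariskiSpace.coords] using IsPolyFun.const (c := ZariskiSpace.coords) _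
      · simpa [pr, hj, ZariskiSpace.coords] using
          IsPolyFun.coord (c := ZariskiSpace.coords (ι := Fin d)) j
    have : Y i = pr '' Set.univ := by
      ext z
      simp only [Set.image_univ, Set.mem_range]
      constructor
      · intro hz
        refine ⟨z, funext fun j => ?_⟩
        by_cases hj : i ≤ (j : ℕ)
        · simpa [pr, hj, ZariskiSpace.coords] using (hz j hj).symm
        · simp [pr, hj, ZariskiSpace.coords]
      · rintro ⟨w, rfl⟩ j hj
        simp [pr, hj, ZariskiSpace.coords]
    rw [this]
    exact (PreirreducibleSpace.isPreirreducible_univ).image _ hpr.continuousOn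
  have hz₀Y : ∀ i, z₀ ∈ Y i := fun i j _ => rfl
  let C (i : ℕ) : IrreducibleCloseds U :=
    { carrier := Subtype.val ⁻¹' Y i
      isIrreducible' := ⟨⟨⟨z₀, hz₀⟩, hz₀Y i⟩, (hYi i).preimage hU.isOpenEmbedding_subtypeVal⟩
      isClosed' := (hYc i).preimage continuous_subtype_val }
  have hC : ∀ i : Fin d, C i < C (i + 1) := by
    intro i
    refine lt_of_le_not_ge (fun z hz j hj => hz j (by omega)) fun hle => ?_
    have hne : (Y (i + 1) ∩ {z | MvPolynomial.eval z.coords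
        (MvPolynomial.X i - MvPolynomial.C (z₀.coords i)) ≠ 0}).Nonempty := by
      refine ⟨(Function.update z₀.coords i (z₀.coords i + 1) : Fin d → ℂ), fun j hj => ?_, ?_⟩
      · have : j ≠ i := by rintro rfl; omega
        exact Function.update_of_ne this _ _
      · change MvPolynomial.eval (Function.update z₀.coords i (z₀.coords i + 1)) _ ≠ 0
        simp
    obtain ⟨z, hzY, hzU, hzi⟩ := hYi (i + 1) _ _ hU (ZariskiSpace.isOpen_ne _)
      ⟨z₀, hz₀Y _, hz₀⟩ hne
    have h1 : (⟨z, hzU⟩ : U) ∈ C i := hle (show (⟨z, hzU⟩ : U) ∈ C (i + 1) from hzY)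
    apply hzi
    simp [h1 i le_rfl]
  exact Order.le_krullDim_iff.2 ⟨LTSeries.mk d (fun i => C i)
    (Fin.strictMono_iff_lt_succ.2 fun i => by simpa using hC i), rfl⟩

/-- Dimension of a homogeneous space: it is that of any open part, since a translate of this part
meets the smallest member of a given chain of irreducible closed subsets. -/
theorem topologicalKrullDim_eq_of_isOpenEmbedding {X Y G : Type*} [TopologicalSpace X]
    [TopologicalSpace Y] [Group G] [MulAction G X] [ContinuousConstSMul G X]
    [MulAction.IsPretransitive G X] [Nonempty Y] {f : Y → X} (hf : IsOpenEmbedding f) :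
    topologicalKrullDim X = topologicalKrullDim Y := by
  refine le_antisymm ?_ hf.isInducing.topologicalKrullDim_le
  refine iSup_le fun s => ?_
  obtain ⟨x, hx⟩ := s.head.isIrreducible.nonempty
  obtain ⟨y⟩ := ‹Nonempty Y›
  obtain ⟨g, hg⟩ := MulAction.exists_smul_eq G (f y) x
  have hf' : IsOpenEmbedding fun y => g • f y :=
    (Homeomorph.smul g).isOpenEmbedding.comp hf
  let e := IrreducibleCloseds.orderIsoOfIsOpenEmbedding _ hf'
  have hmem : ∀ i, ((fun y => g • f y) ⁻¹' (s i : Set X)).Nonempty := fun i =>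
    ⟨y, show g • f y ∈ (s i : Set X) by rw [hg]; exact s.head_le i hx⟩
  exact Order.LTSeries.length_le_krullDim (LTSeries.mk s.length (fun i => e.symm ⟨s i, hmem i⟩)
    fun i j hij => e.symm.strictMono (s.strictMono hij))

/-! ### Frames and the topology of the double flag variety -/

section

variable {p q r : ℕ}

theorem isPolyFun_frame_matrix (i : Fin p ⊕ Fin q) (j : Fin r) :
    IsPolyFun (frameCoords (p := p) (q := q) (r := r)) fun f => f.1.1 i j :=
  IsPolyFun.coord (Sum.inl (i, j))

theorem isPolyFun_frame_plus (i j : Fin p) :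
    IsPolyFun (frameCoords (p := p) (q := q) (r := r)) fun f => f.2.1.val i j :=
  IsPolyFun.coord (Sum.inr (Sum.inl (i, j)))

theorem isPolyFun_frame_minus (i j : Fin q) :
    IsPolyFun (frameCoords (p := p) (q := q) (r := r)) fun f => f.2.2.val i j :=
  IsPolyFun.coord (Sum.inr (Sum.inr (i, j)))

/-- Right translation of frames. -/
def FrameSpace.rightMul (h : GL (Fin r) ℂ) (s : GL (Fin p) ℂ) (t : GL (Fin q) ℂ)
    (f : FrameSpace p q r) : FrameSpace p q r :=
  ⟨⟨f.1.1 * h.val, by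
    rw [Matrix.rank_mul_eq_left_of_isUnit_det _ _ ((Matrix.isUnit_iff_isUnit_det _).1 h.isUnit),
      f.1.2]⟩, f.2.1 * s, f.2.2 * t⟩

/-- Left translation of frames by `K`. -/
def FrameSpace.leftMul (k : GL (Fin p) ℂ × GL (Fin q) ℂ)
    (f : FrameSpace p q r) : FrameSpace p q r :=
  ⟨⟨(blockDiagGL p q k).val * f.1.1, by
    rw [Matrix.rank_mul_eq_right_of_isUnit_det _ _
      ((Matrix.isUnit_iff_isUnit_det _).1 (blockDiagGL p q k).isUnit), f.1.2]⟩,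
    k.1 * f.2.1, k.2 * f.2.2⟩

theorem continuous_rightMul (h : GL (Fin r) ℂ) (s : GL (Fin p) ℂ) (t : GL (Fin q) ℂ) :
    @Continuous _ _ (zariskiOf frameCoords) (zariskiOf frameCoords)
      (FrameSpace.rightMul h s t) := by
  refine continuous_of_isPoly ?_
  rintro (⟨i, j⟩ | ⟨i, j⟩ | ⟨i, j⟩)
  · exact IsPolyFun.matrix_mul (B := fun _ => h.val) isPolyFun_frame_matrix
      (fun _ _ => IsPolyFun.const _) i j
  · exact IsPolyFun.matrix_mul (B := fun _ => s.val) isPolyFun_frame_plus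
      (fun _ _ => IsPolyFun.const _) i j
  · exact IsPolyFun.matrix_mul (B := fun _ => t.val) isPolyFun_frame_minus
      (fun _ _ => IsPolyFun.const _) i j

theorem continuous_leftMul (k : GL (Fin p) ℂ × GL (Fin q) ℂ) :
    @Continuous _ _ (zariskiOf frameCoords) (zariskiOf frameCoords)
      (FrameSpace.leftMul (r := r) k) := by
  refine continuous_of_isPoly ?_
  rintro (⟨i, j⟩ | ⟨i, j⟩ | ⟨i, j⟩)
  · exact IsPolyFun.matrix_mul (A := fun _ => (blockDiagGL p q k).val)
      (fun _ _ => IsPolyFun.const _) isPolyFun_frame_matrix i j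
  · exact IsPolyFun.matrix_mul (A := fun _ => k.1.val) (fun _ _ => IsPolyFun.const _)
      isPolyFun_frame_plus i j
  · exact IsPolyFun.matrix_mul (A := fun _ => k.2.val) (fun _ _ => IsPolyFun.const _)
      isPolyFun_frame_minus i j

theorem frameMap_leftMul (k : GL (Fin p) ℂ × GL (Fin q) ℂ) (f : FrameSpace p q r) :
    frameMap (FrameSpace.leftMul k f) = k • frameMap f := by
  apply DoubleFlagVariety.ext
  · change LinearMap.range (Matrix.mulVecLin (_ * _)) = Submodule.map _ (LinearMap.range _)
    rw [Matrix.mulVecLin_mul, LinearMap.range_comp]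
  · exact mul_smul k.1 f.2.1 _
  · exact mul_smul k.2 f.2.2 _

theorem frameMap_rightMul {h : GL (Fin r) ℂ} {s : GL (Fin p) ℂ} {t : GL (Fin q) ℂ}
    (hs : s • stdFlag p = stdFlag p) (ht : t • stdFlag q = stdFlag q) (f : FrameSpace p q r) :
    frameMap (FrameSpace.rightMul h s t f) = frameMap f := by
  apply DoubleFlagVariety.ext
  · change LinearMap.range (Matrix.mulVecLin (_ * _)) = LinearMap.range _
    rw [Matrix.mulVecLin_mul, LinearMap.range_comp, LinearMap.range_eq_top.2, Submodule.map_top]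
    exact Matrix.mulVec_surjective_iff_isUnit.2 h.isUnit
  · change (f.2.1 * s) • stdFlag p = f.2.1 • stdFlag p
    rw [mul_smul, hs]
  · change (f.2.2 * t) • stdFlag q = f.2.2 • stdFlag q
    rw [mul_smul, ht]

theorem Matrix.mulVec_injective_of_rank {m : Type*} [Fintype m] {A : Matrix m (Fin r) ℂ}
    (h : A.rank = r) : Function.Injective A.mulVec := by
  have := A.mulVecLin.finrank_range_add_finrank_ker
  rw [show Module.finrank ℂ (LinearMap.range A.mulVecLin) = r from h, Module.finrank_fin_fun,
    Nat.add_eq_left, Submodule.finrank_eq_zero] at this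
  exact LinearMap.ker_eq_bot.1 this

theorem Matrix.rank_of_mulVec_injective {m : Type*} [Fintype m] {A : Matrix m (Fin r) ℂ}
    (h : Function.Injective A.mulVec) : A.rank = r := by
  have := LinearMap.finrank_range_of_inj (f := A.mulVecLin) h
  rwa [Module.finrank_fin_fun] at this

/-- Two matrices with the same image differ by an invertible matrix, if one has full column rank. -/
theorem Matrix.exists_mul_eq_of_range_eq {m : Type*} [Fintype m] {A B : Matrix m (Fin r) ℂ}
    (hB : B.rank = r)
    (h : LinearMap.range A.mulVecLin = LinearMap.range B.mulVecLin) :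
    ∃ g : GL (Fin r) ℂ, B = A * g.val := by
  have hcol : ∀ j, ∃ v, A.mulVec v = B.col j := by
    intro j
    have : B.col j ∈ LinearMap.range A.mulVecLin := by
      rw [h, Matrix.range_mulVecLin]
      exact Submodule.subset_span ⟨j, rfl⟩
    exact this
  choose v hv using hcol
  let G : Matrix (Fin r) (Fin r) ℂ := Matrix.of fun i j => v j i
  have hG : B = A * G := by
    ext i j
    have := congrFun (hv j) i
    simp only [Matrix.mulVec, dotProduct, Matrix.col_apply] at this
    rw [Matrix.mul_apply, ← this]
    rfl
  have hinj : Function.Injective G.mulVec := by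
    intro x y hxy
    apply Matrix.mulVec_injective_of_rank hB
    rw [hG, ← Matrix.mulVec_mulVec, ← Matrix.mulVec_mulVec, hxy]
  have hu : IsUnit G := Matrix.mulVec_injective_iff_isUnit.1 hinj
  exact ⟨hu.unit, hG⟩

/-- The fibres of `frameMap` are contained in the orbits of the translations that it ignores. -/
theorem exists_rightMul_of_frameMap_eq {f f' : FrameSpace p q r} (h : frameMap f = frameMap f') :
    ∃ (g : GL (Fin r) ℂ) (s : GL (Fin p) ℂ) (t : GL (Fin q) ℂ), s • stdFlag p = stdFlag p ∧
      t • stdFlag q = stdFlag q ∧ f' = FrameSpace.rightMul g s t f := by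
  obtain ⟨g, hg⟩ := Matrix.exists_mul_eq_of_range_eq f'.1.2
    (congrArg DoubleFlagVariety.W h)
  have h1 : f.2.1 • stdFlag p = f'.2.1 • stdFlag p := congrArg DoubleFlagVariety.Fplus h
  have h2 : f.2.2 • stdFlag q = f'.2.2 • stdFlag q := congrArg DoubleFlagVariety.Fminus h
  refine ⟨g, f.2.1⁻¹ * f'.2.1, f.2.2⁻¹ * f'.2.2, ?_, ?_, ?_⟩
  · rw [mul_smul, ← h1, inv_smul_smul]
  · rw [mul_smul, ← h2, inv_smul_smul]
  · refine Prod.ext (Subtype.ext hg) (Prod.ext ?_ ?_)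
    · exact (mul_inv_cancel_left _ _).symm
    · exact (mul_inv_cancel_left _ _).symm

theorem continuous_frameMap :
    @Continuous _ _ (zariskiOf frameCoords) _ (frameMap (p := p) (q := q) (r := r)) :=
  continuous_coinduced_rng

/-- The quotient map from frames is open, since its fibres are orbits of a group acting by
homeomorphisms. -/
theorem isOpenMap_frameMap :
    @IsOpenMap _ _ (zariskiOf frameCoords) _ (frameMap (p := p) (q := q) (r := r)) := by
  let _ := zariskiOf (frameCoords (p := p) (q := q) (r := r))
  intro U hU
  change IsOpen (frameMap ⁻¹' (frameMap '' U))
  have : frameMap ⁻¹' (frameMap '' U) = ⋃ (g : GL (Fin r) ℂ) (s : GL (Fin p) ℂ)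
      (t : GL (Fin q) ℂ) (_ : s • stdFlag p = stdFlag p) (_ : t • stdFlag q = stdFlag q),
      FrameSpace.rightMul g s t ⁻¹' U := by
    ext f
    simp only [Set.mem_preimage, Set.mem_image, Set.mem_iUnion]
    constructor
    · rintro ⟨f', hf', h⟩
      obtain ⟨g, s, t, hs, ht, rfl⟩ := exists_rightMul_of_frameMap_eq h.symm
      exact ⟨g, s, t, hs, ht, hf'⟩
    · rintro ⟨g, s, t, hs, ht, hf⟩
      exact ⟨_, hf, frameMap_rightMul hs ht f⟩
  rw [this]
  exact isOpen_iUnion fun g => isOpen_iUnion fun s => isOpen_iUnion fun t =>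
    isOpen_iUnion fun _ => isOpen_iUnion fun _ => hU.preimage (continuous_rightMul g s t)

instance : ContinuousConstSMul (GL (Fin p) ℂ × GL (Fin q) ℂ) (DoubleFlagVariety p q r) := by
  refine ⟨fun k => ?_⟩
  let _ := zariskiOf (frameCoords (p := p) (q := q) (r := r))
  refine continuous_coinduced_dom.2 ?_
  have : (fun x => k • x) ∘ frameMap (p := p) (q := q) (r := r) =
      frameMap ∘ FrameSpace.leftMul k := funext fun f => (frameMap_leftMul k f).symm
  rw [this]
  exact continuous_frameMap.comp (continuous_leftMul k)

/-! ### Semicontinuity of the dimensions of intersections -/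

/-- Lower semicontinuity of the rank: independence of `k` combinations of the columns is an open
condition. -/
theorem IsPolyFun.isOpen_le_rank {α : Type*} {ι : Type} {c : α → ι → ℂ} {m n : Type*} [Fintype m]
    [Fintype n] {M : α → Matrix m n ℂ} (hM : ∀ i j, IsPolyFun c fun a => M a i j) (k : ℕ) :
    IsOpen[zariskiOf c] {a | k ≤ (M a).rank} := by
  let _ := zariskiOf c
  rw [isOpen_iff_forall_mem_open]
  intro a₀ ha₀
  have hex : ∃ R : Matrix n (Fin k) ℂ, Function.Injective (M a₀ * R).mulVec := by
    have hk : k ≤ Module.finrank ℂ (LinearMap.range (M a₀).mulVecLin) := ha₀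
    obtain ⟨f, hf⟩ := exists_linearIndependent_of_le_finrank hk
    choose v hv using fun i => (f i).2
    refine ⟨Matrix.of fun i j => v j i, ?_⟩
    rw [Matrix.mulVec_injective_iff]
    have : LinearIndependent ℂ fun i => ((f i : LinearMap.range (M a₀).mulVecLin) : m → ℂ) :=
      hf.map' (Submodule.subtype _) (Submodule.ker_subtype _)
    have heq : (M a₀ * Matrix.of fun i j => v j i).col =
        fun i => ((f i : LinearMap.range (M a₀).mulVecLin) : m → ℂ) := by
      funext j
      rw [← hv j]
      ext i
      simp [Matrix.mul_apply, Matrix.mulVec, dotProduct]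
    rw [heq]
    exact this
  obtain ⟨R, hR⟩ := hex
  obtain ⟨Q, N, hQ, -, hQ₀, h⟩ := IsPolyFun.exists_linear_solution (C := fun a => M a * R)
    (v := fun _ _ => 0)
    (IsPolyFun.matrix_mul hM fun _ _ => IsPolyFun.const _) (fun _ => IsPolyFun.const 0) hR
  refine ⟨{a | Q a ≠ 0}, fun a ha => ?_, hQ.isOpen, hQ₀⟩
  change k ≤ _
  rw [← Matrix.rank_of_mulVec_injective (h a ha).1]
  exact Matrix.rank_mul_le_left _ _

theorem flagSum_smul (k : GL (Fin p) ℂ × GL (Fin q) ℂ) (x : DoubleFlagVariety p q r)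
    (i : Fin (p + 1)) (j : Fin (q + 1)) :
    (k • x).flagSum i j = (x.flagSum i j).map (blockDiagGL p q k).val.mulVecLin := by
  have h1 : inclPlus p q ∘ₗ k.1.val.mulVecLin =
      (blockDiagGL p q k).val.mulVecLin ∘ₗ inclPlus p q := by
    ext v (a | a) <;> simp [inclPlus, blockDiagGL]
  have h2 : inclMinus p q ∘ₗ k.2.val.mulVecLin =
      (blockDiagGL p q k).val.mulVecLin ∘ₗ inclMinus p q := by
    ext v (a | a) <;> simp [inclMinus, blockDiagGL]
  change ((x.Fplus.space i).map k.1.val.mulVecLin).map (inclPlus p q) ⊔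
    ((x.Fminus.space j).map k.2.val.mulVecLin).map (inclMinus p q) = _
  rw [← Submodule.map_comp, ← Submodule.map_comp, h1, h2, Submodule.map_comp, Submodule.map_comp,
    ← Submodule.map_sup]
  rfl

theorem finrank_smul_inf (k : GL (Fin p) ℂ × GL (Fin q) ℂ) (x : DoubleFlagVariety p q r)
    (i : Fin (p + 1)) (j : Fin (q + 1)) :
    Module.finrank ℂ ((k • x).W ⊓ (k • x).flagSum i j : Submodule ℂ (Fin p ⊕ Fin q → ℂ)) =
      Module.finrank ℂ (x.W ⊓ x.flagSum i j : Submodule ℂ (Fin p ⊕ Fin q → ℂ)) := by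
  rw [flagSum_smul]
  change Module.finrank ℂ (x.W.map (blockDiagGL p q k).val.mulVecLin ⊓ _ : Submodule ℂ _) = _
  rw [← Submodule.map_inf _ (Matrix.mulVec_injective_iff_isUnit.2 (blockDiagGL p q k).isUnit),
    finrank_map_mulVecLin]

theorem inclPlus_injective (p q : ℕ) : Function.Injective (inclPlus p q) := fun v w h => by
  ext a; simpa [inclPlus] using congrFun h (Sum.inl a)

theorem inclMinus_injective (p q : ℕ) : Function.Injective (inclMinus p q) := fun v w h => by
  ext a; simpa [inclMinus] using congrFun h (Sum.inr a)

theorem finrank_flagSum (x : DoubleFlagVariety p q r) (i : Fin (p + 1)) (j : Fin (q + 1)) :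
    Module.finrank ℂ (x.flagSum i j) = i + j := by
  have h := Submodule.finrank_sup_add_finrank_inf_eq ((x.Fplus.space i).map (inclPlus p q))
    ((x.Fminus.space j).map (inclMinus p q))
  have hinf : (x.Fplus.space i).map (inclPlus p q) ⊓
      (x.Fminus.space j).map (inclMinus p q) = ⊥ := by
    rw [eq_bot_iff]
    rintro _ ⟨⟨v, -, rfl⟩, ⟨w, -, hw⟩⟩
    have hv : v = 0 := by
      ext a
      simpa [inclPlus, inclMinus] using (congrFun hw (Sum.inl a)).symm
    simp [hv]
  rw [hinf, finrank_bot, add_zero,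
    ← (Submodule.equivMapOfInjective _ (inclPlus_injective p q) _).finrank_eq,
    ← (Submodule.equivMapOfInjective _ (inclMinus_injective p q) _).finrank_eq,
    x.Fplus.finrank_eq, x.Fminus.finrank_eq] at h
  exact h

theorem mem_stdFlag_iff {n : ℕ} {i : Fin (n + 1)} {v : Fin n → ℂ} :
    v ∈ (stdFlag n).space i ↔ ∀ k : Fin n, (i : ℕ) ≤ k → v k = 0 := by
  constructor
  · intro hv
    change v ∈ Submodule.span ℂ _ at hv
    induction hv using Submodule.span_induction with
    | mem x hx =>
      obtain ⟨l, rfl⟩ := hx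
      intro k hk
      refine Pi.single_eq_of_ne (fun h => ?_) _
      have := l.2
      subst h
      omega
    | zero => simp
    | add x y _ _ hx hy => intro k hk; simp [hx k hk, hy k hk]
    | smul a x _ hx => intro k hk; simp [hx k hk]
  · intro h
    have : v = ∑ k, v k • (Pi.single k 1 : Fin n → ℂ) := by
      ext a
      simp [Finset.sum_apply, Pi.single_apply]
    rw [this]
    refine Submodule.sum_mem _ fun k _ => ?_
    by_cases hk : (i : ℕ) ≤ k
    · simp [h k hk]
    · exact Submodule.smul_mem _ _ (Submodule.subset_span ⟨⟨k, not_le.1 hk⟩, rfl⟩)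

theorem mem_flagSum_iff_of_std {x : DoubleFlagVariety p q r} (hp : x.Fplus = stdFlag p)
    (hq : x.Fminus = stdFlag q) {i : Fin (p + 1)} {j : Fin (q + 1)} {v : Fin p ⊕ Fin q → ℂ} :
    v ∈ x.flagSum i j ↔ (∀ k : Fin p, (i : ℕ) ≤ k → v (Sum.inl k) = 0) ∧
      ∀ k : Fin q, (j : ℕ) ≤ k → v (Sum.inr k) = 0 := by
  rw [DoubleFlagVariety.flagSum, Submodule.mem_sup, hp, hq]
  constructor
  · rintro ⟨_, ⟨a, ha, rfl⟩, _, ⟨b, hb, rfl⟩, rfl⟩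
    exact ⟨fun k hk => by simpa [inclPlus, inclMinus] using mem_stdFlag_iff.1 ha k hk,
      fun k hk => by simpa [inclPlus, inclMinus] using mem_stdFlag_iff.1 hb k hk⟩
  · rintro ⟨h1, h2⟩
    refine ⟨_, ⟨fun a => v (Sum.inl a), mem_stdFlag_iff.2 h1, rfl⟩, _,
      ⟨fun a => v (Sum.inr a), mem_stdFlag_iff.2 h2, rfl⟩, ?_⟩
    ext (a | a) <;> simp [inclPlus, inclMinus]

/-- The matrix with columns those of `A` and the first ones of `g₁` and `g₂`; its image is the sum
of the subspace and of a step of the flags. -/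
noncomputable def FrameSpace.sumMatrix (i : Fin (p + 1)) (j : Fin (q + 1)) (f : FrameSpace p q r) :
    Matrix (Fin p ⊕ Fin q) (Fin r ⊕ (Fin p ⊕ Fin q)) ℂ :=
  Matrix.fromCols f.1.1 ((blockDiagGL p q f.2).val * Matrix.diagonal
    (Sum.elim (fun k : Fin p => if (k : ℕ) < i then 1 else 0)
      fun k : Fin q => if (k : ℕ) < j then 1 else 0))

theorem range_sumMatrix (i : Fin (p + 1)) (j : Fin (q + 1)) (f : FrameSpace p q r) :
    LinearMap.range (f.sumMatrix i j).mulVecLin = (frameMap f).W ⊔ (frameMap f).flagSum i j := by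
  obtain ⟨A, g⟩ := f
  let x : DoubleFlagVariety p q r := ⟨_, A.2, stdFlag p, stdFlag q⟩
  have hx : (frameMap (A, g)).flagSum i j = (x.flagSum i j).map (blockDiagGL p q g).val.mulVecLin :=
    flagSum_smul g x i j
  have hdiag : LinearMap.range (Matrix.diagonal
      (Sum.elim (fun k : Fin p => if (k : ℕ) < i then (1 : ℂ) else 0)
      fun k : Fin q => if (k : ℕ) < j then (1 : ℂ) else 0)).mulVecLin = x.flagSum i j := by
    ext v
    rw [mem_flagSum_iff_of_std rfl rfl]
    constructor
    · rintro ⟨w, rfl⟩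
      refine ⟨fun k hk => ?_, fun k hk => ?_⟩ <;>
        simp [Matrix.mulVec_diagonal, not_lt.2 hk]
    · rintro ⟨h1, h2⟩
      refine ⟨v, ?_⟩
      ext (k | k)
      · by_cases hk : (k : ℕ) < i
        · simp [Matrix.mulVec_diagonal, hk]
        · simp [Matrix.mulVec_diagonal, hk, h1 k (not_lt.1 hk)]
      · by_cases hk : (k : ℕ) < j
        · simp [Matrix.mulVec_diagonal, hk]
        · simp [Matrix.mulVec_diagonal, hk, h2 k (not_lt.1 hk)]
  rw [hx, ← hdiag, ← LinearMap.range_comp, ← Matrix.mulVecLin_mul]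
  ext v
  rw [Submodule.mem_sup]
  constructor
  · rintro ⟨w, rfl⟩
    refine ⟨_, ⟨w ∘ Sum.inl, rfl⟩, _, ⟨w ∘ Sum.inr, rfl⟩, ?_⟩
    exact (Matrix.fromCols_mulVec _ _ _).symm
  · rintro ⟨_, ⟨a, rfl⟩, _, ⟨b, rfl⟩, rfl⟩
    exact ⟨Sum.elim a b, Matrix.fromCols_mulVec_sumElim A.1 _ a b⟩

/-- The dimension of `W ∩ (F⁺ᵢ + F⁻ⱼ)` is upper semicontinuous. -/
theorem isClosed_le_finrank_inf (i : Fin (p + 1)) (j : Fin (q + 1)) (k : ℕ) :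
    IsClosed {x : DoubleFlagVariety p q r |
      k ≤ Module.finrank ℂ (x.W ⊓ x.flagSum i j : Submodule ℂ (Fin p ⊕ Fin q → ℂ))} := by
  let _ := zariskiOf (frameCoords (p := p) (q := q) (r := r))
  rw [← isOpen_compl_iff]
  refine isOpen_coinduced.2 ?_
  have hpoly : ∀ a b, IsPolyFun (frameCoords (p := p) (q := q) (r := r))
      fun f => f.sumMatrix i j a b := by
    rintro a (b | b)
    · exact isPolyFun_frame_matrix a b
    · refine IsPolyFun.matrix_mul (A := fun f : FrameSpace p q r => (blockDiagGL p q f.2).val)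
        (B := fun _ => Matrix.diagonal _) ?_ (fun _ _ => IsPolyFun.const _) a b
      rintro (a | a) (b | b)
      · exact isPolyFun_frame_plus a b
      · exact IsPolyFun.const 0
      · exact IsPolyFun.const 0
      · exact isPolyFun_frame_minus a b
  convert IsPolyFun.isOpen_le_rank hpoly (r + (i + j) + 1 - k) using 1
  ext f
  have h := Submodule.finrank_sup_add_finrank_inf_eq (frameMap f).W ((frameMap f).flagSum i j)
  rw [finrank_flagSum, (frameMap f).finrank_W, ← range_sumMatrix] at h
  change ¬ (k ≤ _) ↔ _ ≤ Module.finrank ℂ (LinearMap.range (f.sumMatrix i j).mulVecLin)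
  omega

end

/-! ### Patterns and their rank functions -/

/-- A pattern encodes a pair of partial permutations: the column `k` with its `1`s in rows `i` and
`j` of the two blocks is encoded by `T k = (i + 1, j + 1)`, an entry `0` standing for a block
without `1`. -/
structure IsPattern (p q : ℕ) {r : ℕ} (T : Fin r → ℕ × ℕ) : Prop where
  fst_le : ∀ k, (T k).1 ≤ p
  snd_le : ∀ k, (T k).2 ≤ q
  ne_zero : ∀ k, T k ≠ (0, 0)
  fst_inj : ∀ k k', (T k).1 ≠ 0 → (T k).1 = (T k').1 → k = k'
  snd_inj : ∀ k k', (T k).2 ≠ 0 → (T k).2 = (T k').2 → k = k'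

/-- The number of columns of a pattern contained within the first `i` and the first `j` vertices. -/
def patRank {r : ℕ} (T : Fin r → ℕ × ℕ) (i j : ℕ) : ℕ :=
  (Finset.univ.filter fun k => (T k).1 ≤ i ∧ (T k).2 ≤ j).card

/-- The elementary degenerations of patterns: uncrossing two columns, or lowering one end of a
column. -/
inductive PatStep {r : ℕ} (T : Fin r → ℕ × ℕ) : (Fin r → ℕ × ℕ) → Prop
  | swap (k k' : Fin r) (a a' b b' : ℕ) (hk : k ≠ k') (h : T k = (a, b)) (h' : T k' = (a', b'))
      (ha : a < a') (hb : b' < b) :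
      PatStep T (Function.update (Function.update T k (a, b')) k' (a', b))
  | snd (k : Fin r) (a b b' : ℕ) (h : T k = (a, b)) (hb : b' < b) :
      PatStep T (Function.update T k (a, b'))
  | fst (k : Fin r) (a a' b : ℕ) (h : T k = (a', b)) (ha : a < a') :
      PatStep T (Function.update T k (a, b))

section

variable {p q r : ℕ} {S T : Fin r → ℕ × ℕ}

theorem IsPattern.injective (hT : IsPattern p q T) : Function.Injective T := by
  intro k k' h
  by_cases h1 : (T k).1 = 0
  · have h2 : (T k).2 ≠ 0 := fun h2 => hT.ne_zero k (Prod.ext h1 h2)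
    exact hT.snd_inj k k' h2 (congrArg Prod.snd h)
  · exact hT.fst_inj k k' h1 (congrArg Prod.fst h)

theorem patRank_eq_card_image (hT : Function.Injective T) (i j : ℕ) :
    patRank T i j = ((Finset.univ.image T).filter fun x => x.1 ≤ i ∧ x.2 ≤ j).card := by
  rw [Finset.filter_image, Finset.card_image_of_injective _ hT, patRank]

theorem patRank_update (k : Fin r) (x : ℕ × ℕ) (i j : ℕ) :
    patRank (Function.update T k x) i j + (if (T k).1 ≤ i ∧ (T k).2 ≤ j then 1 else 0) =
      patRank T i j + if x.1 ≤ i ∧ x.2 ≤ j then 1 else 0 := by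
  simp only [patRank, Finset.card_filter]
  rw [← Finset.add_sum_erase _ _ (Finset.mem_univ k),
    ← Finset.add_sum_erase _ _ (Finset.mem_univ k)]
  rw [Function.update_self, Finset.sum_congr rfl fun l hl => by
    rw [Function.update_of_ne (Finset.ne_of_mem_erase hl)]]
  omega

theorem patRank_min (hT : IsPattern p q T) (i j : ℕ) :
    patRank T (min i p) (min j q) = patRank T i j := by
  unfold patRank
  congr 1
  ext k
  have := hT.fst_le k
  have := hT.snd_le k
  simp only [Finset.mem_filter, Finset.mem_univ, true_and]
  omega

theorem patRank_top (hT : IsPattern p q T) : patRank T p q = r := by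
  unfold patRank
  rw [Finset.filter_true_of_mem fun k _ => ⟨hT.fst_le k, hT.snd_le k⟩, Finset.card_fin]

/-- Where two patterns agree in the rows above `a`, while the second one has a point `(a, s)` and
the first one has no point in a rectangle with that corner, the rank functions differ strictly. -/
theorem patRank_lt_of_no_point (hS : IsPattern p q S) (hT : IsPattern p q T)
    (hle : ∀ i j, patRank T i j ≤ patRank S i j) {a s : ℕ}
    (hrow : ∀ x b, x < a → ((x, b) ∈ Set.range S ↔ (x, b) ∈ Set.range T))
    (has : (a, s) ∈ Set.range S) {i j : ℕ} (hi : a ≤ i) (hj : s ≤ j)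
    (hno : ∀ k, a ≤ (T k).1 → (T k).1 ≤ i → s ≤ (T k).2 → (T k).2 ≤ j → False) :
    patRank T i j < patRank S i j := by
  rw [patRank_eq_card_image hT.injective, patRank_eq_card_image hS.injective]
  set P := Finset.univ.image S with hP
  set R := Finset.univ.image T with hR
  have hPm : ∀ x, x ∈ P ↔ x ∈ Set.range S := by simp [hP]
  have hRm : ∀ x, x ∈ R ↔ x ∈ Set.range T := by simp [hR]
  let A := P.filter fun x => x.1 < a ∧ s ≤ x.2 ∧ x.2 ≤ j
  let B := P.filter fun x => x.1 ≤ i ∧ x.2 < s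
  let C := R.filter fun x => x.1 ≤ i ∧ x.2 < s
  have hBC : C.card ≤ B.card := by
    rcases Nat.eq_zero_or_pos s with rfl | hs
    · simp [C]
    · have := hle i (s - 1)
      rw [patRank_eq_card_image hT.injective, patRank_eq_card_image hS.injective] at this
      convert this using 4 <;> omega
  have h1 : (R.filter fun x => x.1 ≤ i ∧ x.2 ≤ j) ⊆ A ∪ C := by
    intro x hx
    obtain ⟨hxR, hxi, hxj⟩ := Finset.mem_filter.1 hx
    obtain ⟨k, rfl⟩ := (hRm x).1 hxR
    by_cases hxs : (T k).2 < s
    · exact Finset.mem_union_right _ (Finset.mem_filter.2 ⟨hxR, hxi, hxs⟩)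
    · have hxa : (T k).1 < a := by
        by_contra hxa
        exact hno k (by omega) hxi (by omega) hxj
      refine Finset.mem_union_left _ (Finset.mem_filter.2 ⟨?_, hxa, by omega, hxj⟩)
      exact (hPm _).2 ((hrow _ _ hxa).2 ⟨k, rfl⟩)
  have h2 : insert (a, s) (A ∪ B) ⊆ P.filter fun x => x.1 ≤ i ∧ x.2 ≤ j := by
    intro x hx
    simp only [A, B, Finset.mem_insert, Finset.mem_union, Finset.mem_filter] at hx ⊢
    rcases hx with rfl | ⟨h, h'⟩ | ⟨h, h'⟩
    · exact ⟨(hPm _).2 has, hi, hj⟩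
    · exact ⟨h, by omega, by omega⟩
    · exact ⟨h, by omega, by omega⟩
  have h3 : (a, s) ∉ A ∪ B := by simp [A, B]
  have h4 : Disjoint A B := by
    rw [Finset.disjoint_left]
    intro x hx hx'
    simp only [A, B, Finset.mem_filter] at hx hx'
    omega
  have h5 := Finset.card_le_card h1
  have h6 := Finset.card_le_card h2
  have h7 := Finset.card_union_le A C
  rw [Finset.card_insert_of_notMem h3, Finset.card_union_of_disjoint h4] at h6
  omega

/-- If the rank function of `S` dominates that of `T`, then some elementary degeneration of `T`
is still dominated by `S`. -/
theorem exists_patStep (hS : IsPattern p q S) (hT : IsPattern p q T)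
    (hle : ∀ i j, patRank T i j ≤ patRank S i j) (hne : Set.range S ≠ Set.range T) :
    ∃ T', IsPattern p q T' ∧ PatStep T T' ∧ (∀ i j, patRank T' i j ≤ patRank S i j) ∧
      (∀ i j, patRank T i j ≤ patRank T' i j) ∧
      ∃ i ≤ p, ∃ j ≤ q, patRank T i j < patRank T' i j := by
  classical
  -- `a` is the first row where the patterns differ, and `(a, s)` the first place there
  have hex : ∃ a, ∃ b, ¬((a, b) ∈ Set.range S ↔ (a, b) ∈ Set.range T) := by
    by_contra! h
    exact hne (Set.ext fun x => h x.1 x.2)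
  obtain ⟨a, hex', hrow⟩ : ∃ a, (∃ b, ¬((a, b) ∈ Set.range S ↔ (a, b) ∈ Set.range T)) ∧
      ∀ x b, x < a → ((x, b) ∈ Set.range S ↔ (x, b) ∈ Set.range T) :=
    ⟨Nat.find hex, Nat.find_spec hex, fun x b hx => by
      have := Nat.find_min hex hx
      push Not at this
      exact this b⟩
  obtain ⟨s, hs, hcol⟩ : ∃ s, ¬((a, s) ∈ Set.range S ↔ (a, s) ∈ Set.range T) ∧
      ∀ b, b < s → ((a, b) ∈ Set.range S ↔ (a, b) ∈ Set.range T) :=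
    ⟨Nat.find hex', Nat.find_spec hex', fun b hb => not_not.1 (Nat.find_min hex' hb)⟩
  have hsT : (a, s) ∉ Set.range T := by
    intro hsT
    have hsS : (a, s) ∉ Set.range S := fun h => hs (by simp only [h, hsT])
    have h := hle a s
    rw [patRank_eq_card_image hT.injective, patRank_eq_card_image hS.injective] at h
    refine absurd (Finset.card_lt_card (Finset.ssubset_iff_subset_ne.2 ⟨?_, ?_⟩)) (not_lt.2 h)
    · intro x hx
      obtain ⟨x, y⟩ := x
      simp only [Finset.mem_filter, Finset.mem_image, Finset.mem_univ, true_and] at hx ⊢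
      obtain ⟨hx, hxa, hxs⟩ := hx
      refine ⟨?_, hxa, hxs⟩
      rcases hxa.lt_or_eq with h | rfl
      · exact (hrow x y h).1 hx
      · rcases hxs.lt_or_eq with h | rfl
        · exact (hcol y h).1 hx
        · exact absurd hx hsS
    · intro heq
      have : (a, s) ∈ (Finset.univ.image S).filter fun x => x.1 ≤ a ∧ x.2 ≤ s := by
        rw [heq]
        simpa using hsT
      exact hsS (by simpa using this)
  have hsS : (a, s) ∈ Set.range S := by tauto
  obtain ⟨k₀, hk₀⟩ := hsS
  have ha : a ≤ p := by have := hS.fst_le k₀; rwa [hk₀] at this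
  have hsq : s ≤ q := by have := hS.snd_le k₀; rwa [hk₀] at this
  have h00 : a = 0 → s ≠ 0 := by
    rintro rfl rfl
    exact hS.ne_zero k₀ hk₀
  -- `t` is the next entry of `T` in row `a`, or a value beyond all entries
  obtain ⟨t, hst, htno, ht⟩ : ∃ t, s < t ∧ (∀ k, (T k).1 = a → s ≤ (T k).2 → t ≤ (T k).2) ∧
      ((a, t) ∈ Set.range T ∨ q < t) := by
    by_cases h : ∃ b, s < b ∧ (a, b) ∈ Set.range T
    · refine ⟨Nat.find h, (Nat.find_spec h).1, fun k hk hk' => ?_, Or.inl (Nat.find_spec h).2⟩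
      refine Nat.find_min' h ⟨lt_of_le_of_ne hk' fun he => hsT ⟨k, ?_⟩, k, ?_⟩
      · exact Prod.ext hk he.symm
      · exact Prod.ext hk rfl
    · push Not at h
      refine ⟨q + 1, by omega, fun k hk hk' => ?_, Or.inr (by omega)⟩
      exfalso
      refine h (T k).2 (lt_of_le_of_ne hk' fun he => hsT ⟨k, ?_⟩) ⟨k, Prod.ext hk rfl⟩
      exact Prod.ext hk he.symm
  -- `a'` is the first row below `a` with an entry of `T` in the columns from `s` to `t`
  obtain ⟨a', haa', hno, ha'⟩ : ∃ a', a < a' ∧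
      (∀ k, a < (T k).1 → s ≤ (T k).2 → (T k).2 < t → a' ≤ (T k).1) ∧
      ((∃ b, s ≤ b ∧ b < t ∧ (a', b) ∈ Set.range T) ∨ p < a') := by
    by_cases h : ∃ x, a < x ∧ ∃ b, s ≤ b ∧ b < t ∧ (x, b) ∈ Set.range T
    · exact ⟨Nat.find h, (Nat.find_spec h).1, fun k h1 h2 h3 =>
        Nat.find_min' h ⟨h1, _, h2, h3, k, rfl⟩, Or.inl (Nat.find_spec h).2⟩
    · push Not at h
      exact ⟨p + 1, by omega, fun k h1 h2 h3 => absurd ⟨k, rfl⟩ (h _ h1 _ h2 h3), Or.inr (by omega)⟩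
  have hlt : ∀ i j, a ≤ i → i < a' → s ≤ j → j < t → patRank T i j < patRank S i j := by
    intro i j hi hi' hj hj'
    refine patRank_lt_of_no_point hS hT hle hrow ⟨k₀, hk₀⟩ hi hj fun k h1 h2 h3 h4 => ?_
    rcases h1.eq_or_lt with h1 | h1
    · have := htno k h1.symm h3
      omega
    · have := hno k h1 h3 (by omega)
      omega
  -- `T` has entries `(a, t)` and `(a', b')`, which are uncrossed, or one of them, which is lowered
  rcases ht with ⟨k, hk⟩ | ht <;> rcases ha' with ⟨b', hsb', hb't, k', hk'⟩ | ha'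
  · have hkk : k ≠ k' := by
      rintro rfl
      rw [hk] at hk'
      simp only [Prod.mk.injEq] at hk'
      omega
    have hrk : ∀ i j, patRank (Function.update (Function.update T k (a, b')) k' (a', t)) i j =
        patRank T i j + if a ≤ i ∧ i < a' ∧ b' ≤ j ∧ j < t then 1 else 0 := by
      intro i j
      have h1 := patRank_update (T := T) k (a, b') i j
      have h2 := patRank_update (T := Function.update T k (a, b')) k' (a', t) i j
      rw [Function.update_of_ne hkk.symm, hk'] at h2
      rw [hk] at h1
      dsimp only at h1 h2
      split_ifs at h1 h2 ⊢ <;> omega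
    have hval : ∀ l, Function.update (Function.update T k (a, b')) k' (a', t) l =
        if l = k' then (a', t) else if l = k then (a, b') else T l := by
      intro l
      simp only [Function.update_apply]
    refine ⟨_, ⟨fun l => ?_, fun l => ?_, fun l => ?_, fun l m => ?_, fun l m => ?_⟩,
      PatStep.swap k k' a a' t b' hkk hk hk' haa' hb't, fun i j => ?_, fun i j => ?_,
      a, ha, b', ?_, ?_⟩
    · have h1 := hT.fst_le k'
      have h2 := hT.fst_le l
      rw [hk'] at h1
      rw [hval]
      split_ifs
      exacts [h1, ha, h2]
    · have h1 := hT.snd_le k'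
      have h2 := hT.snd_le l
      have h3 := hT.snd_le k
      rw [hk'] at h1
      rw [hk] at h3
      rw [hval]
      split_ifs
      exacts [h3, h1, h2]
    · have h2 := hT.ne_zero l
      rw [hval]
      split_ifs
      · simp only [ne_eq, Prod.mk.injEq]; omega
      · simp only [ne_eq, Prod.mk.injEq]; omega
      · exact h2
    · have h1 : ∀ l, (Function.update (Function.update T k (a, b')) k' (a', t) l).1 = (T l).1 := by
        intro l
        rw [hval]
        split_ifs with h h'
        · rw [h, hk']
        · rw [h', hk]
        · rfl
      rw [h1, h1]
      exact hT.fst_inj l m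
    · have h1 : ∀ l, (Function.update (Function.update T k (a, b')) k' (a', t) l).2 =
          (T (Equiv.swap k k' l)).2 := by
        intro l
        rw [hval]
        split_ifs with h h'
        · rw [h, Equiv.swap_apply_right, hk]
        · rw [h', Equiv.swap_apply_left, hk']
        · rw [Equiv.swap_apply_of_ne_of_ne h' h]
      rw [h1, h1]
      exact fun h h' => (Equiv.swap k k').injective (hT.snd_inj _ _ h h')
    · rw [hrk]
      split_ifs with h
      · exact hlt i j h.1 h.2.1 (by omega) h.2.2.2
      · exact hle i j
    · rw [hrk]; omega
    · have := hT.snd_le k'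
      rwa [hk'] at this
    · rw [hrk, if_pos ⟨le_rfl, haa', le_rfl, hb't⟩]
      omega
  · have hrk : ∀ i j, patRank (Function.update T k (a, s)) i j =
        patRank T i j + if a ≤ i ∧ s ≤ j ∧ j < t then 1 else 0 := by
      intro i j
      have h1 := patRank_update (T := T) k (a, s) i j
      rw [hk] at h1
      dsimp only at h1
      split_ifs at h1 ⊢ <;> omega
    have hcolfree : ∀ l, s ≠ 0 → (T l).2 ≠ s := by
      intro l hs0 hl
      rcases lt_trichotomy (T l).1 a with h | h | h
      · obtain ⟨m, hm⟩ := (hrow _ s h).2 ⟨l, Prod.ext rfl hl⟩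
        have : m = k₀ := hS.snd_inj m k₀ (by rw [hm]; exact hs0) (by rw [hm, hk₀])
        rw [this, hk₀] at hm
        simp only [Prod.mk.injEq] at hm
        omega
      · exact hsT ⟨l, Prod.ext h hl⟩
      · have h1 := hno l h (by omega) (by omega)
        have h2 := hT.fst_le l
        omega
    have hval : ∀ l, Function.update T k (a, s) l = if l = k then (a, s) else T l := by
      intro l
      simp only [Function.update_apply]
    refine ⟨_, ⟨fun l => ?_, fun l => ?_, fun l => ?_, fun l m => ?_, fun l m h h' => ?_⟩,
      PatStep.snd k a t s hk hst, fun i j => ?_, fun i j => ?_, a, ha, s, hsq, ?_⟩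
    · have h2 := hT.fst_le l
      rw [hval]
      split_ifs
      exacts [ha, h2]
    · have h2 := hT.snd_le l
      rw [hval]
      split_ifs
      exacts [hsq, h2]
    · have h2 := hT.ne_zero l
      rw [hval]
      split_ifs
      · simp only [ne_eq, Prod.mk.injEq]; omega
      · exact h2
    · have h1 : ∀ l, (Function.update T k (a, s) l).1 = (T l).1 := by
        intro l
        rw [hval]
        split_ifs with h
        · rw [h, hk]
        · rfl
      rw [h1, h1]
      exact hT.fst_inj l m
    · rw [hval] at h h'
      rw [hval] at h'
      split_ifs at h h' with h1 h2 h2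
      · rw [h1, h2]
      · exact absurd h'.symm (hcolfree m h)
      · exact absurd h' (hcolfree l (by rwa [h'] at h))
      · exact hT.snd_inj l m h h'
    · rw [hrk]
      split_ifs with h
      · rw [← patRank_min hS, ← patRank_min hT]
        exact hlt _ _ (by omega) (by omega) (by omega) (by omega)
      · exact hle i j
    · rw [hrk]; omega
    · rw [hrk, if_pos ⟨le_rfl, le_rfl, hst⟩]
      omega
  · have hrk : ∀ i j, patRank (Function.update T k' (a, b')) i j =
        patRank T i j + if a ≤ i ∧ i < a' ∧ b' ≤ j then 1 else 0 := by
      intro i j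
      have h1 := patRank_update (T := T) k' (a, b') i j
      rw [hk'] at h1
      dsimp only at h1
      split_ifs at h1 ⊢ <;> omega
    have hrowfree : ∀ l, a ≠ 0 → (T l).1 ≠ a := by
      intro l ha0 hl
      rcases lt_or_ge (T l).2 s with h | h
      · obtain ⟨m, hm⟩ := (hcol _ h).2 ⟨l, Prod.ext hl rfl⟩
        have : m = k₀ := hS.fst_inj m k₀ (by rw [hm]; exact ha0) (by rw [hm, hk₀])
        rw [this, hk₀] at hm
        simp only [Prod.mk.injEq] at hm
        omega
      · have h1 := htno l hl h
        have h2 := hT.snd_le l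
        omega
    have hval : ∀ l, Function.update T k' (a, b') l = if l = k' then (a, b') else T l := by
      intro l
      simp only [Function.update_apply]
    have hb'q : b' ≤ q := by
      have := hT.snd_le k'
      rwa [hk'] at this
    refine ⟨_, ⟨fun l => ?_, fun l => ?_, fun l => ?_, fun l m h h' => ?_, fun l m => ?_⟩,
      PatStep.fst k' a a' b' hk' haa', fun i j => ?_, fun i j => ?_, a, ha, b', hb'q, ?_⟩
    · have h2 := hT.fst_le l
      rw [hval]
      split_ifs
      exacts [ha, h2]
    · have h2 := hT.snd_le l
      rw [hval]
      split_ifs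
      exacts [hb'q, h2]
    · have h2 := hT.ne_zero l
      rw [hval]
      split_ifs
      · simp only [ne_eq, Prod.mk.injEq]; omega
      · exact h2
    · rw [hval] at h h'
      rw [hval] at h'
      split_ifs at h h' with h1 h2 h2
      · rw [h1, h2]
      · exact absurd h'.symm (hrowfree m h)
      · exact absurd h' (hrowfree l (by rwa [h'] at h))
      · exact hT.fst_inj l m h h'
    · have h1 : ∀ l, (Function.update T k' (a, b') l).2 = (T l).2 := by
        intro l
        rw [hval]
        split_ifs with h
        · rw [h, hk']
        · rfl
      rw [h1, h1]
      exact hT.snd_inj l m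
    · rw [hrk]
      split_ifs with h
      · rw [← patRank_min hS, ← patRank_min hT]
        exact hlt _ _ (by omega) (by omega) (by omega) (by omega)
      · exact hle i j
    · rw [hrk]; omega
    · rw [hrk, if_pos ⟨le_rfl, haa', le_rfl⟩]
      omega
  · -- here `T` would have fewer columns than `S`
    have := hlt p q ha ha' hsq ht
    rw [patRank_top hT, patRank_top hS] at this
    exact absurd this (lt_irrefl _)

/-- If the rank function of `S` dominates that of `T`, then `S` is obtained from `T` by elementary
degenerations, up to the order of the columns. -/
theorem exists_patStep_chain (hS : IsPattern p q S) (hT : IsPattern p q T)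
    (hle : ∀ i j, patRank T i j ≤ patRank S i j) :
    ∃ T', Set.range S = Set.range T' ∧ IsPattern p q T' ∧ Relation.ReflTransGen
      (fun A B : Fin r → ℕ × ℕ => IsPattern p q A ∧ IsPattern p q B ∧ PatStep A B) T T' := by
  induction hn : ∑ i ∈ Finset.range (p + 1), ∑ j ∈ Finset.range (q + 1),
    (patRank S i j - patRank T i j) using Nat.strong_induction_on generalizing T with
  | _ n ih =>
    subst hn
    by_cases hne : Set.range S = Set.range T
    · exact ⟨T, hne, hT, .refl⟩
    obtain ⟨T', hT', hstep, h1, h2, i, hi, j, hj, hlt⟩ := exists_patStep hS hT hle hne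
    obtain ⟨T'', h, h', h''⟩ := ih _ (by
      refine Finset.sum_lt_sum (fun a _ => Finset.sum_le_sum fun b _ => ?_)
        ⟨i, Finset.mem_range.2 (by omega), Finset.sum_lt_sum (fun b _ => ?_)
          ⟨j, Finset.mem_range.2 (by omega), ?_⟩⟩
      · have := h2 a b
        omega
      · have := h2 i b
        omega
      · have := h1 i j
        omega) hT' h1 rfl
    exact ⟨T'', h, h', .head ⟨hT, hT', hstep⟩ h''⟩

/-- The rank function determines the pattern up to the order of the columns. -/
theorem range_eq_of_patRank_eq (hS : IsPattern p q S) (hT : IsPattern p q T)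
    (h : ∀ i j, patRank S i j = patRank T i j) : Set.range S = Set.range T := by
  by_contra hne
  obtain ⟨T', -, -, h1, -, i, -, j, -, hlt⟩ :=
    exists_patStep hS hT (fun i j => (h i j).ge) hne
  have := h1 i j
  rw [h] at this
  omega

end

/-! ### Patterns and orbit parameters -/

/-- The `a`-th standard basis vector of `ℂⁿ` for `1 ≤ a ≤ n`, and zero for `a = 0`. -/
def stdVec (n a : ℕ) : Fin n → ℂ := fun i => if (i : ℕ) + 1 = a then 1 else 0

/-- The matrix of a pattern. -/
def patMatrix (p q : ℕ) {r : ℕ} (T : Fin r → ℕ × ℕ) : Matrix (Fin p ⊕ Fin q) (Fin r) ℂ :=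
  Matrix.of fun x k => Sum.elim (stdVec p (T k).1) (stdVec q (T k).2) x

section

variable {p q r : ℕ} {S T : Fin r → ℕ × ℕ}

theorem patMatrix_inl (i : Fin p) (k : Fin r) :
    patMatrix p q T (Sum.inl i) k = if (i : ℕ) + 1 = (T k).1 then 1 else 0 := rfl

theorem patMatrix_inr (j : Fin q) (k : Fin r) :
    patMatrix p q T (Sum.inr j) k = if (j : ℕ) + 1 = (T k).2 then 1 else 0 := rfl

theorem IsPattern.mulVec_inl (hT : IsPattern p q T) (v : Fin r → ℂ) {i : Fin p} {k : Fin r}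
    (h : (i : ℕ) + 1 = (T k).1) : (patMatrix p q T).mulVec v (Sum.inl i) = v k := by
  rw [Matrix.mulVec, dotProduct, Finset.sum_eq_single k]
  · simp [patMatrix_inl, h]
  · intro l _ hl
    rw [patMatrix_inl, if_neg, zero_mul]
    intro h'
    exact hl (hT.fst_inj l k (by omega) (by omega))
  · simp

theorem IsPattern.mulVec_inr (hT : IsPattern p q T) (v : Fin r → ℂ) {j : Fin q} {k : Fin r}
    (h : (j : ℕ) + 1 = (T k).2) : (patMatrix p q T).mulVec v (Sum.inr j) = v k := by
  rw [Matrix.mulVec, dotProduct, Finset.sum_eq_single k]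
  · simp [patMatrix_inr, h]
  · intro l _ hl
    rw [patMatrix_inr, if_neg, zero_mul]
    intro h'
    exact hl (hT.snd_inj l k (by omega) (by omega))
  · simp

theorem IsPattern.cases (hT : IsPattern p q T) (k : Fin r) :
    (∃ i : Fin p, (i : ℕ) + 1 = (T k).1) ∨ ∃ j : Fin q, (j : ℕ) + 1 = (T k).2 := by
  have h1 := hT.fst_le k
  have h2 := hT.snd_le k
  by_cases h : (T k).1 = 0
  · have h' : (T k).2 ≠ 0 := fun h' => hT.ne_zero k (Prod.ext h h')
    exact Or.inr ⟨⟨(T k).2 - 1, by omega⟩, by simp only; omega⟩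
  · exact Or.inl ⟨⟨(T k).1 - 1, by omega⟩, by simp only; omega⟩

theorem IsPattern.mulVec_injective (hT : IsPattern p q T) :
    Function.Injective (patMatrix p q T).mulVec := by
  intro v w h
  ext k
  rcases hT.cases k with ⟨i, hi⟩ | ⟨j, hj⟩
  · rw [← hT.mulVec_inl v hi, ← hT.mulVec_inl w hi, h]
  · rw [← hT.mulVec_inr v hj, ← hT.mulVec_inr w hj, h]

/-- The pair of partial permutations of a pattern. -/
def IsPattern.toPair (hT : IsPattern p q T) : PartialPermPair p q r where
  mat := patMatrix p q T
  top := by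
    refine ⟨fun i c => ?_, fun i c c' h h' => ?_, fun i i' c h h' => ?_⟩
    · simp only [Matrix.toRows₁_apply, patMatrix_inl]
      split_ifs <;> simp
    · simp only [Matrix.toRows₁_apply, patMatrix_inl, ite_eq_left_iff, zero_ne_one, imp_false,
        not_not] at h h'
      exact hT.fst_inj c c' (by omega) (by omega)
    · simp only [Matrix.toRows₁_apply, patMatrix_inl, ite_eq_left_iff, zero_ne_one, imp_false,
        not_not] at h h'
      omega
  bot := by
    refine ⟨fun i c => ?_, fun i c c' h h' => ?_, fun i i' c h h' => ?_⟩
    · simp only [Matrix.toRows₂_apply, patMatrix_inr]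
      split_ifs <;> simp
    · simp only [Matrix.toRows₂_apply, patMatrix_inr, ite_eq_left_iff, zero_ne_one, imp_false,
        not_not] at h h'
      exact hT.snd_inj c c' (by omega) (by omega)
    · simp only [Matrix.toRows₂_apply, patMatrix_inr, ite_eq_left_iff, zero_ne_one, imp_false,
        not_not] at h h'
      omega
  rank_eq := Matrix.rank_of_mulVec_injective hT.mulVec_injective

/-- The orbit parameter of a pattern. -/
def IsPattern.param (hT : IsPattern p q T) : OrbitParam p q r :=
  Quotient.mk (partialPermPairSetoid p q r) hT.toPair

theorem OrbitParam.exists_pattern (ω : OrbitParam p q r) :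
    ∃ (T : Fin r → ℕ × ℕ) (hT : IsPattern p q T), hT.param = ω := by
  classical
  obtain ⟨η, rfl⟩ := Quotient.exists_rep ω
  have h1 : ∀ k, ∃ a, (∀ i : Fin p, (i : ℕ) + 1 = a ↔ η.mat (Sum.inl i) k = 1) ∧ a ≤ p := by
    intro k
    by_cases h : ∃ i, η.mat (Sum.inl i) k = 1
    · obtain ⟨i, hi⟩ := h
      refine ⟨i + 1, fun i' => ⟨fun h => ?_, fun h => ?_⟩, i.2⟩
      · rwa [show i' = i from Fin.ext (by omega)]
      · rw [η.top.col i' i k h hi]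
    · push Not at h
      exact ⟨0, fun i => ⟨fun h => by omega, fun h' => absurd h' (h i)⟩, by omega⟩
  have h2 : ∀ k, ∃ a, (∀ i : Fin q, (i : ℕ) + 1 = a ↔ η.mat (Sum.inr i) k = 1) ∧ a ≤ q := by
    intro k
    by_cases h : ∃ i, η.mat (Sum.inr i) k = 1
    · obtain ⟨i, hi⟩ := h
      refine ⟨i + 1, fun i' => ⟨fun h => ?_, fun h => ?_⟩, i.2⟩
      · rwa [show i' = i from Fin.ext (by omega)]
      · rw [η.bot.col i' i k h hi]
    · push Not at h
      exact ⟨0, fun i => ⟨fun h => by omega, fun h' => absurd h' (h i)⟩, by omega⟩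
  choose a ha hap using h1
  choose b hb hbq using h2
  have hmat : patMatrix p q (fun k => (a k, b k)) = η.mat := by
    ext (i | i) k
    · rw [patMatrix_inl]
      split_ifs with h
      · exact ((ha k i).1 h).symm
      · exact ((η.top.zero_or_one i k).resolve_right fun h' => h ((ha k i).2 h')).symm
    · rw [patMatrix_inr]
      split_ifs with h
      · exact ((hb k i).1 h).symm
      · exact ((η.bot.zero_or_one i k).resolve_right fun h' => h ((hb k i).2 h')).symm
  have hT : IsPattern p q fun k => (a k, b k) := by
    refine ⟨hap, hbq, fun k hk => ?_, fun k k' h h' => ?_, fun k k' h h' => ?_⟩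
    · have hinj := Matrix.mulVec_injective_of_rank η.rank_eq
      have hz : (patMatrix p q (fun k => (a k, b k))).mulVec (Pi.single k 1) = 0 := by
        simp only [Prod.mk.injEq] at hk
        rw [Matrix.mulVec_single_one]
        ext (i | i)
        · simp [Matrix.col_apply, patMatrix_inl, hk.1]
        · simp [Matrix.col_apply, patMatrix_inr, hk.2]
      rw [hmat] at hz
      have := congrFun (hinj (hz.trans (Matrix.mulVec_zero _).symm)) k
      simp at this
    · simp only at h h'
      have h1 := hap k
      have e : (((⟨a k - 1, by omega⟩ : Fin p) : ℕ)) + 1 = a k := by simp only; omega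
      exact η.top.row _ _ _ ((ha k _).1 e) ((ha k' _).1 (e.trans h'))
    · simp only at h h'
      have h1 := hbq k
      have e : (((⟨b k - 1, by omega⟩ : Fin q) : ℕ)) + 1 = b k := by simp only; omega
      exact η.bot.row _ _ _ ((hb k _).1 e) ((hb k' _).1 (e.trans h'))
  refine ⟨_, hT, Quotient.sound ⟨1, ?_⟩⟩
  rw [← hmat]
  rfl

theorem IsPattern.param_eq (hS : IsPattern p q S) (hT : IsPattern p q T)
    (h : Set.range S = Set.range T) : hS.param = hT.param := by
  have h1 : ∀ k, ∃ l, S l = T k := fun k => by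
    have : T k ∈ Set.range S := h ▸ ⟨k, rfl⟩
    exact this
  choose σ hσ using h1
  have hinj : Function.Injective σ := fun k k' hk => hT.injective (by rw [← hσ, ← hσ, hk])
  refine Quotient.sound ⟨Equiv.ofBijective σ (Finite.injective_iff_bijective.1 hinj), ?_⟩
  change patMatrix p q T = (patMatrix p q S).submatrix id σ
  ext x k
  simp only [patMatrix, Matrix.of_apply, Matrix.submatrix_apply, hσ, id]

theorem IsPattern.isEdge_iff (hT : IsPattern p q T) (i : Fin p) (j : Fin q) :
    hT.param.IsEdge i j ↔ ∃ k, T k = ((i : ℕ) + 1, (j : ℕ) + 1) := by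
  change (∃ c, patMatrix p q T (Sum.inl i) c = 1 ∧ patMatrix p q T (Sum.inr j) c = 1) ↔ _
  simp only [patMatrix_inl, patMatrix_inr, ite_eq_left_iff, zero_ne_one, imp_false, not_not,
    Prod.ext_iff]
  exact exists_congr fun k => by omega

theorem IsPattern.isMarkedPlus_iff (hT : IsPattern p q T) (i : Fin p) :
    hT.param.IsMarkedPlus i ↔ ∃ k, T k = ((i : ℕ) + 1, 0) := by
  change (∃ c, patMatrix p q T (Sum.inl i) c = 1 ∧ ∀ j, patMatrix p q T (Sum.inr j) c = 0) ↔ _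
  simp only [patMatrix_inl, patMatrix_inr, ite_eq_left_iff, ite_eq_right_iff, zero_ne_one,
    one_ne_zero, imp_false, not_not, Prod.ext_iff]
  refine exists_congr fun k => and_congr ⟨Eq.symm, Eq.symm⟩ ⟨fun h => ?_, fun h j => by omega⟩
  by_contra hne
  have := hT.snd_le k
  exact h ⟨(T k).2 - 1, by omega⟩ (by simp only; omega)

theorem IsPattern.isMarkedMinus_iff (hT : IsPattern p q T) (j : Fin q) :
    hT.param.IsMarkedMinus j ↔ ∃ k, T k = (0, (j : ℕ) + 1) := by
  change (∃ c, patMatrix p q T (Sum.inr j) c = 1 ∧ ∀ i, patMatrix p q T (Sum.inl i) c = 0) ↔ _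
  simp only [patMatrix_inl, patMatrix_inr, ite_eq_left_iff, ite_eq_right_iff, zero_ne_one,
    one_ne_zero, imp_false, not_not, Prod.ext_iff]
  refine exists_congr fun k => and_comm.trans
    (and_congr ⟨fun h => ?_, fun h j => by omega⟩ ⟨Eq.symm, Eq.symm⟩)
  by_contra hne
  have := hT.fst_le k
  exact h ⟨(T k).1 - 1, by omega⟩ (by simp only; omega)

theorem IsPattern.rankMat_eq (hT : IsPattern p q T) (i : Fin (p + 1)) (j : Fin (q + 1)) :
    hT.param.rankMat i j = patRank T i j := by
  classical
  have h1 : (Finset.univ.filter fun e : Fin p × Fin q =>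
      (e.1 : ℕ) < i ∧ (e.2 : ℕ) < j ∧ hT.param.IsEdge e.1 e.2).card =
      (Finset.univ.filter fun k => ((T k).1 ≤ i ∧ (T k).2 ≤ j) ∧
        (T k).1 ≠ 0 ∧ (T k).2 ≠ 0).card := by
    symm
    refine Finset.card_bij (fun k hk => (⟨(T k).1 - 1, ?_⟩, ⟨(T k).2 - 1, ?_⟩)) ?_ ?_ ?_
    · have := hT.fst_le k
      simp only [Finset.mem_filter] at hk
      omega
    · have := hT.snd_le k
      simp only [Finset.mem_filter] at hk
      omega
    · intro k hk
      simp only [Finset.mem_filter, Finset.mem_univ, true_and, hT.isEdge_iff] at hk ⊢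
      exact ⟨by omega, by omega, k, Prod.ext (by simp only; omega) (by simp only; omega)⟩
    · intro k hk k' hk' h
      have hk := (Finset.mem_filter.1 hk).2
      have hk' := (Finset.mem_filter.1 hk').2
      simp only [Prod.mk.injEq, Fin.mk.injEq] at h
      exact hT.fst_inj k k' hk.2.1 (by omega)
    · rintro ⟨a, b⟩ hab
      simp only [Finset.mem_filter, Finset.mem_univ, true_and, hT.isEdge_iff] at hab
      obtain ⟨ha, hb, k, hk⟩ := hab
      refine ⟨k, ?_, ?_⟩
      · simp only [Finset.mem_filter, Finset.mem_univ, true_and, hk]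
        omega
      · simp [hk]
  have h2 : (Finset.univ.filter fun a : Fin p => (a : ℕ) < i ∧ hT.param.IsMarkedPlus a).card =
      (Finset.univ.filter fun k => ((T k).1 ≤ i ∧ (T k).2 ≤ j) ∧ (T k).2 = 0).card := by
    symm
    refine Finset.card_bij (fun k hk => ⟨(T k).1 - 1, ?_⟩) ?_ ?_ ?_
    · have := hT.fst_le k
      simp only [Finset.mem_filter] at hk
      have : (T k).1 ≠ 0 := fun h => hT.ne_zero k (Prod.ext h hk.2.2)
      omega
    · intro k hk
      simp only [Finset.mem_filter, Finset.mem_univ, true_and, hT.isMarkedPlus_iff] at hk ⊢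
      have : (T k).1 ≠ 0 := fun h => hT.ne_zero k (Prod.ext h hk.2)
      exact ⟨by omega, k, Prod.ext (by simp only; omega) hk.2⟩
    · intro k hk k' hk' h
      have hk := (Finset.mem_filter.1 hk).2
      have hk' := (Finset.mem_filter.1 hk').2
      simp only [Fin.mk.injEq] at h
      have h1 : (T k).1 ≠ 0 := fun h => hT.ne_zero k (Prod.ext h hk.2)
      have h2 : (T k').1 ≠ 0 := fun h => hT.ne_zero k' (Prod.ext h hk'.2)
      exact hT.fst_inj k k' h1 (by omega)
    · intro a hab
      simp only [Finset.mem_filter, Finset.mem_univ, true_and, hT.isMarkedPlus_iff] at hab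
      obtain ⟨ha, k, hk⟩ := hab
      refine ⟨k, ?_, ?_⟩
      · simp only [Finset.mem_filter, Finset.mem_univ, true_and, hk]
        exact ⟨⟨ha, Nat.zero_le _⟩, trivial⟩
      · simp [hk]
  have h3 : (Finset.univ.filter fun b : Fin q => (b : ℕ) < j ∧ hT.param.IsMarkedMinus b).card =
      (Finset.univ.filter fun k => ((T k).1 ≤ i ∧ (T k).2 ≤ j) ∧ (T k).1 = 0).card := by
    symm
    refine Finset.card_bij (fun k hk => ⟨(T k).2 - 1, ?_⟩) ?_ ?_ ?_
    · have := hT.snd_le k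
      simp only [Finset.mem_filter] at hk
      have : (T k).2 ≠ 0 := fun h => hT.ne_zero k (Prod.ext hk.2.2 h)
      omega
    · intro k hk
      simp only [Finset.mem_filter, Finset.mem_univ, true_and, hT.isMarkedMinus_iff] at hk ⊢
      have : (T k).2 ≠ 0 := fun h => hT.ne_zero k (Prod.ext hk.2 h)
      exact ⟨by omega, k, Prod.ext hk.2 (by simp only; omega)⟩
    · intro k hk k' hk' h
      have hk := (Finset.mem_filter.1 hk).2
      have hk' := (Finset.mem_filter.1 hk').2
      simp only [Fin.mk.injEq] at h
      have h1 : (T k).2 ≠ 0 := fun h => hT.ne_zero k (Prod.ext hk.2 h)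
      have h2 : (T k').2 ≠ 0 := fun h => hT.ne_zero k' (Prod.ext hk'.2 h)
      exact hT.snd_inj k k' h1 (by omega)
    · intro a hab
      simp only [Finset.mem_filter, Finset.mem_univ, true_and, hT.isMarkedMinus_iff] at hab
      obtain ⟨ha, k, hk⟩ := hab
      refine ⟨k, ?_, ?_⟩
      · simp only [Finset.mem_filter, Finset.mem_univ, true_and, hk]
        exact ⟨⟨Nat.zero_le _, ha⟩, trivial⟩
      · simp [hk]
  rw [OrbitParam.rankMat, h1, h2, h3, patRank]
  rw [← Finset.card_union_of_disjoint, ← Finset.card_union_of_disjoint]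
  · congr 1
    ext k
    have := hT.ne_zero k
    simp only [Finset.mem_union, Finset.mem_filter, Finset.mem_univ, true_and]
    omega
  · rw [Finset.disjoint_left]
    intro k hk hk'
    have h := hT.ne_zero k
    simp only [Finset.mem_union, Finset.mem_filter, Finset.mem_univ, true_and] at hk hk'
    rw [ne_eq, Prod.ext_iff] at h
    omega
  · rw [Finset.disjoint_left]
    intro k hk hk'
    simp only [Finset.mem_filter, Finset.mem_univ, true_and] at hk hk'
    omega

theorem IsPattern.finrank_basePoint (hT : IsPattern p q T) (i : Fin (p + 1)) (j : Fin (q + 1)) :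
    Module.finrank ℂ (hT.param.basePoint.W ⊓ hT.param.basePoint.flagSum i j :
      Submodule ℂ (Fin p ⊕ Fin q → ℂ)) = patRank T i j := by
  have hli : LinearIndependent ℂ (patMatrix p q T).col :=
    Matrix.mulVec_injective_iff.1 hT.mulVec_injective
  have hli' := hli.comp (Subtype.val : {k // (T k).1 ≤ i ∧ (T k).2 ≤ j} → Fin r)
    Subtype.val_injective
  have hspan : (hT.param.basePoint.W ⊓ hT.param.basePoint.flagSum i j :
      Submodule ℂ (Fin p ⊕ Fin q → ℂ)) = Submodule.span ℂ (Set.range ((patMatrix p q T).col ∘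
        (Subtype.val : {k // (T k).1 ≤ i ∧ (T k).2 ≤ j} → Fin r))) := by
    apply le_antisymm
    · rintro _ ⟨⟨v, rfl⟩, hw⟩
      have hw' := (mem_flagSum_iff_of_std (x := hT.param.basePoint) rfl rfl).1 hw
      change (patMatrix p q T).mulVec v ∈ _
      rw [Matrix.mulVec_eq_sum]
      simp only [op_smul_eq_smul]
      refine Submodule.sum_mem _ fun k _ => ?_
      by_cases hk : (T k).1 ≤ i ∧ (T k).2 ≤ j
      · refine Submodule.smul_mem _ _ (Submodule.subset_span ?_)
        exact ⟨⟨k, hk⟩, rfl⟩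
      · have hvk : v k = 0 := by
          have h1 := hT.fst_le k
          have h2 := hT.snd_le k
          rw [not_and_or] at hk
          rcases hk with hk | hk
          · have e : (((⟨(T k).1 - 1, by omega⟩ : Fin p) : ℕ)) + 1 = (T k).1 := by
              simp only; omega
            rw [← hT.mulVec_inl v e]
            exact hw'.1 _ (by simp only; omega)
          · have e : (((⟨(T k).2 - 1, by omega⟩ : Fin q) : ℕ)) + 1 = (T k).2 := by
              simp only; omega
            rw [← hT.mulVec_inr v e]
            exact hw'.2 _ (by simp only; omega)
        simp [hvk]
    · rw [Submodule.span_le]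
      rintro _ ⟨⟨k, hk⟩, rfl⟩
      refine ⟨?_, ?_⟩
      · change _ ∈ LinearMap.range (patMatrix p q T).mulVecLin
        rw [Matrix.range_mulVecLin]
        exact Submodule.subset_span ⟨k, rfl⟩
      · refine (mem_flagSum_iff_of_std (x := hT.param.basePoint) rfl rfl).2 ⟨fun l hl => ?_,
          fun l hl => ?_⟩
        · simp only [Function.comp, Matrix.col_apply, patMatrix_inl]
          rw [if_neg]
          omega
        · simp only [Function.comp, Matrix.col_apply, patMatrix_inr]
          rw [if_neg]
          omega
  rw [hspan, finrank_span_eq_card hli', Fintype.card_subtype, patRank]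

theorem OrbitParam.finrank_of_mem_orbit {ω : OrbitParam p q r} {x : DoubleFlagVariety p q r}
    (hx : x ∈ ω.orbit) (i : Fin (p + 1)) (j : Fin (q + 1)) :
    Module.finrank ℂ (x.W ⊓ x.flagSum i j : Submodule ℂ (Fin p ⊕ Fin q → ℂ)) = ω.rankMat i j := by
  obtain ⟨T, hT, rfl⟩ := ω.exists_pattern
  obtain ⟨k, rfl⟩ := hx
  rw [hT.rankMat_eq, ← hT.finrank_basePoint]
  exact finrank_smul_inf k _ i j

theorem patRank_le_of_rankMat_le (hS : IsPattern p q S) (hT : IsPattern p q T)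
    (h : ∀ (i : Fin (p + 1)) (j : Fin (q + 1)), hT.param.rankMat i j ≤ hS.param.rankMat i j)
    (i j : ℕ) :
    patRank T i j ≤ patRank S i j := by
  have := h (⟨min i p, by omega⟩ : Fin (p + 1)) (⟨min j q, by omega⟩ : Fin (q + 1))
  rw [hT.rankMat_eq, hS.rankMat_eq] at this
  rwa [← patRank_min hT, ← patRank_min hS]

theorem OrbitParam.eq_of_rankMat_eq {ω ω' : OrbitParam p q r}
    (h : ∀ (i : Fin (p + 1)) (j : Fin (q + 1)), ω.rankMat i j = ω'.rankMat i j) : ω = ω' := by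
  obtain ⟨S, hS, rfl⟩ := ω.exists_pattern
  obtain ⟨T, hT, rfl⟩ := ω'.exists_pattern
  refine hS.param_eq hT (range_eq_of_patRank_eq hS hT fun i j => le_antisymm ?_ ?_)
  · exact patRank_le_of_rankMat_le hT hS (fun i j => (h i j).le) i j
  · exact patRank_le_of_rankMat_le hS hT (fun i j => (h i j).ge) i j

end

/-! ### Adapted bases and normal forms -/

section

variable {n : ℕ}

/-- The step of a flag numbered by any natural number; it is constant from `n` on. -/
def CompleteFlag.step (F : CompleteFlag n) (m : ℕ) : Submodule ℂ (Fin n → ℂ) :=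
  F.space ⟨min m n, by omega⟩

namespace CompleteFlag

variable (F : CompleteFlag n)

theorem step_val (i : Fin (n + 1)) : F.step i = F.space i := by
  unfold step
  congr 1
  exact Fin.ext (by simp only; omega)

theorem step_mono : Monotone F.step := fun a b h => F.mono (by
  rw [Fin.mk_le_mk]
  exact min_le_min_right n h)

theorem finrank_step (m : ℕ) : Module.finrank ℂ (F.step m) = min m n := F.finrank_eq _

theorem step_zero : F.step 0 = ⊥ := by
  rw [← Submodule.finrank_eq_zero, finrank_step, Nat.zero_min]

theorem step_top : F.step n = ⊤ := by
  apply Submodule.eq_top_of_finrank_eq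
  rw [finrank_step, min_self, Module.finrank_fin_fun]

theorem step_succ {a : ℕ} (ha : a < n) {v : Fin n → ℂ} (hv : v ∈ F.step (a + 1))
    (hv' : v ∉ F.step a) : F.step (a + 1) = F.step a ⊔ Submodule.span ℂ {v} := by
  symm
  apply Submodule.eq_of_le_of_finrank_le
  · exact sup_le (F.step_mono (Nat.le_succ a)) (by simpa using hv)
  · rw [finrank_step]
    have : F.step a < F.step a ⊔ Submodule.span ℂ {v} := by
      refine lt_of_le_not_ge le_sup_left fun h => hv' (h ?_)
      exact Submodule.mem_sup_right (Submodule.mem_span_singleton_self v)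
    have := Submodule.finrank_lt_finrank_of_lt this
    rw [finrank_step] at this
    omega

end CompleteFlag

/-- A basis `e 1, …, e n` adapted to a flag, extended by `e 0 = 0`. -/
structure IsAdapted (F : CompleteFlag n) (e : ℕ → Fin n → ℂ) : Prop where
  zero : e 0 = 0
  mem : ∀ a < n, e (a + 1) ∈ F.step (a + 1)
  notMem : ∀ a < n, e (a + 1) ∉ F.step a

namespace IsAdapted

variable {F : CompleteFlag n} {e : ℕ → Fin n → ℂ}

theorem exists_adapted (F : CompleteFlag n) : ∃ e, IsAdapted F e := by
  have h : ∀ a, ∃ v, a < n → v ∈ F.step (a + 1) ∧ v ∉ F.step a := by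
    intro a
    by_cases ha : a < n
    · have hlt : F.step a < F.step (a + 1) := by
        refine lt_of_le_of_ne (F.step_mono (Nat.le_succ a)) fun h => ?_
        have := congrArg (fun S : Submodule ℂ (Fin n → ℂ) => Module.finrank ℂ S) h
        simp only [F.finrank_step] at this
        omega
      obtain ⟨v, hv, hv'⟩ := SetLike.exists_of_lt hlt
      exact ⟨v, fun _ => ⟨hv, hv'⟩⟩
    · exact ⟨0, fun h => absurd h ha⟩
  choose v hv using h
  exact ⟨fun a => Nat.casesOn a 0 v, rfl, fun a ha => (hv a ha).1, fun a ha => (hv a ha).2⟩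

theorem update (he : IsAdapted F e) {a : ℕ} {v : Fin n → ℂ} (hv : v ∈ F.step (a + 1))
    (hv' : v ∉ F.step a) : IsAdapted F (Function.update e (a + 1) v) := by
  refine ⟨?_, fun b hb => ?_, fun b hb => ?_⟩
  · rw [Function.update_of_ne (by omega), he.zero]
  · by_cases h : b = a
    · subst h; rwa [Function.update_self]
    · rw [Function.update_of_ne (by omega)]; exact he.mem b hb
  · by_cases h : b = a
    · subst h; rwa [Function.update_self]
    · rw [Function.update_of_ne (by omega)]; exact he.notMem b hb

theorem step_eq_span (he : IsAdapted F e) {m : ℕ} (hm : m ≤ n) :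
    F.step m = Submodule.span ℂ (e '' Set.Iic m) := by
  induction m with
  | zero =>
    rw [F.step_zero]
    symm
    rw [Submodule.span_eq_bot]
    rintro _ ⟨a, ha, rfl⟩
    rw [Nat.le_zero.1 ha, he.zero]
  | succ m ih =>
    have : Set.Iic (m + 1) = Set.Iic m ∪ {m + 1} := by
      ext x
      simp only [Set.mem_Iic, Set.mem_union, Set.mem_singleton_iff]
      omega
    rw [F.step_succ hm (he.mem m hm) (he.notMem m hm), ih (by omega), this, Set.image_union,
      Set.image_singleton, Submodule.span_union]

theorem mem_step (he : IsAdapted F e) {a : ℕ} (ha : a ≤ n) : e a ∈ F.step a := by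
  rw [he.step_eq_span ha]
  exact Submodule.subset_span ⟨a, le_refl a, rfl⟩

/-- An adapted basis is the image of the standard basis by an invertible matrix, which moves the
standard flag to the given flag. -/
theorem exists_gl (he : IsAdapted F e) :
    ∃ g : GL (Fin n) ℂ, g • stdFlag n = F ∧ ∀ a ≤ n, g.val.mulVec (stdVec n a) = e a := by
  let G : Matrix (Fin n) (Fin n) ℂ := Matrix.of fun x k => e (k + 1) x
  have hG : ∀ a ≤ n, G.mulVec (stdVec n a) = e a := by
    intro a ha
    ext x
    rcases Nat.eq_zero_or_pos a with rfl | h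
    · simp [Matrix.mulVec, dotProduct, stdVec, he.zero]
    · rw [Matrix.mulVec, dotProduct, Finset.sum_eq_single ⟨a - 1, by omega⟩]
      · have : a - 1 + 1 = a := by omega
        simp [G, stdVec, this]
      · intro b _ hb
        have : (b : ℕ) + 1 ≠ a := fun h => hb (Fin.ext (by simp only; omega))
        simp [stdVec, this]
      · simp
  have hsurj : Function.Surjective G.mulVec := by
    have : LinearMap.range G.mulVecLin = ⊤ := by
      rw [eq_top_iff, ← F.step_top, he.step_eq_span le_rfl, Submodule.span_le]
      rintro _ ⟨a, ha, rfl⟩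
      exact ⟨stdVec n a, hG a ha⟩
    exact LinearMap.range_eq_top.1 this
  have hu : IsUnit G := Matrix.mulVec_surjective_iff_isUnit.1 hsurj
  refine ⟨hu.unit, ?_, hG⟩
  apply CompleteFlag.ext
  funext i
  apply Submodule.eq_of_le_of_finrank_le
  · change Submodule.map G.mulVecLin (Submodule.span ℂ _) ≤ _
    rw [Submodule.map_span_le]
    rintro _ ⟨⟨k, hk⟩, rfl⟩
    have : (Pi.single k 1 : Fin n → ℂ) = stdVec n (k + 1) := by
      ext x
      simp [stdVec, Pi.single_apply, Fin.ext_iff]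
    change G.mulVec (Pi.single k 1) ∈ _
    rw [this]
    rw [hG _ k.2, ← F.step_val]
    exact F.step_mono (show (k : ℕ) + 1 ≤ i from hk) (he.mem_step k.2)
  · rw [F.finrank_eq, (hu.unit • stdFlag n).finrank_eq]

end IsAdapted

/-- If a step `A ⊂ B` by one dimension is realized by an element `z` of `W`, then the part of `W`
over `B` is that over `A` together with `z`. -/
theorem Submodule.inf_comap_eq_sup {E E' : Type*} [AddCommGroup E] [Module ℂ E] [AddCommGroup E']
    [Module ℂ E'] (φ : E →ₗ[ℂ] E') {W : Submodule ℂ E} {A B : Submodule ℂ E'} {z : E} (hz : z ∈ W)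
    (hB : B = A ⊔ Submodule.span ℂ {φ z}) :
    W ⊓ B.comap φ = (W ⊓ A.comap φ) ⊔ Submodule.span ℂ {z} := by
  apply le_antisymm
  · rintro y ⟨hy, hyB⟩
    rw [SetLike.mem_coe, Submodule.mem_comap, hB, Submodule.mem_sup] at hyB
    obtain ⟨a, ha, b, hb, hab⟩ := hyB
    obtain ⟨c, rfl⟩ := Submodule.mem_span_singleton.1 hb
    refine Submodule.mem_sup.2 ⟨y - c • z, ⟨W.sub_mem hy (W.smul_mem c hz), ?_⟩, c • z,
      Submodule.smul_mem _ _ (Submodule.mem_span_singleton_self z), sub_add_cancel _ _⟩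
    rw [SetLike.mem_coe, Submodule.mem_comap, map_sub, map_smul, ← hab, add_sub_cancel_right]
    exact ha
  · refine sup_le (inf_le_inf_left _ (Submodule.comap_mono (hB ▸ le_sup_left))) ?_
    rw [Submodule.span_singleton_le_iff_mem]
    refine ⟨hz, ?_⟩
    rw [SetLike.mem_coe, Submodule.mem_comap, hB]
    exact Submodule.mem_sup_right (Submodule.mem_span_singleton_self _)

/-- Any subspace is spanned by part of some basis adapted to a given flag. -/
theorem IsAdapted.exists_span_eq (F : CompleteFlag n) (U : Submodule ℂ (Fin n → ℂ)) {m : ℕ}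
    (hm : m ≤ n) : ∃ (e : ℕ → Fin n → ℂ) (B : Finset ℕ), IsAdapted F e ∧
      (∀ b ∈ B, 1 ≤ b ∧ b ≤ m) ∧ U ⊓ F.step m = Submodule.span ℂ (e '' B) := by
  induction m with
  | zero =>
    obtain ⟨e, he⟩ := IsAdapted.exists_adapted F
    exact ⟨e, ∅, he, by simp, by simp [F.step_zero]⟩
  | succ m ih =>
    obtain ⟨e, B, he, hB, hU⟩ := ih (by omega)
    by_cases h : U ⊓ F.step (m + 1) ≤ F.step m
    · refine ⟨e, B, he, fun b hb => ⟨(hB b hb).1, (hB b hb).2.trans (Nat.le_succ m)⟩, ?_⟩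
      rw [← hU]
      exact le_antisymm (le_inf inf_le_left h) (inf_le_inf_left _ (F.step_mono (Nat.le_succ m)))
    · obtain ⟨v, ⟨hvU, hv⟩, hv'⟩ := SetLike.not_le_iff_exists.1 h
      refine ⟨Function.update e (m + 1) v, insert (m + 1) B, he.update hv hv', ?_, ?_⟩
      · intro b hb
        rcases Finset.mem_insert.1 hb with rfl | hb
        · omega
        · have := hB b hb
          omega
      · have := Submodule.inf_comap_eq_sup LinearMap.id hvU (F.step_succ hm hv hv')
        rw [Submodule.comap_id, Submodule.comap_id] at this
        rw [this, hU, Finset.coe_insert, Set.image_insert_eq, Submodule.span_insert, sup_comm,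
          Function.update_self]
        congr 2
        refine Set.image_congr fun b hb => (Function.update_of_ne ?_ _ _).symm
        have := hB b hb
        omega

end

section

variable {p q r : ℕ}

/-- The vector `e a + f b` of `V⁺ ⊕ V⁻`. -/
def pairVec (e : ℕ → Fin p → ℂ) (f : ℕ → Fin q → ℂ) (x : ℕ × ℕ) : Fin p ⊕ Fin q → ℂ :=
  Sum.elim (e x.1) (f x.2)

/-- The first projection of `V⁺ ⊕ V⁻`. -/
def projPlus (p q : ℕ) : (Fin p ⊕ Fin q → ℂ) →ₗ[ℂ] (Fin p → ℂ) := LinearMap.funLeft ℂ ℂ Sum.inl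

/-- The second projection of `V⁺ ⊕ V⁻`. -/
def projMinus (p q : ℕ) : (Fin p ⊕ Fin q → ℂ) →ₗ[ℂ] (Fin q → ℂ) := LinearMap.funLeft ℂ ℂ Sum.inr

/-- A nonzero combination of some vectors of an adapted basis can replace one of them. -/
theorem IsAdapted.exists_leading {F : CompleteFlag q} {f : ℕ → Fin q → ℂ} (hf : IsAdapted F f)
    {B : Finset ℕ} (hB : ∀ b ∈ B, 1 ≤ b ∧ b ≤ q) {w : Fin q → ℂ}
    (hw : w ∈ Submodule.span ℂ (f '' B)) (hw0 : w ≠ 0) :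
    ∃ b, b + 1 ∈ B ∧ w ∈ F.step (b + 1) ∧ w ∉ F.step b := by
  classical
  induction B using Finset.induction_on_max generalizing w with
  | empty => simp at hw; exact absurd hw hw0
  | insert b B hlt ih =>
    rw [Finset.coe_insert, Set.image_insert_eq, Submodule.mem_span_insert] at hw
    obtain ⟨c, w₀, hw₀, rfl⟩ := hw
    have hb := hB b (Finset.mem_insert_self b B)
    obtain ⟨b, rfl⟩ : ∃ b', b = b' + 1 := ⟨b - 1, by omega⟩
    have hw₀b : w₀ ∈ F.step b := by
      rw [hf.step_eq_span (by omega)]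
      refine Submodule.span_mono (Set.image_mono fun x hx => ?_) hw₀
      have := hlt x hx
      simp only [Set.mem_Iic]
      omega
    by_cases hc : c = 0
    · subst hc
      rw [zero_smul, zero_add] at hw0 ⊢
      obtain ⟨b', h1, h2⟩ := ih (fun x hx => hB x (Finset.mem_insert_of_mem hx)) hw₀ hw0
      exact ⟨b', Finset.mem_insert_of_mem h1, h2⟩
    · refine ⟨b, Finset.mem_insert_self _ _, ?_, fun h => ?_⟩
      · exact Submodule.add_mem _ (Submodule.smul_mem _ _ (hf.mem b (by omega)))
          (F.step_mono (Nat.le_succ b) hw₀b)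
      · have h1 := (Submodule.add_mem_iff_left _ hw₀b).1 h
        exact hf.notMem b (by omega) ((Submodule.smul_mem_iff _ hc).1 h1)

/-- Finite sets of columns satisfying the conditions on patterns. -/
structure IsPatternSet (p q : ℕ) (S : Finset (ℕ × ℕ)) : Prop where
  fst_le : ∀ x ∈ S, x.1 ≤ p
  snd_le : ∀ x ∈ S, x.2 ≤ q
  ne_zero : ∀ x ∈ S, x ≠ (0, 0)
  fst_inj : ∀ x ∈ S, ∀ y ∈ S, x.1 ≠ 0 → x.1 = y.1 → x = y
  snd_inj : ∀ x ∈ S, ∀ y ∈ S, x.2 ≠ 0 → x.2 = y.2 → x = y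

/-- The normal form of a subspace of `V⁺ ⊕ V⁻` with respect to a flag of `V⁺` and a flag of `V⁻`:
for suitable adapted bases, it is spanned by vectors `e a + f b`, `e a` and `f b`, each basis vector
being used at most once. The proof goes up the steps of the flag of `V⁺`. -/
theorem exists_normal_form (F : CompleteFlag p) (F' : CompleteFlag q)
    (W : Submodule ℂ (Fin p ⊕ Fin q → ℂ)) {m : ℕ} (hm : m ≤ p) :
    ∃ (e : ℕ → Fin p → ℂ) (f : ℕ → Fin q → ℂ) (S : Finset (ℕ × ℕ)), IsAdapted F e ∧
      IsAdapted F' f ∧ IsPatternSet m q S ∧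
      W ⊓ (F.step m).comap (projPlus p q) = Submodule.span ℂ (pairVec e f '' S) := by
  classical
  induction m with
  | zero =>
    obtain ⟨e, he⟩ := IsAdapted.exists_adapted F
    obtain ⟨f, B, hf, hB, hU⟩ :=
      IsAdapted.exists_span_eq F' (W.comap (inclMinus p q)) (le_refl q)
    refine ⟨e, f, B.image fun b => (0, b), he, hf, ⟨?_, ?_, ?_, ?_, ?_⟩, ?_⟩
    · simp
    · intro x hx
      obtain ⟨b, hb, rfl⟩ := Finset.mem_image.1 hx
      exact (hB b hb).2
    · intro x hx
      obtain ⟨b, hb, rfl⟩ := Finset.mem_image.1 hx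
      have := hB b hb
      simp only [ne_eq, Prod.mk.injEq, true_and]
      omega
    · simp
    · intro x hx y hy
      obtain ⟨b, hb, rfl⟩ := Finset.mem_image.1 hx
      obtain ⟨b', hb', rfl⟩ := Finset.mem_image.1 hy
      simp
    · have h1 : pairVec e f '' (B.image fun b => (0, b) : Finset (ℕ × ℕ)) =
          inclMinus p q '' (f '' B) := by
        rw [Finset.coe_image, Set.image_image, Set.image_image]
        refine Set.image_congr fun b _ => ?_
        simp [pairVec, he.zero, inclMinus]
      rw [h1, Submodule.span_image, ← hU, F'.step_top, inf_top_eq, F.step_zero]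
      ext z
      simp only [Submodule.mem_inf, Submodule.mem_comap, Submodule.mem_bot, Submodule.mem_map]
      constructor
      · rintro ⟨hz, hz'⟩
        have : inclMinus p q (fun j => z (Sum.inr j)) = z := by
          ext (i | i)
          · exact (congrFun hz' i).symm
          · rfl
        exact ⟨_, by rwa [this], this⟩
      · rintro ⟨w, hw, rfl⟩
        exact ⟨hw, rfl⟩
  | succ m ih =>
    obtain ⟨e, f, S, he, hf, hS, hW⟩ := ih (by omega)
    by_cases h : W ⊓ (F.step (m + 1)).comap (projPlus p q) ≤ (F.step m).comap (projPlus p q)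
    · refine ⟨e, f, S, he, hf, ⟨fun x hx => (hS.fst_le x hx).trans (Nat.le_succ m),
        hS.snd_le, hS.ne_zero, hS.fst_inj, hS.snd_inj⟩, ?_⟩
      rw [← hW]
      exact le_antisymm (le_inf inf_le_left h)
        (inf_le_inf_left _ (Submodule.comap_mono (F.step_mono (Nat.le_succ m))))
    obtain ⟨z, ⟨hzW, hz⟩, hz'⟩ := SetLike.not_le_iff_exists.1 h
    -- the unused vectors `f b`, to which the second component of `z` can be reduced
    let B := (Finset.Icc 1 q).filter fun b => ∀ x ∈ S, x.2 ≠ b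
    have htop : (⊤ : Submodule ℂ (Fin q → ℂ)) ≤ Submodule.span ℂ (f '' B) ⊔
        (Submodule.span ℂ (pairVec e f '' S)).map (projMinus p q) := by
      rw [← F'.step_top, hf.step_eq_span le_rfl, Submodule.span_le]
      rintro _ ⟨b, hb, rfl⟩
      by_cases hbB : b ∈ B
      · exact Submodule.mem_sup_left (Submodule.subset_span ⟨b, hbB, rfl⟩)
      · refine Submodule.mem_sup_right ?_
        rcases Nat.eq_zero_or_pos b with rfl | hb0
        · rw [hf.zero]; exact Submodule.zero_mem _
        · simp only [B, Finset.mem_filter, Finset.mem_Icc, not_and, not_forall, not_not] at hbB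
          obtain ⟨x, hx, rfl⟩ := hbB ⟨hb0, hb⟩
          exact ⟨_, Submodule.subset_span ⟨x, hx, rfl⟩, rfl⟩
    obtain ⟨w, hw, _, ⟨u, hu, rfl⟩, hzw⟩ :=
      Submodule.mem_sup.1 (htop (Submodule.mem_top (x := projMinus p q z)))
    rw [SetLike.mem_coe, ← hW] at hu
    obtain ⟨y, hyz⟩ : ∃ y, y = z - u := ⟨_, rfl⟩
    have hyW : y ∈ W := hyz ▸ W.sub_mem hzW hu.1
    have hy : projPlus p q y ∈ F.step (m + 1) := by
      rw [hyz, map_sub]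
      exact Submodule.sub_mem _ hz (F.step_mono (Nat.le_succ m) hu.2)
    have hy' : projPlus p q y ∉ F.step m := by
      rw [hyz, map_sub, Submodule.sub_mem_iff_left _ (show projPlus p q u ∈ F.step m from hu.2)]
      exact hz'
    have hyw : projMinus p q y = w := by
      rw [hyz, map_sub, ← hzw, add_sub_cancel_right]
    have hW' := Submodule.inf_comap_eq_sup (projPlus p q) hyW (F.step_succ hm hy hy')
    have hSm : ∀ x ∈ S, x.1 ≠ m + 1 := fun x hx => by
      have := hS.fst_le x hx
      omega
    -- it remains to add the column `(m + 1, b)`, where `w` replaces `f b`, or `b = 0` if `w = 0`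
    have key : ∀ (b : ℕ) (f' : ℕ → Fin q → ℂ), IsAdapted F' f' → b ≤ q → f' b = w →
        (b ≠ 0 → ∀ x ∈ S, x.2 ≠ b) → pairVec e f' '' S = pairVec e f '' S →
        ∃ (e : ℕ → Fin p → ℂ) (f : ℕ → Fin q → ℂ) (S : Finset (ℕ × ℕ)), IsAdapted F e ∧
          IsAdapted F' f ∧ IsPatternSet (m + 1) q S ∧
          W ⊓ (F.step (m + 1)).comap (projPlus p q) = Submodule.span ℂ (pairVec e f '' S) := by
      intro b f' hf' hbq hb hbS himg
      refine ⟨Function.update e (m + 1) (projPlus p q y), f', insert (m + 1, b) S,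
        he.update hy hy', hf', ⟨?_, ?_, ?_, ?_, ?_⟩, ?_⟩
      · intro x hx
        rcases Finset.mem_insert.1 hx with rfl | hx
        · exact le_rfl
        · exact (hS.fst_le x hx).trans (Nat.le_succ m)
      · intro x hx
        rcases Finset.mem_insert.1 hx with rfl | hx
        · exact hbq
        · exact hS.snd_le x hx
      · intro x hx
        rcases Finset.mem_insert.1 hx with rfl | hx
        · simp
        · exact hS.ne_zero x hx
      · intro x hx x' hx' h0 hxx
        rcases Finset.mem_insert.1 hx with rfl | hx <;>
          rcases Finset.mem_insert.1 hx' with rfl | hx'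
        · rfl
        · exact absurd hxx.symm (hSm x' hx')
        · exact absurd hxx (hSm x hx)
        · exact hS.fst_inj x hx x' hx' h0 hxx
      · intro x hx x' hx' h0 hxx
        rcases Finset.mem_insert.1 hx with rfl | hx <;>
          rcases Finset.mem_insert.1 hx' with rfl | hx'
        · rfl
        · exact absurd hxx.symm (hbS h0 x' hx')
        · exact absurd hxx (hbS (fun h => h0 (hxx.trans h)) x hx)
        · exact hS.snd_inj x hx x' hx' h0 hxx
      · have himg' : pairVec (Function.update e (m + 1) (projPlus p q y)) f' '' S =
            pairVec e f '' S := by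
          rw [← himg]
          refine Set.image_congr fun x hx => ?_
          rw [pairVec, Function.update_of_ne (hSm x hx), pairVec]
        have hyv : pairVec (Function.update e (m + 1) (projPlus p q y)) f' (m + 1, b) = y := by
          ext (i | i)
          · simp [pairVec, projPlus, LinearMap.funLeft_apply]
          · have := congrFun (hb.trans hyw.symm) i
            simpa [pairVec, projMinus, LinearMap.funLeft_apply] using this
        rw [hW', hW, Finset.coe_insert, Set.image_insert_eq, Submodule.span_insert, sup_comm,
          himg', hyv]
    by_cases hw0 : w = 0
    · exact key 0 f hf (Nat.zero_le q) (hf.zero.trans hw0.symm) (fun h => absurd rfl h) rfl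
    · obtain ⟨b, hbB, hwb, hwb'⟩ := hf.exists_leading (B := B)
        (fun b hb => Finset.mem_Icc.1 (Finset.mem_filter.1 hb).1) hw hw0
      have hbB' := Finset.mem_filter.1 hbB
      refine key (b + 1) _ (hf.update hwb hwb') (Finset.mem_Icc.1 hbB'.1).2
        (Function.update_self _ _ _) (fun _ => hbB'.2) ?_
      refine Set.image_congr fun x hx => ?_
      rw [pairVec, Function.update_of_ne (hbB'.2 x hx), pairVec]

theorem IsPattern.map_range_patMatrix {T : Fin r → ℕ × ℕ} (hT : IsPattern p q T)
    {g : GL (Fin p) ℂ} {g' : GL (Fin q) ℂ} {e : ℕ → Fin p → ℂ} {f : ℕ → Fin q → ℂ}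
    (hge : ∀ a ≤ p, g.val.mulVec (stdVec p a) = e a)
    (hge' : ∀ b ≤ q, g'.val.mulVec (stdVec q b) = f b) :
    (LinearMap.range (patMatrix p q T).mulVecLin).map (blockDiagGL p q (g, g')).val.mulVecLin =
      Submodule.span ℂ (Set.range fun k => pairVec e f (T k)) := by
  rw [Matrix.range_mulVecLin, Submodule.map_span, ← Set.range_comp]
  congr 2
  funext k
  have : (patMatrix p q T).col k = Sum.elim (stdVec p (T k).1) (stdVec q (T k).2) := rfl
  rw [Function.comp_apply, this]
  change (Matrix.fromBlocks g.val 0 0 g'.val).mulVec _ = _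
  rw [Matrix.fromBlocks_mulVec]
  simp [pairVec, hge _ (hT.fst_le k), hge' _ (hT.snd_le k)]

/-- Every point of the double flag variety lies in the orbit of some pattern. -/
theorem exists_mem_orbit (x : DoubleFlagVariety p q r) : ∃ ω : OrbitParam p q r, x ∈ ω.orbit := by
  obtain ⟨e, f, S, he, hf, hS, hW⟩ := exists_normal_form x.Fplus x.Fminus x.W (le_refl p)
  rw [CompleteFlag.step_top, Submodule.comap_top, inf_top_eq] at hW
  obtain ⟨g, hg, hge⟩ := he.exists_gl
  obtain ⟨g', hg', hge'⟩ := hf.exists_gl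
  let T : Fin S.card → ℕ × ℕ := fun k => S.equivFin.symm k
  have hTS : ∀ k, T k ∈ S := fun k => (S.equivFin.symm k).2
  have hTinj : Function.Injective T := Subtype.val_injective.comp S.equivFin.symm.injective
  have hT : IsPattern p q T := by
    refine ⟨fun k => hS.fst_le _ (hTS k), fun k => hS.snd_le _ (hTS k),
      fun k => hS.ne_zero _ (hTS k), fun k k' h h' => ?_, fun k k' h h' => ?_⟩
    · exact hTinj (hS.fst_inj _ (hTS k) _ (hTS k') h h')
    · exact hTinj (hS.snd_inj _ (hTS k) _ (hTS k') h h')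
  have hWT : x.W = (LinearMap.range (patMatrix p q T).mulVecLin).map
      (blockDiagGL p q (g, g')).val.mulVecLin := by
    rw [hW, hT.map_range_patMatrix hge hge']
    congr 1
    ext v
    constructor
    · rintro ⟨s, hs, rfl⟩
      exact ⟨S.equivFin ⟨s, hs⟩, by simp [T]⟩
    · rintro ⟨k, rfl⟩
      exact ⟨T k, hTS k, rfl⟩
  obtain rfl : S.card = r := by
    rw [← x.finrank_W, hWT, finrank_map_mulVecLin]
    exact (Matrix.rank_of_mulVec_injective hT.mulVec_injective).symm
  refine ⟨hT.param, (g, g'), DoubleFlagVariety.ext ?_ ?_ ?_⟩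
  · exact hWT.symm
  · exact hg
  · exact hg'

/-! ### Orbits and rank conditions -/

theorem existsUnique_orbit_eq (x : DoubleFlagVariety p q r) : ∃! ω : OrbitParam p q r,
    MulAction.orbit (GL (Fin p) ℂ × GL (Fin q) ℂ) x = ω.orbit := by
  obtain ⟨ω, hω⟩ := exists_mem_orbit x
  refine ⟨ω, MulAction.orbit_eq_iff.2 hω, fun ω' hω' => OrbitParam.eq_of_rankMat_eq fun i j => ?_⟩
  have hx : x ∈ ω'.orbit := hω' ▸ MulAction.mem_orbit_self x
  rw [← OrbitParam.finrank_of_mem_orbit hω, ← OrbitParam.finrank_of_mem_orbit hx]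

theorem OrbitParam.orbit_eq_setOf (ω : OrbitParam p q r) :
    ω.orbit = {x : DoubleFlagVariety p q r | ∀ (i : Fin (p + 1)) (j : Fin (q + 1)),
      Module.finrank ℂ (x.W ⊓ x.flagSum i j : Submodule ℂ (Fin p ⊕ Fin q → ℂ))
        = ω.rankMat i j} := by
  ext x
  refine ⟨fun hx i j => OrbitParam.finrank_of_mem_orbit hx i j, fun hx => ?_⟩
  obtain ⟨ω', hω'⟩ := exists_mem_orbit x
  have : ω' = ω := OrbitParam.eq_of_rankMat_eq fun i j => by
    rw [← OrbitParam.finrank_of_mem_orbit hω']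
    exact hx i j
  rwa [← this]

end

/-! ### Closures of orbits -/

section

variable {p q r : ℕ}

/-- A frame with standard flags. -/
def stdFrame (A : Matrix (Fin p ⊕ Fin q) (Fin r) ℂ) (hA : A.rank = r) : FrameSpace p q r :=
  (⟨A, hA⟩, 1, 1)

theorem frameMap_stdFrame (A : Matrix (Fin p ⊕ Fin q) (Fin r) ℂ) (hA : A.rank = r) :
    frameMap (stdFrame A hA) = ⟨LinearMap.range A.mulVecLin, hA, stdFlag p, stdFlag q⟩ :=
  DoubleFlagVariety.ext rfl (one_smul _ (stdFlag p)) (one_smul _ (stdFlag q))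

/-- The limit at `t = 0` of a line of frames lies in the closure of the other points. -/
theorem frameMap_zero_mem_closure {A B : Matrix (Fin p ⊕ Fin q) (Fin r) ℂ}
    (h : ∀ t : ℂ, (A + t • B).rank = r) (h₀ : A.rank = r) {O : Set (DoubleFlagVariety p q r)}
    (hO : ∀ t : ℂ, t ≠ 0 → frameMap (stdFrame _ (h t)) ∈ O) :
    frameMap (stdFrame A h₀) ∈ closure O := by
  let d : ℂ → Unit → ℂ := fun t _ => t
  have hγ : @Continuous _ _ (zariskiOf d) _ fun t : ℂ => frameMap (stdFrame _ (h t)) := by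
    let _ := zariskiOf d
    let _ := zariskiOf (frameCoords (p := p) (q := q) (r := r))
    refine continuous_frameMap.comp (continuous_of_isPoly ?_)
    rintro (⟨i, j⟩ | ⟨i, j⟩ | ⟨i, j⟩)
    · exact (IsPolyFun.const (A i j)).add
        ((IsPolyFun.coord (c := d) ()).mul (IsPolyFun.const (B i j)))
    · exact IsPolyFun.const _
    · exact IsPolyFun.const _
  have h0 : frameMap (stdFrame A h₀) = frameMap (stdFrame _ (h 0)) := by
    congr 2
    simp
  rw [h0]
  by_contra hcon
  have hV := (isClosed_closure (s := O)).isOpen_compl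
  have hV' : IsOpen[zariskiOf d] ((fun t : ℂ => frameMap (stdFrame _ (h t))) ⁻¹' (closure O)ᶜ) := by
    let _ := zariskiOf d
    exact hV.preimage hγ
  obtain ⟨_, ⟨F, ⟨P, hP⟩, rfl⟩, hF0, hFV⟩ := by
    let _ := zariskiOf d
    exact (isTopologicalBasis_zariskiOf d).exists_subset_of_mem_open
      (show (0 : ℂ) ∈ _ from hcon) hV'
  -- a polynomial that does not vanish at `0` does not vanish at some `t ≠ 0`
  have hcont : Continuous F := by
    have : F = fun t => MvPolynomial.eval (d t) P := funext hP
    rw [this]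
    exact (MvPolynomial.continuous_eval P).comp (continuous_pi fun _ => continuous_id)
  have hnear : ∀ᶠ t in 𝓝[≠] (0 : ℂ), F t ≠ 0 ∧ t ≠ 0 :=
    ((hcont.continuousAt.eventually_ne hF0).filter_mono nhdsWithin_le_nhds).and
      self_mem_nhdsWithin
  obtain ⟨t, htF, ht⟩ := hnear.exists
  exact hFV htF (subset_closure (hO t ht))

theorem mem_step_stdFlag_iff {n m : ℕ} {v : Fin n → ℂ} :
    v ∈ (stdFlag n).step m ↔ ∀ k : Fin n, m ≤ k → v k = 0 := by
  rw [CompleteFlag.step, mem_stdFlag_iff]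
  refine forall_congr' fun k => ?_
  have : min m n ≤ k ↔ m ≤ k := by omega
  simp only [this]

theorem stdVec_zero (n : ℕ) : stdVec n 0 = 0 := by
  ext i
  simp [stdVec]

theorem isAdapted_stdVec (n : ℕ) : IsAdapted (stdFlag n) (stdVec n) := by
  refine ⟨stdVec_zero n, fun a ha => ?_, fun a ha h => ?_⟩
  · rw [mem_step_stdFlag_iff]
    intro k hk
    rw [stdVec, if_neg (by omega)]
  · rw [mem_step_stdFlag_iff] at h
    have := h ⟨a, ha⟩ le_rfl
    simp [stdVec] at this

theorem isAdapted_update_stdVec {n a a' : ℕ} (ha : a < a') (ha' : a' ≤ n) {t : ℂ} (ht : t ≠ 0) :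
    IsAdapted (stdFlag n)
      (Function.update (stdVec n) a' (stdVec n a + t • stdVec n a')) := by
  obtain ⟨c, rfl⟩ : ∃ c, a' = c + 1 := ⟨a' - 1, by omega⟩
  refine (isAdapted_stdVec n).update ?_ ?_
  · rw [mem_step_stdFlag_iff]
    intro k hk
    simp only [Pi.add_apply, Pi.smul_apply, stdVec]
    rw [if_neg (by omega), if_neg (by omega)]
    simp
  · intro h
    rw [mem_step_stdFlag_iff] at h
    have := h ⟨c, ha'⟩ le_rfl
    simp only [Pi.add_apply, Pi.smul_apply, stdVec] at this
    rw [if_neg (by omega)] at this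
    simp [ht] at this

variable {S T : Fin r → ℕ × ℕ}

/-- A degeneration of patterns follows from a line of matrices, all of whose points but one have
the normal form of the first pattern with respect to varying adapted bases. -/
theorem IsPattern.basePoint_mem_closure_of_line (hS : IsPattern p q S) (hT : IsPattern p q T)
    (B : Matrix (Fin p ⊕ Fin q) (Fin r) ℂ)
    (h : ∀ t : ℂ, t ≠ 0 → ∃ (e : ℕ → Fin p → ℂ) (f : ℕ → Fin q → ℂ), IsAdapted (stdFlag p) e ∧
      IsAdapted (stdFlag q) f ∧ Submodule.span ℂ (Set.range fun k => pairVec e f (T k)) =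
        Submodule.span ℂ (Set.range (patMatrix p q S + t • B).col)) :
    hS.param.basePoint ∈ closure hT.param.orbit := by
  have hS0 := Matrix.rank_of_mulVec_injective hS.mulVec_injective
  have hT0 := Matrix.rank_of_mulVec_injective hT.mulVec_injective
  have key : ∀ t : ℂ, t ≠ 0 → ∃ (g : GL (Fin p) ℂ) (g' : GL (Fin q) ℂ),
      g • stdFlag p = stdFlag p ∧ g' • stdFlag q = stdFlag q ∧
      (LinearMap.range (patMatrix p q T).mulVecLin).map (blockDiagGL p q (g, g')).val.mulVecLin =
        LinearMap.range (patMatrix p q S + t • B).mulVecLin := by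
    intro t ht
    obtain ⟨e, f, he, hf, hspan⟩ := h t ht
    obtain ⟨g, hg, hge⟩ := he.exists_gl
    obtain ⟨g', hg', hge'⟩ := hf.exists_gl
    refine ⟨g, g', hg, hg', ?_⟩
    rw [hT.map_range_patMatrix hge hge', hspan, Matrix.range_mulVecLin]
  have hrank : ∀ t : ℂ, (patMatrix p q S + t • B).rank = r := by
    intro t
    by_cases ht : t = 0
    · subst ht
      rw [zero_smul, add_zero, hS0]
    · obtain ⟨g, g', -, -, h⟩ := key t ht
      rw [Matrix.rank, ← h, finrank_map_mulVecLin]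
      exact hT0
  have : hS.param.basePoint = frameMap (stdFrame _ hS0) := (frameMap_stdFrame _ _).symm
  rw [this]
  refine frameMap_zero_mem_closure hrank hS0 fun t ht => ?_
  obtain ⟨g, g', hg, hg', h⟩ := key t ht
  refine ⟨(g, g'), ?_⟩
  rw [frameMap_stdFrame]
  exact DoubleFlagVariety.ext h hg hg'

theorem PatStep.basePoint_mem_closure (hS : IsPattern p q S) (hT : IsPattern p q T)
    (h : PatStep T S) : hS.param.basePoint ∈ closure hT.param.orbit := by
  cases h with
  | swap k k' a a' b b' hk h h' ha hb =>
    have ha' : a' ≤ p := by have := hT.fst_le k'; rwa [h'] at this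
    have hb' : b ≤ q := by have := hT.snd_le k; rwa [h] at this
    have hT1 : ∀ l, l ≠ k' → (T l).1 ≠ a' := fun l hl h1 =>
      hl (hT.fst_inj l k' (by omega) (by rw [h1, h']))
    have hT2 : ∀ l, l ≠ k → (T l).2 ≠ b := fun l hl h1 =>
      hl (hT.snd_inj l k (by omega) (by rw [h1, h]))
    refine hS.basePoint_mem_closure_of_line hT
      (Matrix.of fun x l => if l = k then pairVec 0 (stdVec q) (0, b) x else 0) fun t ht => ?_
    set N := patMatrix p q (Function.update (Function.update T k (a, b')) k' (a', b)) + t •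
      Matrix.of fun x l => if l = k then pairVec 0 (stdVec q) (0, b) x else 0 with hN
    refine ⟨_, _, isAdapted_update_stdVec ha ha' (neg_ne_zero.2 ht),
      isAdapted_update_stdVec hb hb' ht, ?_⟩
    set e := Function.update (stdVec p) a' (stdVec p a + -t • stdVec p a') with he
    set f := Function.update (stdVec q) b (stdVec q b' + t • stdVec q b) with hf
    have h1 : ∀ l, l ≠ k → l ≠ k' → N.col l = pairVec e f (T l) := by
      intro l hl hl'
      ext (i | i)
      · simp [hN, he, hl, hl', Matrix.col_apply, patMatrix, pairVec, hT1 l hl']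
      · simp [hN, hf, hl, hl', Matrix.col_apply, patMatrix, pairVec, hT2 l hl]
    have h2 : N.col k = pairVec e f (T k) := by
      ext (i | i)
      · simp [hN, he, hk, Matrix.col_apply, patMatrix, pairVec, h, ha.ne]
      · simp [hN, hf, hk, Matrix.col_apply, patMatrix, pairVec, h]
    -- in terms of standard basis vectors `u` and `v`, `e a' = u a - t • u a'` and
    -- `f b = v b' + t • v b`, so that `(e a + f b) - (e a' + f b') = t • (u a' + v b)`
    have h3 : N.col k' = t⁻¹ • (pairVec e f (T k) - pairVec e f (T k')) := by
      ext (i | i)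
      · simp [hN, he, Matrix.col_apply, patMatrix, pairVec, h, h', ha.ne, ht]
      · simp [hN, hf, hk.symm, Matrix.col_apply, patMatrix, pairVec, h, h', hb.ne, ht]
    have h4 : pairVec e f (T k') = N.col k - t • N.col k' := by
      rw [h3, h2, smul_smul, mul_inv_cancel₀ ht, one_smul, sub_sub_cancel]
    apply le_antisymm <;> rw [Submodule.span_le] <;> rintro _ ⟨l, rfl⟩
    · by_cases hl' : l = k'
      · subst hl'
        dsimp only
        rw [h4]
        exact Submodule.sub_mem _ (Submodule.subset_span ⟨k, rfl⟩)
          (Submodule.smul_mem _ _ (Submodule.subset_span ⟨l, rfl⟩))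
      · refine Submodule.subset_span ⟨l, ?_⟩
        by_cases hl : l = k
        · subst hl; exact h2
        · exact h1 l hl hl'
    · by_cases hl' : l = k'
      · subst hl'
        rw [h3]
        exact Submodule.smul_mem _ _ (Submodule.sub_mem _ (Submodule.subset_span ⟨k, rfl⟩)
          (Submodule.subset_span ⟨l, rfl⟩))
      · refine Submodule.subset_span ⟨l, ?_⟩
        by_cases hl : l = k
        · subst hl; exact h2.symm
        · exact (h1 l hl hl').symm
  | snd k a b b' h hb =>
    have hb' : b ≤ q := by have := hT.snd_le k; rwa [h] at this
    have hT2 : ∀ l, l ≠ k → (T l).2 ≠ b := fun l hl h1 =>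
      hl (hT.snd_inj l k (by omega) (by rw [h1, h]))
    refine hS.basePoint_mem_closure_of_line hT
      (Matrix.of fun x l => if l = k then pairVec 0 (stdVec q) (0, b) x else 0) fun t ht =>
      ⟨_, _, isAdapted_stdVec p, isAdapted_update_stdVec hb hb' ht, ?_⟩
    congr 2
    ext l (i | i) <;> by_cases hl : l = k
    · simp [hl, Matrix.col_apply, patMatrix, pairVec, h]
    · simp [hl, Matrix.col_apply, patMatrix, pairVec]
    · simp [hl, Matrix.col_apply, patMatrix, pairVec, h]
    · simp [hl, Matrix.col_apply, patMatrix, pairVec, hT2 l hl]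
  | fst k a a' b h ha =>
    have ha' : a' ≤ p := by have := hT.fst_le k; rwa [h] at this
    have hT1 : ∀ l, l ≠ k → (T l).1 ≠ a' := fun l hl h1 =>
      hl (hT.fst_inj l k (by omega) (by rw [h1, h]))
    refine hS.basePoint_mem_closure_of_line hT
      (Matrix.of fun x l => if l = k then pairVec (stdVec p) 0 (a', 0) x else 0) fun t ht =>
      ⟨_, _, isAdapted_update_stdVec ha ha' ht, isAdapted_stdVec q, ?_⟩
    congr 2
    ext l (i | i) <;> by_cases hl : l = k
    · simp [hl, Matrix.col_apply, patMatrix, pairVec, h]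
    · simp [hl, Matrix.col_apply, patMatrix, pairVec, hT1 l hl]
    · simp [hl, Matrix.col_apply, patMatrix, pairVec, h]
    · simp [hl, Matrix.col_apply, patMatrix, pairVec]

theorem OrbitParam.closure_subset_of_basePoint_mem {ω ω' : OrbitParam p q r}
    (h : ω.basePoint ∈ closure ω'.orbit) : closure ω.orbit ⊆ closure ω'.orbit := by
  refine closure_minimal ?_ isClosed_closure
  rintro _ ⟨g, rfl⟩
  refine map_mem_closure (continuous_const_smul g) h ?_
  rintro _ ⟨g', rfl⟩
  exact ⟨g * g', mul_smul g g' _⟩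

theorem OrbitParam.closure_subset_iff (ω ω' : OrbitParam p q r) :
    closure ω.orbit ⊆ closure ω'.orbit ↔
      ∀ (i : Fin (p + 1)) (j : Fin (q + 1)), ω'.rankMat i j ≤ ω.rankMat i j := by
  constructor
  · intro h i j
    have hmem : ω.basePoint ∈ ω.orbit := MulAction.mem_orbit_self _
    have := closure_minimal (fun x hx => (OrbitParam.finrank_of_mem_orbit hx i j).ge)
      (isClosed_le_finrank_inf i j (ω'.rankMat i j)) (h (subset_closure hmem))
    exact le_of_le_of_eq this (OrbitParam.finrank_of_mem_orbit hmem i j)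
  · intro h
    obtain ⟨S, hS, rfl⟩ := ω.exists_pattern
    obtain ⟨T, hT, rfl⟩ := ω'.exists_pattern
    obtain ⟨T', hrange, hT', hchain⟩ :=
      exists_patStep_chain hS hT (patRank_le_of_rankMat_le hS hT h)
    rw [hS.param_eq hT' hrange]
    clear h hrange
    induction hchain using Relation.ReflTransGen.head_induction_on with
    | refl => exact subset_rfl
    | head hAB _ ih =>
      obtain ⟨hA, hB, hstep⟩ := hAB
      exact (ih hB).trans
        (OrbitParam.closure_subset_of_basePoint_mem (hstep.basePoint_mem_closure hB hA))

end

/-! ### Vector-valued polynomial functions -/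

/-- A function with values in a vector space is polynomial if all its coordinates are. -/
def IsPolyMap {α : Type*} {ι : Type} (c : α → ι → ℂ) {E : Type*} [AddCommGroup E] [Module ℂ E]
    (v : α → E) : Prop :=
  ∀ l : E →ₗ[ℂ] ℂ, IsPolyFun c fun a => l (v a)

namespace IsPolyMap

variable {α : Type*} {ι : Type} {c : α → ι → ℂ} {E G : Type*} [AddCommGroup E] [Module ℂ E]
  [AddCommGroup G] [Module ℂ G]

theorem const (x : E) : IsPolyMap c fun _ => x := fun _ => IsPolyFun.const _

theorem linear_comp {v : α → E} (hv : IsPolyMap c v) (L : E →ₗ[ℂ] G) :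
    IsPolyMap c fun a => L (v a) := fun l => hv (l ∘ₗ L)

theorem add {v w : α → E} (hv : IsPolyMap c v) (hw : IsPolyMap c w) :
    IsPolyMap c fun a => v a + w a := fun l => by
  simpa using (hv l).add (hw l)

theorem sub {v w : α → E} (hv : IsPolyMap c v) (hw : IsPolyMap c w) :
    IsPolyMap c fun a => v a - w a := fun l => by
  simpa using (hv l).sub (hw l)

theorem prodMk {v : α → E} {w : α → G} (hv : IsPolyMap c v) (hw : IsPolyMap c w) :
    IsPolyMap c fun a => (v a, w a) := by
  have := (hv.linear_comp (LinearMap.inl ℂ E G)).add (hw.linear_comp (LinearMap.inr ℂ E G))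
  simpa using this

theorem matrix {m n : Type*} [Fintype m] [Fintype n] {A : α → Matrix m n ℂ}
    (hA : ∀ i j, IsPolyFun c fun a => A a i j) : IsPolyMap c A := by
  classical
  intro l
  have : (fun a => l (A a)) = fun a => ∑ i, ∑ j, A a i j * l (Matrix.single i j 1) := by
    funext a
    conv_lhs => rw [Matrix.matrix_eq_sum_single (A a)]
    simp only [map_sum]
    refine Finset.sum_congr rfl fun i _ => Finset.sum_congr rfl fun j _ => ?_
    rw [← smul_eq_mul, ← map_smul, Matrix.smul_single, smul_eq_mul, mul_one]
  rw [this]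
  exact IsPolyFun.sum _ fun i _ => IsPolyFun.sum _ fun j _ => (hA i j).mul (IsPolyFun.const _)

theorem entry {m n : Type*} {A : α → Matrix m n ℂ} (hA : IsPolyMap c A) (i : m) (j : n) :
    IsPolyFun c fun a => A a i j := hA (Matrix.entryLinearMap ℂ ℂ i j)

theorem matrix_mul {l m n : Type*} [Fintype l] [Fintype m] [Fintype n] {A : α → Matrix l m ℂ}
    {B : α → Matrix m n ℂ} (hA : IsPolyMap c A) (hB : IsPolyMap c B) :
    IsPolyMap c fun a => A a * B a :=
  matrix (IsPolyFun.matrix_mul hA.entry hB.entry)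

/-- The coordinate-free form of `IsPolyFun.exists_linear_solution`. -/
theorem exists_linear_solution [Module.Finite ℂ E] [Module.Finite ℂ G] {L : α → E →ₗ[ℂ] G} {v : G}
    (hL : ∀ u, IsPolyMap c fun a => L a u) {a₀ : α} (h₀ : Function.Injective (L a₀)) :
    ∃ (Q : α → ℂ) (N : α → E), IsPolyFun c Q ∧ IsPolyMap c N ∧ Q a₀ ≠ 0 ∧
      ∀ a, Q a ≠ 0 → Function.Injective (L a) ∧ ∀ u, L a u = v → u = (Q a)⁻¹ • N a := by
  classical
  let bE := Module.finBasis ℂ E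
  let bG := Module.finBasis ℂ G
  have hmul : ∀ a u, (LinearMap.toMatrix bE bG (L a)).mulVec (bE.equivFun u) =
      bG.equivFun (L a u) := fun a u => LinearMap.toMatrix_mulVec_repr bE bG (L a) u
  have hinj : ∀ a, Function.Injective (LinearMap.toMatrix bE bG (L a)).mulVec ↔
      Function.Injective (L a) := by
    intro a
    have : (LinearMap.toMatrix bE bG (L a)).mulVec ∘ bE.equivFun = bG.equivFun ∘ L a :=
      funext (hmul a)
    rw [← Function.Injective.of_comp_iff' _ bE.equivFun.bijective, this,
      Function.Injective.of_comp_iff bG.equivFun.injective]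
  obtain ⟨Q, N, hQ, hN, hQ₀, h⟩ := IsPolyFun.exists_linear_solution
    (C := fun a => LinearMap.toMatrix bE bG (L a)) (v := fun _ => bG.equivFun v) (c := c)
    (fun i j => by
      simp only [LinearMap.toMatrix_apply]
      exact hL (bE j) (bG.coord i)) (fun i => IsPolyFun.const _) ((hinj a₀).2 h₀)
  refine ⟨Q, fun a => bE.equivFun.symm fun j => N j a, hQ, ?_, hQ₀, fun a ha =>
    ⟨(hinj a).1 (h a ha).1, fun u hu => ?_⟩⟩
  · intro l
    simp only [Module.Basis.equivFun_symm_apply, map_sum, map_smul, smul_eq_mul]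
    exact IsPolyFun.sum _ fun j _ => (hN j).mul (IsPolyFun.const _)
  · apply bE.equivFun.injective
    ext j
    rw [(h a ha).2 (bE.equivFun u) (by rw [hmul, hu]) j]
    rw [map_smul, LinearEquiv.apply_symm_apply, Pi.smul_apply, smul_eq_mul, div_eq_inv_mul]

end IsPolyMap

/-! ### Isotropy algebras and the dimension of orbits -/

/-- The algebra of block-diagonal matrices, in which `K` is the group of units. -/
abbrev BlockAlg (p q : ℕ) : Type := Matrix (Fin p) (Fin p) ℂ × Matrix (Fin q) (Fin q) ℂ

/-- The block-diagonal matrix of an element of `BlockAlg p q`. -/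
def blockDiag (p q : ℕ) : BlockAlg p q →ₐ[ℂ] Matrix (Fin p ⊕ Fin q) (Fin p ⊕ Fin q) ℂ :=
  AlgHom.ofLinearMap
    { toFun := fun k => Matrix.fromBlocks k.1 0 0 k.2
      map_add' := fun k l => by simp [Matrix.fromBlocks_add]
      map_smul' := fun c k => by simp [Matrix.fromBlocks_smul] }
    Matrix.fromBlocks_one
    fun k l => by simp [Matrix.fromBlocks_multiply]

/-- The pairs of upper triangular matrices. -/
def upperTri (p q : ℕ) : Submodule ℂ (BlockAlg p q) where
  carrier := {b | (∀ i j, j < i → b.1 i j = 0) ∧ ∀ i j, j < i → b.2 i j = 0}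
  zero_mem' := by simp
  add_mem' := fun {a b} ha hb => ⟨fun i j h => by simp [ha.1 i j h, hb.1 i j h],
    fun i j h => by simp [ha.2 i j h, hb.2 i j h]⟩
  smul_mem' := fun c a ha => ⟨fun i j h => by simp [ha.1 i j h], fun i j h => by simp [ha.2 i j h]⟩

/-- The isotropy algebra of the base point of a pattern: the pairs of matrices preserving the
standard flags and the subspace. -/
def isotropyAlg (p q : ℕ) {r : ℕ} (T : Fin r → ℕ × ℕ) : Submodule ℂ (BlockAlg p q) where
  carrier := {b | b ∈ upperTri p q ∧
    ∃ h : Matrix (Fin r) (Fin r) ℂ, blockDiag p q b * patMatrix p q T = patMatrix p q T * h}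
  zero_mem' := ⟨zero_mem _, 0, by simp⟩
  add_mem' := by
    rintro a b ⟨ha, h, hh⟩ ⟨hb, h', hh'⟩
    exact ⟨add_mem ha hb, h + h', by
      rw [map_add, Matrix.add_mul, hh, hh', Matrix.mul_add]⟩
  smul_mem' := by
    rintro c a ⟨ha, h, hh⟩
    exact ⟨Submodule.smul_mem _ c ha, c • h, by
      rw [map_smul, Matrix.smul_mul, hh, Matrix.mul_smul]⟩

section

variable {p q r : ℕ}

theorem upperTri_mul {a b : BlockAlg p q} (ha : a ∈ upperTri p q) (hb : b ∈ upperTri p q) :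
    a * b ∈ upperTri p q := by
  refine ⟨fun i j h => ?_, fun i j h => ?_⟩
  · change (a.1 * b.1) i j = 0
    rw [Matrix.mul_apply]
    refine Finset.sum_eq_zero fun k _ => ?_
    rcases lt_or_ge k i with hk | hk
    · rw [ha.1 i k hk, zero_mul]
    · rw [hb.1 k j (h.trans_le hk), mul_zero]
  · change (a.2 * b.2) i j = 0
    rw [Matrix.mul_apply]
    refine Finset.sum_eq_zero fun k _ => ?_
    rcases lt_or_ge k i with hk | hk
    · rw [ha.2 i k hk, zero_mul]
    · rw [hb.2 k j (h.trans_le hk), mul_zero]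

theorem one_mem_upperTri : (1 : BlockAlg p q) ∈ upperTri p q :=
  ⟨fun _ _ h => Matrix.one_apply_ne h.ne', fun _ _ h => Matrix.one_apply_ne h.ne'⟩

theorem smul_stdFlag_eq_iff {n : ℕ} (g : GL (Fin n) ℂ) :
    g • stdFlag n = stdFlag n ↔ ∀ i j, j < i → g.val i j = 0 := by
  constructor
  · intro h i j hij
    have h1 : (Pi.single j 1 : Fin n → ℂ) ∈ (stdFlag n).space j.succ := by
      rw [mem_stdFlag_iff]
      intro k hk
      refine Pi.single_eq_of_ne (fun hkj => ?_) _
      subst hkj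
      simp at hk
    have h2 : g.val.mulVec (Pi.single j 1) ∈ (g • stdFlag n).space j.succ :=
      Submodule.mem_map_of_mem h1
    rw [h, mem_stdFlag_iff] at h2
    have := h2 i (by simpa using hij)
    rwa [Matrix.mulVec_single_one] at this
  · intro h
    apply CompleteFlag.ext
    funext l
    apply Submodule.eq_of_le_of_finrank_le
    · rintro _ ⟨v, hv, rfl⟩
      rw [SetLike.mem_coe, mem_stdFlag_iff] at hv
      rw [mem_stdFlag_iff]
      intro k hk
      rw [Matrix.mulVecLin_apply, Matrix.mulVec, dotProduct]
      refine Finset.sum_eq_zero fun j _ => ?_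
      rcases lt_or_ge j k with hj | hj
      · rw [h k j hj, zero_mul]
      · rw [hv j (hk.trans hj), mul_zero]
    · rw [(stdFlag n).finrank_eq, (g • stdFlag n).finrank_eq]

/-- The underlying element of `BlockAlg p q` of an element of `K`. -/
def groupVal (k : GL (Fin p) ℂ × GL (Fin q) ℂ) : BlockAlg p q := (k.1.val, k.2.val)

theorem groupVal_mul (k l : GL (Fin p) ℂ × GL (Fin q) ℂ) :
    groupVal (k * l) = groupVal k * groupVal l := rfl

theorem groupVal_one : groupVal (1 : GL (Fin p) ℂ × GL (Fin q) ℂ) = 1 := rfl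

theorem groupVal_inv_mul (k : GL (Fin p) ℂ × GL (Fin q) ℂ) :
    groupVal k⁻¹ * groupVal k = 1 := by
  rw [← groupVal_mul, inv_mul_cancel, groupVal_one]

theorem blockDiag_groupVal (k : GL (Fin p) ℂ × GL (Fin q) ℂ) :
    blockDiag p q (groupVal k) = (blockDiagGL p q k).val := rfl

theorem exists_groupVal_eq {m : BlockAlg p q} (h : m.1.det ≠ 0) (h' : m.2.det ≠ 0) :
    ∃ k, groupVal k = m :=
  ⟨(Matrix.GeneralLinearGroup.mkOfDetNeZero m.1 h, Matrix.GeneralLinearGroup.mkOfDetNeZero m.2 h'),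
    rfl⟩

theorem groupVal_mem_upperTri_iff (k : GL (Fin p) ℂ × GL (Fin q) ℂ) :
    groupVal k ∈ upperTri p q ↔ k.1 • stdFlag p = stdFlag p ∧ k.2 • stdFlag q = stdFlag q := by
  rw [smul_stdFlag_eq_iff, smul_stdFlag_eq_iff]
  rfl

variable {T : Fin r → ℕ × ℕ}

theorem one_mem_isotropyAlg : (1 : BlockAlg p q) ∈ isotropyAlg p q T :=
  ⟨one_mem_upperTri, 1, by simp⟩

/-- The frame of the base point of a pattern. -/
def IsPattern.frame (hT : IsPattern p q T) : FrameSpace p q r :=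
  stdFrame (patMatrix p q T) (Matrix.rank_of_mulVec_injective hT.mulVec_injective)

theorem IsPattern.frameMap_frame (hT : IsPattern p q T) :
    frameMap hT.frame = hT.param.basePoint := frameMap_stdFrame _ _

theorem IsPattern.smul_basePoint_of_mem (hT : IsPattern p q T) {k : GL (Fin p) ℂ × GL (Fin q) ℂ}
    (hk : groupVal k ∈ isotropyAlg p q T) : k • hT.param.basePoint = hT.param.basePoint := by
  obtain ⟨hk, h, hh⟩ := hk
  obtain ⟨h1, h2⟩ := (groupVal_mem_upperTri_iff k).1 hk
  refine DoubleFlagVariety.ext ?_ h1 h2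
  apply Submodule.eq_of_le_of_finrank_le
  · change Submodule.map (blockDiagGL p q k).val.mulVecLin
      (LinearMap.range (patMatrix p q T).mulVecLin) ≤ LinearMap.range (patMatrix p q T).mulVecLin
    rw [← LinearMap.range_comp, ← Matrix.mulVecLin_mul, ← blockDiag_groupVal, hh,
      Matrix.mulVecLin_mul]
    exact LinearMap.range_comp_le_range _ _
  · rw [hT.param.basePoint.finrank_W, (k • hT.param.basePoint).finrank_W]

/-- A frame of the point `k • x`, for `x` the base point, is the translate by `k` of a frame of
`x`. -/
theorem IsPattern.exists_of_frameMap_eq (hT : IsPattern p q T) {f : FrameSpace p q r}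
    {k : GL (Fin p) ℂ × GL (Fin q) ℂ} (hf : frameMap f = k • hT.param.basePoint) :
    groupVal (f.2⁻¹ * k) ∈ upperTri p q ∧ ∃ h : GL (Fin r) ℂ,
      blockDiag p q (groupVal k) * patMatrix p q T = f.1.1 * h.val := by
  rw [← hT.frameMap_frame, ← frameMap_leftMul] at hf
  obtain ⟨h, s, t, hs, ht, heq⟩ := exists_rightMul_of_frameMap_eq hf
  have h1 : k.1 * 1 = f.2.1 * s := congrArg (fun f => f.2.1) heq
  have h2 : k.2 * 1 = f.2.2 * t := congrArg (fun f => f.2.2) heq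
  have h3 : (blockDiagGL p q k).val * patMatrix p q T = f.1.1 * h.val :=
    congrArg (fun f : FrameSpace p q r => f.1.1) heq
  refine ⟨?_, h, h3⟩
  have h4 : f.2⁻¹ * k = (s, t) := by
    rw [mul_one] at h1 h2
    exact Prod.ext (by simp [h1]) (by simp [h2])
  rw [h4, groupVal_mem_upperTri_iff]
  exact ⟨hs, ht⟩

/-- The linear system which recovers, from a frame `(A, g)` of a point `k • x`, the elements `g * b`
of the coset of `k` modulo the isotropy algebra: the unknowns are `b`, upper triangular, and `h`,
subject to `A * h = g * b * ω`. The projection `P` singles out a point of the coset. -/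
def frameSystem (T : Fin r → ℕ × ℕ) (P : BlockAlg p q →ₗ[ℂ] BlockAlg p q) (f : FrameSpace p q r) :
    (upperTri p q × Matrix (Fin r) (Fin r) ℂ) →ₗ[ℂ]
      (Matrix (Fin p ⊕ Fin q) (Fin r) ℂ × BlockAlg p q) where
  toFun u := (f.1.1 * u.2 - blockDiag p q (groupVal f.2 * u.1) * patMatrix p q T,
    P (groupVal f.2 * u.1))
  map_add' u v := by
    refine Prod.ext ?_ ?_
    · simp only [Prod.fst_add, Prod.snd_add, Submodule.coe_add, mul_add, map_add, Matrix.add_mul,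
        Matrix.mul_add]
      abel
    · simp only [Prod.fst_add, Prod.snd_add, Submodule.coe_add, mul_add, map_add]
  map_smul' c u := by
    refine Prod.ext ?_ ?_
    · simp only [Prod.smul_fst, Prod.smul_snd, Submodule.coe_smul, mul_smul_comm, map_smul,
        Matrix.smul_mul, Matrix.mul_smul, smul_sub, RingHom.id_apply]
    · simp only [Prod.smul_fst, Prod.smul_snd, Submodule.coe_smul, mul_smul_comm, map_smul,
        RingHom.id_apply]

theorem isPolyMap_groupVal_mul {β : Type*} {ι : Type} {c : β → ι → ℂ} {g b : β → BlockAlg p q}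
    (hg : IsPolyMap c g) (hb : IsPolyMap c b) : IsPolyMap c fun a => g a * b a :=
  ((hg.linear_comp (LinearMap.fst ℂ _ _)).matrix_mul (hb.linear_comp (LinearMap.fst ℂ _ _))).prodMk
    ((hg.linear_comp (LinearMap.snd ℂ _ _)).matrix_mul (hb.linear_comp (LinearMap.snd ℂ _ _)))

theorem isPolyMap_frame_groupVal :
    IsPolyMap (frameCoords (p := p) (q := q) (r := r)) fun f => groupVal f.2 :=
  (IsPolyMap.matrix isPolyFun_frame_plus).prodMk (IsPolyMap.matrix isPolyFun_frame_minus)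

theorem isPolyMap_frameSystem (P : BlockAlg p q →ₗ[ℂ] BlockAlg p q)
    (u : upperTri p q × Matrix (Fin r) (Fin r) ℂ) :
    IsPolyMap frameCoords fun f : FrameSpace p q r => frameSystem T P f u := by
  have h := isPolyMap_groupVal_mul (isPolyMap_frame_groupVal (p := p) (q := q) (r := r))
    (IsPolyMap.const (u.1 : BlockAlg p q))
  exact (((IsPolyMap.matrix isPolyFun_frame_matrix).matrix_mul (IsPolyMap.const u.2)).sub
    ((h.linear_comp (blockDiag p q).toLinearMap).matrix_mul (IsPolyMap.const _))).prodMk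
    (h.linear_comp P)

theorem frameSystem_frame_injective (hT : IsPattern p q T) {P : BlockAlg p q →ₗ[ℂ] BlockAlg p q}
    (hP : ∀ b ∈ isotropyAlg p q T, P b = b) : Function.Injective (frameSystem T P hT.frame) := by
  rw [← LinearMap.ker_eq_bot, LinearMap.ker_eq_bot']
  rintro ⟨⟨b, hb⟩, h⟩ hu
  have h1 : patMatrix p q T * h - blockDiag p q (1 * b) * patMatrix p q T = 0 :=
    congrArg Prod.fst hu
  have h2 : P (1 * b) = 0 := congrArg Prod.snd hu
  rw [one_mul] at h1 h2
  rw [hP b ⟨hb, h, (sub_eq_zero.1 h1).symm⟩] at h2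
  subst h2
  rw [map_zero, Matrix.zero_mul, sub_zero] at h1
  have h3 : h = 0 := by
    ext i j
    have : (patMatrix p q T).mulVec (h.col j) = (patMatrix p q T).mulVec 0 := by
      rw [Matrix.mulVec_zero]
      ext x
      exact congrFun (congrFun h1 x) j
    exact congrFun (hT.mulVec_injective this) i
  subst h3
  rfl

/-- Each element of the isotropy algebra gives a solution, without the normalization, of the linear
system attached to a frame. -/
theorem IsPattern.exists_frameSystem_solution (hT : IsPattern p q T)
    (P : BlockAlg p q →ₗ[ℂ] BlockAlg p q) {f : FrameSpace p q r}
    {k : GL (Fin p) ℂ × GL (Fin q) ℂ} (hf : frameMap f = k • hT.param.basePoint)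
    {a : BlockAlg p q} (ha : a ∈ isotropyAlg p q T) :
    ∃ u, groupVal f.2 * (u.1 : BlockAlg p q) = groupVal k * a ∧
      frameSystem T P f u = (0, P (groupVal k * a)) := by
  obtain ⟨hb, h, hh⟩ := hT.exists_of_frameMap_eq hf
  obtain ⟨ha, h', hh'⟩ := ha
  have h1 : groupVal f.2 * (groupVal (f.2⁻¹ * k) * a) = groupVal k * a := by
    rw [← mul_assoc, ← groupVal_mul, mul_inv_cancel_left]
  refine ⟨(⟨_, upperTri_mul hb ha⟩, h.val * h'), h1, Prod.ext ?_ ?_⟩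
  · change f.1.1 * (h.val * h') -
      blockDiag p q (groupVal f.2 * (groupVal (f.2⁻¹ * k) * a)) * patMatrix p q T = 0
    rw [h1, map_mul, Matrix.mul_assoc, hh', ← Matrix.mul_assoc, ← Matrix.mul_assoc, hh, sub_self]
  · change P (groupVal f.2 * (groupVal (f.2⁻¹ * k) * a)) = _
    rw [h1]

instance (x : DoubleFlagVariety p q r) : ContinuousConstSMul (GL (Fin p) ℂ × GL (Fin q) ℂ)
    (MulAction.orbit (GL (Fin p) ℂ × GL (Fin q) ℂ) x) :=
  ⟨fun k => ((continuous_const_smul k).comp continuous_subtype_val).subtype_mk _⟩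

/-- The dimension of an orbit is the codimension of the isotropy algebra. Near the base point `x`,
the map `z ↦ (1 + R z) • x`, for `R` a parametrization of a complement of the isotropy algebra, is
an open embedding of an open part of `ℂ^d` in the orbit: its inverse is a rational function of
frames, given by the solution of the linear system `frameSystem`. -/
theorem IsPattern.topologicalKrullDim_orbit (hT : IsPattern p q T) {d : ℕ}
    (Ψ : BlockAlg p q →ₗ[ℂ] (Fin d → ℂ)) (hΨ : Function.Surjective Ψ)
    (hker : ∀ b, Ψ b = 0 ↔ b ∈ isotropyAlg p q T) :
    topologicalKrullDim hT.param.orbit = d := by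
  obtain ⟨R, hR⟩ := Ψ.exists_rightInverse_of_surjective (LinearMap.range_eq_top.2 hΨ)
  have hΨR : ∀ z, Ψ (R z) = z := fun z => LinearMap.congr_fun hR z
  -- the projection on the isotropy algebra along the range of `R`; the elements `m` of the form
  -- `1 + R z` are those with `P m = 1`
  let P : BlockAlg p q →ₗ[ℂ] BlockAlg p q := LinearMap.id - R ∘ₗ Ψ
  have hP : ∀ b, P b = b - R (Ψ b) := fun b => rfl
  have hΨ1 : Ψ 1 = 0 := (hker 1).2 one_mem_isotropyAlg
  have hPA : ∀ b ∈ isotropyAlg p q T, P b = b := fun b hb => by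
    rw [hP, (hker b).2 hb, map_zero, sub_zero]
  have hPmem : ∀ b, P b ∈ isotropyAlg p q T := fun b => by
    rw [← hker, hP, map_sub, hΨR, sub_self]
  let κ : ZariskiSpace (Fin d) → BlockAlg p q := fun z => 1 + R z.coords
  have hΨκ : ∀ z, Ψ (κ z) = z.coords := fun z => by rw [map_add, hΨ1, hΨR, zero_add]
  have hPκ : ∀ z, P (κ z) = 1 := fun z => by rw [hP, hΨκ, add_sub_cancel_right]
  have hκΨ : ∀ m, P m = 1 → m = κ (Ψ m) := fun m hm => by
    rw [hP, sub_eq_iff_eq_add] at hm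
    exact hm
  obtain ⟨Q, N, ⟨PQ, hPQ⟩, hN, hQ₀, hsol⟩ := IsPolyMap.exists_linear_solution
    (v := ((0, 1) : Matrix (Fin p ⊕ Fin q) (Fin r) ℂ × BlockAlg p q))
    (isPolyMap_frameSystem (T := T) P) (frameSystem_frame_injective hT hPA)
  have hQ : IsPolyFun frameCoords Q := ⟨PQ, hPQ⟩
  -- the coordinates of the frame `(1 + R z) • (ω, 1, 1)`
  let γ : ZariskiSpace (Fin d) → FrameIndex p q r → ℂ := fun z =>
    Sum.elim (fun ij => (blockDiag p q (κ z) * patMatrix p q T) ij.1 ij.2)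
      (Sum.elim (fun ij => (κ z).1 ij.1 ij.2) (fun ij => (κ z).2 ij.1 ij.2))
  have hcoords : IsPolyMap (ZariskiSpace.coords (ι := Fin d))
      (ZariskiSpace.coords (ι := Fin d)) := by
    intro l
    have : (fun z : ZariskiSpace (Fin d) => l z.coords) =
        fun z => ∑ i, z.coords i * l (Pi.single i 1) := by
      funext z
      rw [LinearMap.pi_apply_eq_sum_univ l z.coords]
      refine Finset.sum_congr rfl fun i _ => ?_
      rw [smul_eq_mul]
      congr 2
      funext j
      simp [Pi.single_apply, eq_comm]
    rw [this]
    exact IsPolyFun.sum _ fun i _ => (IsPolyFun.coord i).mul (IsPolyFun.const _)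
  have hκ : IsPolyMap (ZariskiSpace.coords (ι := Fin d)) κ :=
    (IsPolyMap.const 1).add (hcoords.linear_comp R)
  have hκ1 : ∀ i j, IsPolyFun (ZariskiSpace.coords (ι := Fin d)) fun z => (κ z).1 i j :=
    (hκ.linear_comp (LinearMap.fst ℂ _ _)).entry
  have hκ2 : ∀ i j, IsPolyFun (ZariskiSpace.coords (ι := Fin d)) fun z => (κ z).2 i j :=
    (hκ.linear_comp (LinearMap.snd ℂ _ _)).entry
  have hγ : ∀ i, IsPolyFun (ZariskiSpace.coords (ι := Fin d)) fun z => γ z i := by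
    rintro (⟨i, j⟩ | ⟨i, j⟩ | ⟨i, j⟩)
    · exact ((hκ.linear_comp (blockDiag p q).toLinearMap).matrix_mul (IsPolyMap.const _)).entry i j
    · exact hκ1 i j
    · exact hκ2 i j
  have hH : IsPolyFun (ZariskiSpace.coords (ι := Fin d)) fun z =>
      (κ z).1.det * (κ z).2.det * MvPolynomial.eval (γ z) PQ :=
    ((IsPolyFun.det hκ1).mul (IsPolyFun.det hκ2)).mul (IsPolyFun.eval hγ PQ)
  -- where `1 + R z` is invertible and the linear system of its frame can be solved
  let D : Set (ZariskiSpace (Fin d)) :=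
    {z | (κ z).1.det * (κ z).2.det * MvPolynomial.eval (γ z) PQ ≠ 0}
  have hD : IsOpen D := hH.isOpen
  have hDk : ∀ z : D, ∃ k, groupVal k = κ z := fun z =>
    exists_groupVal_eq (left_ne_zero_of_mul (left_ne_zero_of_mul z.2))
      (right_ne_zero_of_mul (left_ne_zero_of_mul z.2))
  choose k hk using hDk
  let F : D → FrameSpace p q r := fun z => FrameSpace.leftMul (k z) hT.frame
  have hFγ : ∀ z, frameCoords (F z) = γ z := by
    intro z
    funext x
    rcases x with ⟨i, j⟩ | ⟨i, j⟩ | ⟨i, j⟩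
    · change (blockDiag p q (groupVal (k z)) * patMatrix p q T) i j = _
      rw [hk]
      rfl
    · change ((groupVal (k z)).1 * (1 : Matrix (Fin p) (Fin p) ℂ)) i j = _
      rw [hk, mul_one]
      rfl
    · change ((groupVal (k z)).2 * (1 : Matrix (Fin q) (Fin q) ℂ)) i j = _
      rw [hk, mul_one]
      rfl
  have hF : ∀ z, frameMap (F z) = k z • hT.param.basePoint := fun z => by
    rw [← hT.frameMap_frame, ← frameMap_leftMul]
  have hF2 : ∀ z, groupVal (F z).2 = κ z := fun z => by
    rw [← hk]
    exact mul_one (groupVal (k z))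
  have hQF : ∀ z, Q (F z) ≠ 0 := fun z => by
    rw [hPQ, hFγ]
    exact right_ne_zero_of_mul z.2
  let φ : D → MulAction.orbit (GL (Fin p) ℂ × GL (Fin q) ℂ) hT.param.basePoint :=
    fun z => ⟨k z • hT.param.basePoint, MulAction.mem_orbit _ _⟩
  have hφc : Continuous φ := by
    refine Continuous.subtype_mk ?_ _
    have : (fun z => k z • hT.param.basePoint) = frameMap ∘ F := funext fun z => (hF z).symm
    rw [this]
    let _ := zariskiOf (frameCoords (p := p) (q := q) (r := r))
    refine continuous_frameMap.comp (continuous_zariskiOf fun G ⟨PG, hG⟩ => ?_)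
    have : {z | G (F z) ≠ 0} = Subtype.val ⁻¹'
        {z : ZariskiSpace (Fin d) | MvPolynomial.eval (γ z) PG ≠ 0} := by
      ext z
      change G (F z) ≠ 0 ↔ MvPolynomial.eval (γ z) PG ≠ 0
      rw [hG, hFγ]
    rw [this]
    exact (IsPolyFun.eval hγ PG).isOpen.preimage continuous_subtype_val
  -- the rational map recovering `z` from a frame
  have hsolz : ∀ f, Q f ≠ 0 → ∀ g : GL (Fin p) ℂ × GL (Fin q) ℂ,
      frameMap f = g • hT.param.basePoint → ∀ a ∈ isotropyAlg p q T, P (groupVal g * a) = 1 →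
      groupVal g * a = groupVal f.2 * ((Q f)⁻¹ • ((N f).1 : BlockAlg p q)) := by
    intro f hf g hg a ha h1
    obtain ⟨u, hu, hu'⟩ := hT.exists_frameSystem_solution P hg ha
    rw [h1] at hu'
    rw [← hu, (hsol f hf).2 u hu']
    rfl
  have hκF : ∀ z : D, κ z = groupVal (F z).2 * ((Q (F z))⁻¹ • ((N (F z)).1 : BlockAlg p q)) := by
    intro z
    rw [← hsolz (F z) (hQF z) (k z) (hF z) 1 one_mem_isotropyAlg, mul_one, hk]
    rw [mul_one, hk, hPκ]
  have hφi : Function.Injective φ := by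
    intro z z' h
    have h' : k z • hT.param.basePoint = k z' • hT.param.basePoint := congrArg Subtype.val h
    have h1 := hsolz (F z) (hQF z) (k z') ((hF z).trans h') 1 one_mem_isotropyAlg
      (by rw [mul_one, hk, hPκ])
    rw [mul_one, hk, ← hκF z] at h1
    apply Subtype.ext
    have h2 := congrArg Ψ h1
    rw [hΨκ, hΨκ] at h2
    exact h2.symm
  -- near `φ z₀`, a point of the orbit has a frame `f` at which the system can be solved, with
  -- solution in the given neighbourhood `{G ≠ 0}` of `z₀`
  have hφo : IsOpenMap φ := by
    intro U hU
    rw [isOpen_iff_forall_mem_open]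
    rintro _ ⟨z₀, hz₀, rfl⟩
    obtain ⟨U₀, hU₀, rfl⟩ := isOpen_induced_iff.1 hU
    obtain ⟨_, ⟨G, hG, rfl⟩, hzG, hGU⟩ :=
      (isTopologicalBasis_zariskiOf (ZariskiSpace.coords (ι := Fin d))).exists_subset_of_mem_open
        (show (z₀ : ZariskiSpace (Fin d)) ∈ U₀ from hz₀) hU₀
    obtain ⟨PG, hPG⟩ := hG.mul hH
    have hnum : ∀ i, IsPolyFun frameCoords fun f : FrameSpace p q r =>
        Ψ (groupVal f.2 * ((N f).1 : BlockAlg p q)) i := by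
      intro i
      exact (isPolyMap_groupVal_mul isPolyMap_frame_groupVal (hN.linear_comp
        ((upperTri p q).subtype ∘ₗ LinearMap.fst ℂ _ _))).linear_comp Ψ (LinearMap.proj i)
    obtain ⟨n, H', hH', hH'e⟩ := IsPolyFun.eval_div hnum hQ PG
    have hrat : ∀ f, (fun i => Ψ (groupVal f.2 * ((N f).1 : BlockAlg p q)) i / Q f) =
        Ψ (groupVal f.2 * ((Q f)⁻¹ • ((N f).1 : BlockAlg p q))) := by
      intro f
      funext i
      rw [mul_smul_comm, map_smul, Pi.smul_apply, smul_eq_mul, div_eq_inv_mul]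
    let V : Set (FrameSpace p q r) := {f | Q f * H' f ≠ 0}
    refine ⟨Subtype.val ⁻¹' (frameMap '' V), ?_, ?_, F z₀, ?_, hF z₀⟩
    · rintro ⟨_, g, rfl⟩ ⟨f, hfV, hf⟩
      dsimp only at hf
      have hQf : Q f ≠ 0 := left_ne_zero_of_mul hfV
      -- some element `g * a` of the coset of `g` satisfies the normalization
      obtain ⟨a, ha, hPa⟩ : ∃ a ∈ isotropyAlg p q T, P (groupVal g * a) = 1 := by
        -- an injective endomorphism of the isotropy algebra, hence with `1` in its range
        let Λ : isotropyAlg p q T →ₗ[ℂ] isotropyAlg p q T :=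
          (P ∘ₗ LinearMap.mulLeft ℂ (groupVal g) ∘ₗ (isotropyAlg p q T).subtype).codRestrict _
            fun a => hPmem _
        have hΛ : Function.Injective Λ := by
          rw [← LinearMap.ker_eq_bot, LinearMap.ker_eq_bot']
          intro a ha
          have ha' : P (groupVal g * a) = 0 := congrArg Subtype.val ha
          obtain ⟨u, hu, hu'⟩ := hT.exists_frameSystem_solution P hf a.2
          rw [ha'] at hu'
          have hu0 : u = 0 := (hsol f hQf).1 (hu'.trans (map_zero _).symm)
          rw [hu0] at hu
          have h3 : (0 : BlockAlg p q) = groupVal g * a := by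
            rw [← hu]
            exact (mul_zero _).symm
          apply Subtype.ext
          have h4 := congrArg (fun m => groupVal g⁻¹ * m) h3
          simp only [mul_zero, ← mul_assoc, groupVal_inv_mul, one_mul] at h4
          exact h4.symm
        obtain ⟨a, ha⟩ := (LinearMap.injective_iff_surjective.1 hΛ) ⟨1, one_mem_isotropyAlg⟩
        exact ⟨a, a.2, congrArg Subtype.val ha⟩
      have h1 := hsolz f hQf g hf a ha hPa
      have h2 := hκΨ _ hPa
      let z : ZariskiSpace (Fin d) := Ψ (groupVal g * a)
      have hz : MvPolynomial.eval z.coords PG ≠ 0 := by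
        have : z.coords = fun i => Ψ (groupVal f.2 * ((N f).1 : BlockAlg p q)) i / Q f := by
          rw [hrat, ← h1]
          rfl
        rw [this, hH'e f hQf]
        exact div_ne_zero (right_ne_zero_of_mul hfV) (pow_ne_zero _ hQf)
      rw [← hPG] at hz
      have hzD : z ∈ D := right_ne_zero_of_mul hz
      refine ⟨⟨z, hzD⟩, hGU (left_ne_zero_of_mul hz), Subtype.ext ?_⟩
      have h3 : groupVal (g⁻¹ * k ⟨z, hzD⟩) = a := by
        rw [groupVal_mul, hk, ← h2, ← mul_assoc, groupVal_inv_mul, one_mul]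
      have h4 := hT.smul_basePoint_of_mem (k := g⁻¹ * k ⟨z, hzD⟩) (by rw [h3]; exact ha)
      rw [mul_smul, inv_smul_eq_iff] at h4
      exact h4
    · refine IsOpen.preimage continuous_subtype_val (isOpenMap_frameMap V ?_)
      exact (hQ.mul hH').isOpen
    · have hQz := hQF z₀
      refine mul_ne_zero hQz fun h0 => ?_
      have h1 := hH'e (F z₀) hQz
      rw [h0, zero_div, hrat, ← hκF, hΨκ, ← hPG] at h1
      exact mul_ne_zero hzG z₀.2 h1
  have hne : D.Nonempty := by
    refine ⟨(0 : Fin d → ℂ), ?_⟩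
    have h0 : κ (0 : Fin d → ℂ) = 1 := by
      change 1 + R 0 = 1
      rw [map_zero, add_zero]
    change (κ (0 : Fin d → ℂ)).1.det * (κ (0 : Fin d → ℂ)).2.det * MvPolynomial.eval _ PQ ≠ 0
    have h1 : γ (0 : Fin d → ℂ) = frameCoords hT.frame := by
      funext x
      rcases x with ⟨i, j⟩ | ⟨i, j⟩ | ⟨i, j⟩
      · change (blockDiag p q (κ (0 : Fin d → ℂ)) * patMatrix p q T) i j = _
        rw [h0, map_one, Matrix.one_mul]
        rfl
      · change (κ (0 : Fin d → ℂ)).1 i j = _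
        rw [h0]
        rfl
      · change (κ (0 : Fin d → ℂ)).2 i j = _
        rw [h0]
        rfl
    rw [h1, ← hPQ, h0]
    simpa using hQ₀
  have : Nonempty D := hne.to_subtype
  change topologicalKrullDim (MulAction.orbit (GL (Fin p) ℂ × GL (Fin q) ℂ) hT.param.basePoint) = _
  rw [topologicalKrullDim_eq_of_isOpenEmbedding (G := GL (Fin p) ℂ × GL (Fin q) ℂ)
    (IsOpenEmbedding.of_continuous_injective_isOpenMap hφc hφi hφo)]
  exact topologicalKrullDim_of_isOpen hD hne

end

/-! ### The codimension of the isotropy algebra -/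

section

variable {p q r : ℕ} {T : Fin r → ℕ × ℕ}

theorem IsPattern.degPlus_cases (hT : IsPattern p q T) (i : Fin p) :
    (hT.param.degPlus i = 0 ∧ ∀ k, (i : ℕ) + 1 ≠ (T k).1) ∨
    (hT.param.degPlus i = 1 ∧ ∃ k, ∃ j : Fin q, T k = ((i : ℕ) + 1, (j : ℕ) + 1)) ∨
    (hT.param.degPlus i = 2 ∧ ∃ k, T k = ((i : ℕ) + 1, 0)) := by
  simp only [OrbitParam.degPlus, hT.isMarkedPlus_iff, hT.isEdge_iff]
  split_ifs with h1 h2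
  · exact Or.inr (Or.inr ⟨rfl, h1⟩)
  · obtain ⟨j, k, hk⟩ := h2
    exact Or.inr (Or.inl ⟨rfl, k, j, hk⟩)
  · refine Or.inl ⟨rfl, fun k hk => ?_⟩
    by_cases h0 : (T k).2 = 0
    · exact h1 ⟨k, Prod.ext hk.symm h0⟩
    · have := hT.snd_le k
      exact h2 ⟨⟨(T k).2 - 1, by omega⟩, k, Prod.ext hk.symm (by simp only; omega)⟩

theorem IsPattern.degMinus_cases (hT : IsPattern p q T) (j : Fin q) :
    (hT.param.degMinus j = 0 ∧ ∀ k, (j : ℕ) + 1 ≠ (T k).2) ∨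
    (hT.param.degMinus j = 1 ∧ ∃ k, ∃ i : Fin p, T k = ((i : ℕ) + 1, (j : ℕ) + 1)) ∨
    (hT.param.degMinus j = 2 ∧ ∃ k, T k = (0, (j : ℕ) + 1)) := by
  simp only [OrbitParam.degMinus, hT.isMarkedMinus_iff, hT.isEdge_iff]
  split_ifs with h1 h2
  · exact Or.inr (Or.inr ⟨rfl, h1⟩)
  · obtain ⟨j, k, hk⟩ := h2
    exact Or.inr (Or.inl ⟨rfl, k, j, hk⟩)
  · refine Or.inl ⟨rfl, fun k hk => ?_⟩
    by_cases h0 : (T k).1 = 0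
    · exact h1 ⟨k, Prod.ext h0 hk.symm⟩
    · have := hT.fst_le k
      exact h2 ⟨⟨(T k).1 - 1, by omega⟩, k, Prod.ext (by simp only; omega) hk.symm⟩

theorem IsPattern.edge_left_unique (hT : IsPattern p q T) {i : Fin p} {j j' : Fin q}
    (h : hT.param.IsEdge i j) (h' : hT.param.IsEdge i j') : j = j' := by
  rw [hT.isEdge_iff] at h h'
  obtain ⟨k, hk⟩ := h
  obtain ⟨k', hk'⟩ := h'
  obtain rfl := hT.fst_inj k k' (by simp [hk]) (by simp [hk, hk'])
  rw [hk, Prod.mk.injEq] at hk'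
  exact Fin.ext (by omega)

theorem IsPattern.edge_right_unique (hT : IsPattern p q T) {i i' : Fin p} {j : Fin q}
    (h : hT.param.IsEdge i j) (h' : hT.param.IsEdge i' j) : i = i' := by
  rw [hT.isEdge_iff] at h h'
  obtain ⟨k, hk⟩ := h
  obtain ⟨k', hk'⟩ := h'
  obtain rfl := hT.snd_inj k k' (by simp [hk]) (by simp [hk, hk'])
  rw [hk, Prod.mk.injEq] at hk'
  exact Fin.ext (by omega)

theorem IsPattern.degPlus_of_edge (hT : IsPattern p q T) {i : Fin p} {j : Fin q}
    (h : hT.param.IsEdge i j) : hT.param.degPlus i = 1 := by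
  obtain ⟨k, hk⟩ := (hT.isEdge_iff i j).1 h
  rcases hT.degPlus_cases i with ⟨-, h'⟩ | ⟨h', -⟩ | ⟨-, k', hk'⟩
  · exact absurd (by rw [hk]) (h' k)
  · exact h'
  · obtain rfl := hT.fst_inj k k' (by simp [hk]) (by simp [hk, hk'])
    simp [hk] at hk'

theorem IsPattern.degMinus_of_edge (hT : IsPattern p q T) {i : Fin p} {j : Fin q}
    (h : hT.param.IsEdge i j) : hT.param.degMinus j = 1 := by
  obtain ⟨k, hk⟩ := (hT.isEdge_iff i j).1 h
  rcases hT.degMinus_cases j with ⟨-, h'⟩ | ⟨h', -⟩ | ⟨-, k', hk'⟩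
  · exact absurd (by rw [hk]) (h' k)
  · exact h'
  · obtain rfl := hT.snd_inj k k' (by simp [hk]) (by simp [hk, hk'])
    simp [hk] at hk'

theorem blockDiag_mul_patMatrix_inl (b : BlockAlg p q) (i : Fin p) (k : Fin r) :
    (blockDiag p q b * patMatrix p q T) (Sum.inl i) k = (b.1.mulVec (stdVec p (T k).1)) i := by
  change ∑ x, Matrix.fromBlocks b.1 0 0 b.2 (Sum.inl i) x * patMatrix p q T x k = _
  rw [Fintype.sum_sum_type]
  simp [Matrix.mulVec, dotProduct, patMatrix]

theorem blockDiag_mul_patMatrix_inr (b : BlockAlg p q) (j : Fin q) (k : Fin r) :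
    (blockDiag p q b * patMatrix p q T) (Sum.inr j) k = (b.2.mulVec (stdVec q (T k).2)) j := by
  change ∑ x, Matrix.fromBlocks b.1 0 0 b.2 (Sum.inr j) x * patMatrix p q T x k = _
  rw [Fintype.sum_sum_type]
  simp [Matrix.mulVec, dotProduct, patMatrix]

theorem mulVec_stdVec_succ {n : ℕ} (A : Matrix (Fin n) (Fin n) ℂ) (i l : Fin n) :
    A.mulVec (stdVec n ((l : ℕ) + 1)) i = A i l := by
  simp [Matrix.mulVec, dotProduct, stdVec, Fin.val_inj]

theorem patMatrix_mulVec_inl_eq_zero {i : Fin p} (h : ∀ k, (i : ℕ) + 1 ≠ (T k).1) (w : Fin r → ℂ) :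
    (patMatrix p q T).mulVec w (Sum.inl i) = 0 := by
  rw [Matrix.mulVec, dotProduct]
  refine Finset.sum_eq_zero fun k _ => ?_
  rw [patMatrix_inl, if_neg (h k), zero_mul]

theorem patMatrix_mulVec_inr_eq_zero {j : Fin q} (h : ∀ k, (j : ℕ) + 1 ≠ (T k).2) (w : Fin r → ℂ) :
    (patMatrix p q T).mulVec w (Sum.inr j) = 0 := by
  rw [Matrix.mulVec, dotProduct]
  refine Finset.sum_eq_zero fun k _ => ?_
  rw [patMatrix_inr, if_neg (h k), zero_mul]

/-- A vector lies in the image of the matrix of a pattern when its coordinates vanish at the free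
vertices and agree at the ends of the edges. -/
theorem IsPattern.exists_mulVec_eq (hT : IsPattern p q T) {v : Fin p ⊕ Fin q → ℂ}
    (h1 : ∀ i, hT.param.degPlus i = 0 → v (Sum.inl i) = 0)
    (h2 : ∀ j, hT.param.degMinus j = 0 → v (Sum.inr j) = 0)
    (h3 : ∀ i j, hT.param.IsEdge i j → v (Sum.inl i) = v (Sum.inr j)) :
    ∃ w, (patMatrix p q T).mulVec w = v := by
  have hw : ∀ k, ∃ c, (∀ i : Fin p, (i : ℕ) + 1 = (T k).1 → v (Sum.inl i) = c) ∧
      ∀ j : Fin q, (j : ℕ) + 1 = (T k).2 → v (Sum.inr j) = c := by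
    intro k
    rcases hT.cases k with ⟨i, hi⟩ | ⟨j, hj⟩
    · refine ⟨v (Sum.inl i), fun i' hi' => ?_, fun j hj => ?_⟩
      · rw [show i' = i from Fin.ext (by omega)]
      · exact (h3 i j ((hT.isEdge_iff i j).2 ⟨k, Prod.ext hi.symm hj.symm⟩)).symm
    · refine ⟨v (Sum.inr j), fun i hi => ?_, fun j' hj' => ?_⟩
      · exact h3 i j ((hT.isEdge_iff i j).2 ⟨k, Prod.ext hi.symm hj.symm⟩)
      · rw [show j' = j from Fin.ext (by omega)]
  choose w hw1 hw2 using hw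
  refine ⟨w, ?_⟩
  ext (i | j)
  · by_cases h : ∃ k, (i : ℕ) + 1 = (T k).1
    · obtain ⟨k, hk⟩ := h
      rw [hT.mulVec_inl w hk, hw1 k i hk]
    · push Not at h
      have h0 : hT.param.degPlus i = 0 := by
        rcases hT.degPlus_cases i with ⟨h', -⟩ | ⟨-, k, j, hk⟩ | ⟨-, k, hk⟩
        · exact h'
        · exact absurd (by rw [hk]) (h k)
        · exact absurd (by rw [hk]) (h k)
      rw [h1 i h0]
      exact patMatrix_mulVec_inl_eq_zero h w
  · by_cases h : ∃ k, (j : ℕ) + 1 = (T k).2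
    · obtain ⟨k, hk⟩ := h
      rw [hT.mulVec_inr w hk, hw2 k j hk]
    · push Not at h
      have h0 : hT.param.degMinus j = 0 := by
        rcases hT.degMinus_cases j with ⟨h', -⟩ | ⟨-, k, i, hk⟩ | ⟨-, k, hk⟩
        · exact h'
        · exact absurd (by rw [hk]) (h k)
        · exact absurd (by rw [hk]) (h k)
      rw [h2 j h0]
      exact patMatrix_mulVec_inr_eq_zero h w

/-- The equations of the isotropy algebra. -/
theorem IsPattern.mem_isotropyAlg_iff (hT : IsPattern p q T) (b : BlockAlg p q) :
    b ∈ isotropyAlg p q T ↔ b ∈ upperTri p q ∧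
      (∀ i l, hT.param.degPlus i < hT.param.degPlus l → b.1 i l = 0) ∧
      (∀ j m, hT.param.degMinus j < hT.param.degMinus m → b.2 j m = 0) ∧
      ∀ i j l m, hT.param.IsEdge i j → hT.param.IsEdge l m → b.1 i l = b.2 j m := by
  constructor
  · rintro ⟨hb, h, hh⟩
    have hl : ∀ i k, b.1.mulVec (stdVec p (T k).1) i =
        (patMatrix p q T).mulVec (fun l => h l k) (Sum.inl i) := fun i k => by
      rw [← blockDiag_mul_patMatrix_inl, hh]
      rfl
    have hr : ∀ j k, b.2.mulVec (stdVec q (T k).2) j =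
        (patMatrix p q T).mulVec (fun l => h l k) (Sum.inr j) := fun j k => by
      rw [← blockDiag_mul_patMatrix_inr, hh]
      rfl
    have hedge : ∀ i j k, hT.param.IsEdge i j →
        b.1.mulVec (stdVec p (T k).1) i = b.2.mulVec (stdVec q (T k).2) j := by
      intro i j k hij
      obtain ⟨k', hk'⟩ := (hT.isEdge_iff i j).1 hij
      rw [hl, hr, hT.mulVec_inl _ (k := k') (by rw [hk']), hT.mulVec_inr _ (k := k') (by rw [hk'])]
    have hfree : ∀ i k, hT.param.degPlus i = 0 → b.1.mulVec (stdVec p (T k).1) i = 0 := by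
      intro i k hi
      rcases hT.degPlus_cases i with ⟨-, h'⟩ | ⟨h', -⟩ | ⟨h', -⟩
      · rw [hl]
        exact patMatrix_mulVec_inl_eq_zero h' _
      · omega
      · omega
    have hfree' : ∀ j k, hT.param.degMinus j = 0 → b.2.mulVec (stdVec q (T k).2) j = 0 := by
      intro i k hi
      rcases hT.degMinus_cases i with ⟨-, h'⟩ | ⟨h', -⟩ | ⟨h', -⟩
      · rw [hr]
        exact patMatrix_mulVec_inr_eq_zero h' _
      · omega
      · omega
    refine ⟨hb, fun i l hil => ?_, fun j m hjm => ?_, fun i j l m hij hlm => ?_⟩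
    · rw [← mulVec_stdVec_succ b.1 i l]
      rcases hT.degPlus_cases l with ⟨h', -⟩ | ⟨h', k, m, hk⟩ | ⟨h', k, hk⟩
      · omega
      · simpa only [hk] using hfree i k (by omega)
      · rcases hT.degPlus_cases i with ⟨hi, -⟩ | ⟨hi, k', j, hk'⟩ | ⟨hi, -⟩
        · simpa only [hk] using hfree i k hi
        · simpa only [hk, stdVec_zero, Matrix.mulVec_zero, Pi.zero_apply] using
            hedge i j k ((hT.isEdge_iff i j).2 ⟨k', hk'⟩)
        · omega
    · rw [← mulVec_stdVec_succ b.2 j m]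
      rcases hT.degMinus_cases m with ⟨h', -⟩ | ⟨h', k, l, hk⟩ | ⟨h', k, hk⟩
      · omega
      · simpa only [hk] using hfree' j k (by omega)
      · rcases hT.degMinus_cases j with ⟨hi, -⟩ | ⟨hi, k', i, hk'⟩ | ⟨hi, -⟩
        · simpa only [hk] using hfree' j k hi
        · simpa only [hk, stdVec_zero, Matrix.mulVec_zero, Pi.zero_apply] using
            (hedge i j k ((hT.isEdge_iff i j).2 ⟨k', hk'⟩)).symm
        · omega
    · obtain ⟨k, hk⟩ := (hT.isEdge_iff l m).1 hlm
      rw [← mulVec_stdVec_succ b.1 i l, ← mulVec_stdVec_succ b.2 j m]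
      simpa only [hk] using hedge i j k hij
  · rintro ⟨hb, h1, h2, h3⟩
    have hcol : ∀ k, ∃ w, (patMatrix p q T).mulVec w =
        fun x => (blockDiag p q b * patMatrix p q T) x k := by
      intro k
      -- the type of the column `k`
      have hk : (∃ l m, hT.param.IsEdge l m ∧ T k = ((l : ℕ) + 1, (m : ℕ) + 1)) ∨
          (∃ l, hT.param.degPlus l = 2 ∧ T k = ((l : ℕ) + 1, 0)) ∨
          ∃ m, hT.param.degMinus m = 2 ∧ T k = (0, (m : ℕ) + 1) := by
        have hp := hT.fst_le k
        have hq := hT.snd_le k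
        by_cases ha : (T k).1 = 0
        · have hb : (T k).2 ≠ 0 := fun hb => hT.ne_zero k (Prod.ext ha hb)
          have e : T k = (0, (((⟨(T k).2 - 1, by omega⟩ : Fin q)) : ℕ) + 1) :=
            Prod.ext ha (by simp only; omega)
          refine Or.inr (Or.inr ⟨_, ?_, e⟩)
          rw [OrbitParam.degMinus, if_pos ((hT.isMarkedMinus_iff _).2 ⟨k, e⟩)]
        · by_cases hb : (T k).2 = 0
          · have e : T k = ((((⟨(T k).1 - 1, by omega⟩ : Fin p)) : ℕ) + 1, 0) :=
              Prod.ext (by simp only; omega) hb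
            refine Or.inr (Or.inl ⟨_, ?_, e⟩)
            rw [OrbitParam.degPlus, if_pos ((hT.isMarkedPlus_iff _).2 ⟨k, e⟩)]
          · have e : T k = ((((⟨(T k).1 - 1, by omega⟩ : Fin p)) : ℕ) + 1,
                (((⟨(T k).2 - 1, by omega⟩ : Fin q)) : ℕ) + 1) :=
              Prod.ext (by simp only; omega) (by simp only; omega)
            exact Or.inl ⟨_, _, (hT.isEdge_iff _ _).2 ⟨k, e⟩, e⟩
      apply hT.exists_mulVec_eq
      · intro i hi
        rw [blockDiag_mul_patMatrix_inl]
        rcases hk with ⟨l, m, hlm, hk⟩ | ⟨l, hl, hk⟩ | ⟨m, hm, hk⟩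
        · rw [hk, mulVec_stdVec_succ]
          exact h1 i l (by rw [hi, hT.degPlus_of_edge hlm]; exact one_pos)
        · rw [hk, mulVec_stdVec_succ]
          exact h1 i l (by omega)
        · rw [hk, stdVec_zero, Matrix.mulVec_zero]
          rfl
      · intro j hj
        rw [blockDiag_mul_patMatrix_inr]
        rcases hk with ⟨l, m, hlm, hk⟩ | ⟨l, hl, hk⟩ | ⟨m, hm, hk⟩
        · rw [hk, mulVec_stdVec_succ]
          exact h2 j m (by rw [hj, hT.degMinus_of_edge hlm]; exact one_pos)
        · rw [hk, stdVec_zero, Matrix.mulVec_zero]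
          rfl
        · rw [hk, mulVec_stdVec_succ]
          exact h2 j m (by omega)
      · intro i j hij
        rw [blockDiag_mul_patMatrix_inl, blockDiag_mul_patMatrix_inr]
        rcases hk with ⟨l, m, hlm, hk⟩ | ⟨l, hl, hk⟩ | ⟨m, hm, hk⟩
        · rw [hk, mulVec_stdVec_succ, mulVec_stdVec_succ, h3 i j l m hij hlm]
        · rw [hk, mulVec_stdVec_succ, stdVec_zero, Matrix.mulVec_zero,
            h1 i l (by rw [hl, hT.degPlus_of_edge hij]; exact one_lt_two)]
          rfl
        · rw [hk, mulVec_stdVec_succ, stdVec_zero, Matrix.mulVec_zero,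
            h2 j m (by rw [hm, hT.degMinus_of_edge hij]; exact one_lt_two)]
          rfl
    choose w hw using hcol
    refine ⟨hb, Matrix.of fun l k => w k l, ?_⟩
    ext x k
    exact (congrFun (hw k) x).symm

end

namespace OrbitParam

variable {p q r : ℕ}

/-- The edges of the graph of an orbit parameter. -/
abbrev Edge (ω : OrbitParam p q r) : Type := {e : Fin p × Fin q // ω.IsEdge e.1 e.2}

/-- The index set of the equations of the isotropy algebra: an entry below the diagonal or with
`deg i < deg l` has to vanish, and two entries indexed by a pair of edges have to agree, unless both
are below the diagonal. -/
abbrev EquationIndex (ω : OrbitParam p q r) : Type :=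
  {x : Fin p × Fin p // x.2 < x.1 ∨ (x.1 < x.2 ∧ ω.degPlus x.1 < ω.degPlus x.2)} ⊕
  {x : Fin q × Fin q // x.2 < x.1 ∨ (x.1 < x.2 ∧ ω.degMinus x.1 < ω.degMinus x.2)} ⊕
  {e : ω.Edge × ω.Edge // ¬(e.2.1.1 < e.1.1.1 ∧ e.2.1.2 < e.1.1.2)}

/-- The left hand sides of the equations of the isotropy algebra. -/
def isotropyEquations (ω : OrbitParam p q r) : BlockAlg p q →ₗ[ℂ] (ω.EquationIndex → ℂ) where
  toFun b := Sum.elim (fun x => b.1 x.1.1 x.1.2) (Sum.elim (fun x => b.2 x.1.1 x.1.2)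
    fun e => b.1 e.1.1.1.1 e.1.2.1.1 - b.2 e.1.1.1.2 e.1.2.1.2)
  map_add' a b := by
    ext (x | x | e)
    · rfl
    · rfl
    · simp
      ring
  map_smul' _ b := by
    ext (x | x | e)
    · rfl
    · rfl
    · simp
      ring

end OrbitParam

section

variable {p q r : ℕ} {T : Fin r → ℕ × ℕ}

theorem IsPattern.isotropyEquations_eq_zero_iff (hT : IsPattern p q T) (b : BlockAlg p q) :
    hT.param.isotropyEquations b = 0 ↔ b ∈ isotropyAlg p q T := by
  rw [hT.mem_isotropyAlg_iff]
  constructor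
  · intro h
    have h1 : ∀ x, _ := fun x => congrFun h (Sum.inl x)
    have h2 : ∀ x, _ := fun x => congrFun h (Sum.inr (Sum.inl x))
    have h3 : ∀ x, _ := fun x => congrFun h (Sum.inr (Sum.inr x))
    have hlow : ∀ i l, l < i → b.1 i l = 0 := fun i l hl => h1 ⟨(i, l), Or.inl hl⟩
    have hlow' : ∀ j m, m < j → b.2 j m = 0 := fun j m hm => h2 ⟨(j, m), Or.inl hm⟩
    refine ⟨⟨hlow, hlow'⟩, fun i l hil => ?_, fun j m hjm => ?_, fun i j l m hij hlm => ?_⟩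
    · rcases lt_trichotomy l i with h | rfl | h
      · exact hlow i l h
      · exact absurd hil (lt_irrefl _)
      · exact h1 ⟨(i, l), Or.inr ⟨h, hil⟩⟩
    · rcases lt_trichotomy m j with h | rfl | h
      · exact hlow' j m h
      · exact absurd hjm (lt_irrefl _)
      · exact h2 ⟨(j, m), Or.inr ⟨h, hjm⟩⟩
    · by_cases hb : l < i ∧ m < j
      · rw [hlow i l hb.1, hlow' j m hb.2]
      · exact sub_eq_zero.1 (h3 ⟨(⟨(i, j), hij⟩, ⟨(l, m), hlm⟩), hb⟩)
  · rintro ⟨h0, h1, h2, h3⟩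
    ext (⟨⟨i, l⟩, h⟩ | ⟨⟨j, m⟩, h⟩ | ⟨⟨⟨⟨i, j⟩, hij⟩, ⟨⟨l, m⟩, hlm⟩⟩, h⟩)
    · rcases h with h | h
      · exact h0.1 i l h
      · exact h1 i l h.2
    · rcases h with h | h
      · exact h0.2 j m h
      · exact h2 j m h.2
    · exact sub_eq_zero.2 (h3 i j l m hij hlm)

/-- The equations of the isotropy algebra are independent. The first ones concern distinct entries,
and the equation of a pair of edges contains an entry occurring in no other equation: one that is
not below the diagonal. -/
theorem IsPattern.isotropyEquations_surjective (hT : IsPattern p q T) :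
    Function.Surjective hT.param.isotropyEquations := by
  classical
  -- each equation on a pair of edges can be varied independently of all the others
  have hpair : ∀ π, ∃ c : BlockAlg p q,
      hT.param.isotropyEquations c = Pi.single (Sum.inr (Sum.inr π)) 1 := by
    rintro ⟨⟨⟨⟨i, j⟩, hij⟩, ⟨⟨l, m⟩, hlm⟩⟩, h⟩
    dsimp only at hij hlm h
    by_cases hil : i ≤ l
    · refine ⟨(Matrix.single i l 1, 0), ?_⟩
      ext (⟨⟨i', l'⟩, h'⟩ | ⟨⟨j', m'⟩, h'⟩ | ⟨⟨⟨⟨i', j'⟩, hij'⟩, ⟨⟨l', m'⟩, hlm'⟩⟩, h'⟩)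
      · simp only [OrbitParam.isotropyEquations, LinearMap.coe_mk, AddHom.coe_mk, Sum.elim_inl]
        rw [Pi.single_eq_of_ne (by simp), Matrix.single_apply, if_neg]
        rintro ⟨rfl, rfl⟩
        dsimp only at h'
        rw [hT.degPlus_of_edge hij, hT.degPlus_of_edge hlm] at h'
        omega
      · rw [Pi.single_eq_of_ne (by simp)]
        rfl
      · dsimp only at hij' hlm'
        simp only [OrbitParam.isotropyEquations, LinearMap.coe_mk, AddHom.coe_mk, Sum.elim_inr,
          Matrix.zero_apply, sub_zero, Matrix.single_apply]
        split_ifs with he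
        · obtain ⟨rfl, rfl⟩ := he
          obtain rfl := hT.edge_left_unique hij hij'
          obtain rfl := hT.edge_left_unique hlm hlm'
          rw [Pi.single_eq_same]
        · rw [Pi.single_eq_of_ne]
          simp only [ne_eq, Sum.inr.injEq, Subtype.mk.injEq, Prod.mk.injEq]
          rintro ⟨⟨rfl, rfl⟩, rfl, rfl⟩
          exact he ⟨rfl, rfl⟩
    · have hjm : j ≤ m := not_lt.1 fun hm => h ⟨not_le.1 hil, hm⟩
      refine ⟨(0, -Matrix.single j m 1), ?_⟩
      ext (⟨⟨i', l'⟩, h'⟩ | ⟨⟨j', m'⟩, h'⟩ | ⟨⟨⟨⟨i', j'⟩, hij'⟩, ⟨⟨l', m'⟩, hlm'⟩⟩, h'⟩)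
      · rw [Pi.single_eq_of_ne (by simp)]
        rfl
      · simp only [OrbitParam.isotropyEquations, LinearMap.coe_mk, AddHom.coe_mk, Sum.elim_inl,
          Sum.elim_inr]
        rw [Pi.single_eq_of_ne (by simp), Matrix.neg_apply, Matrix.single_apply, if_neg, neg_zero]
        rintro ⟨rfl, rfl⟩
        dsimp only at h'
        rw [hT.degMinus_of_edge hij, hT.degMinus_of_edge hlm] at h'
        omega
      · dsimp only at hij' hlm'
        simp only [OrbitParam.isotropyEquations, LinearMap.coe_mk, AddHom.coe_mk, Sum.elim_inr,
          Matrix.zero_apply, zero_sub, Matrix.neg_apply, neg_neg, Matrix.single_apply]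
        split_ifs with he
        · obtain ⟨rfl, rfl⟩ := he
          obtain rfl := hT.edge_right_unique hij hij'
          obtain rfl := hT.edge_right_unique hlm hlm'
          rw [Pi.single_eq_same]
        · rw [Pi.single_eq_of_ne]
          simp only [ne_eq, Sum.inr.injEq, Subtype.mk.injEq, Prod.mk.injEq]
          rintro ⟨⟨rfl, rfl⟩, rfl, rfl⟩
          exact he ⟨rfl, rfl⟩
  choose c hc using hpair
  intro y
  -- `b` satisfies the equations on single entries, and is corrected for those on pairs of edges
  let b : BlockAlg p q :=
    (Matrix.of fun i l => if h : _ then y (Sum.inl ⟨(i, l), h⟩) else 0,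
      Matrix.of fun j m => if h : _ then y (Sum.inr (Sum.inl ⟨(j, m), h⟩)) else 0)
  refine ⟨b + ∑ π, (y (Sum.inr (Sum.inr π)) -
    hT.param.isotropyEquations b (Sum.inr (Sum.inr π))) • c π, ?_⟩
  rw [map_add, map_sum]
  simp only [map_smul, hc]
  ext (x | x | π)
  · rw [Pi.add_apply, Finset.sum_apply, Finset.sum_eq_zero, add_zero]
    · exact dif_pos x.2
    · intro π _
      rw [Pi.smul_apply, Pi.single_eq_of_ne (by simp), smul_zero]
  · rw [Pi.add_apply, Finset.sum_apply, Finset.sum_eq_zero, add_zero]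
    · exact dif_pos x.2
    · intro π _
      rw [Pi.smul_apply, Pi.single_eq_of_ne (by simp), smul_zero]
  · rw [Pi.add_apply, Finset.sum_apply, Finset.sum_eq_single π]
    · rw [Pi.smul_apply, Pi.single_eq_same, smul_eq_mul, mul_one, add_sub_cancel]
    · intro π' _ hπ
      rw [Pi.smul_apply, Pi.single_eq_of_ne (by simpa using hπ.symm), smul_zero]
    · simp

/-- The pairs in decreasing order are half of those off the diagonal. -/
theorem two_mul_card_filter_lt {α : Type*} [Fintype α] {f : α → ℕ} (hf : Function.Injective f) :
    2 * (Finset.univ.filter fun x : α × α => f x.2 < f x.1).card + Fintype.card α =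
      Fintype.card α * Fintype.card α := by
  classical
  have h1 : (Finset.univ.filter fun x : α × α => f x.1 < f x.2).card =
      (Finset.univ.filter fun x : α × α => f x.2 < f x.1).card :=
    Finset.card_equiv (Equiv.prodComm α α) (by simp)
  have h2 : (Finset.univ.filter fun x : α × α => f x.2 < f x.1) ∪
      (Finset.univ.filter fun x : α × α => f x.1 < f x.2) = (Finset.univ : Finset α).offDiag := by
    ext x
    simp only [Finset.mem_union, Finset.mem_filter, Finset.mem_univ, true_and,
      Finset.mem_offDiag]
    rw [← hf.ne_iff]
    omega
  have h3 : Disjoint (Finset.univ.filter fun x : α × α => f x.2 < f x.1)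
      (Finset.univ.filter fun x : α × α => f x.1 < f x.2) := by
    rw [Finset.disjoint_filter]
    intro x _ h
    omega
  have h4 := Finset.card_union_of_disjoint h3
  rw [h1, h2, Finset.offDiag_card, Finset.card_univ] at h4
  have h5 : Fintype.card α ≤ Fintype.card α * Fintype.card α := Nat.le_mul_self _
  omega

theorem card_lt_or (n : ℕ) (s : Fin n × Fin n → Prop) [DecidablePred s] :
    Fintype.card {x : Fin n × Fin n // x.2 < x.1 ∨ (x.1 < x.2 ∧ s x)} =
      n * (n - 1) / 2 + (Finset.univ.filter fun x : Fin n × Fin n => x.1 < x.2 ∧ s x).card := by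
  rw [Fintype.card_subtype, Finset.filter_or, Finset.card_union_of_disjoint]
  · have h := two_mul_card_filter_lt (Fin.val_injective (n := n))
    simp only [Fin.val_fin_lt, Fintype.card_fin] at h
    rw [Nat.mul_sub_one, ← h]
    omega
  · rw [Finset.disjoint_filter]
    intro x _ h h'
    exact lt_asymm h h'.1

/-- Among the pairs of edges, those with both ends in decreasing order are complementary to the
crossings within the `b (b - 1) / 2` pairs of edges with decreasing first ends. -/
theorem IsPattern.card_edge_pairs (hT : IsPattern p q T)
    [Fintype {e : hT.param.Edge × hT.param.Edge // ¬(e.2.1.1 < e.1.1.1 ∧ e.2.1.2 < e.1.1.2)}] :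
    Fintype.card {e : hT.param.Edge × hT.param.Edge //
      ¬(e.2.1.1 < e.1.1.1 ∧ e.2.1.2 < e.1.1.2)} =
      hT.param.numEdges * (hT.param.numEdges + 1) / 2 + hT.param.numCrossings := by
  classical
  have hE : Fintype.card hT.param.Edge = hT.param.numEdges := by
    rw [Fintype.card_subtype, OrbitParam.numEdges]
  have hf : Function.Injective fun e : hT.param.Edge => (e.1.1 : ℕ) := by
    rintro ⟨⟨i, j⟩, h⟩ ⟨⟨i', j'⟩, h'⟩ e
    obtain rfl : i = i' := Fin.ext e
    obtain rfl : j = j' := hT.edge_left_unique h h'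
    rfl
  have h1 := two_mul_card_filter_lt hf
  have h2 : hT.param.numCrossings = (Finset.univ.filter fun e : hT.param.Edge × hT.param.Edge =>
      e.2.1.1 < e.1.1.1 ∧ e.1.1.2 < e.2.1.2).card := by
    symm
    refine Finset.card_bij (fun e _ => (e.2.1, e.1.1)) ?_ ?_ ?_
    · intro e he
      simp only [Finset.mem_filter, Finset.mem_univ, true_and] at he ⊢
      exact ⟨e.2.2, e.1.2, he⟩
    · rintro ⟨e, e'⟩ - ⟨f, f'⟩ - h
      simp only [Prod.mk.injEq] at h
      exact Prod.ext (Subtype.ext h.2) (Subtype.ext h.1)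
    · rintro ⟨e, e'⟩ h
      simp only [Finset.mem_filter, Finset.mem_univ, true_and] at h
      exact ⟨(⟨e', h.2.1⟩, ⟨e, h.1⟩), by simpa using h.2.2, rfl⟩
  have h3 : (Finset.univ.filter fun e : hT.param.Edge × hT.param.Edge =>
      (e.2.1.1 : ℕ) < e.1.1.1) = (Finset.univ.filter fun e : hT.param.Edge × hT.param.Edge =>
        e.2.1.1 < e.1.1.1 ∧ e.2.1.2 < e.1.1.2) ∪
      Finset.univ.filter fun e : hT.param.Edge × hT.param.Edge =>
        e.2.1.1 < e.1.1.1 ∧ e.1.1.2 < e.2.1.2 := by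
    ext ⟨⟨⟨i, j⟩, h⟩, ⟨⟨i', j'⟩, h'⟩⟩
    simp only [Finset.mem_union, Finset.mem_filter, Finset.mem_univ, true_and, ← and_or_left]
    refine ⟨fun hi => ⟨hi, lt_or_gt_of_ne ?_⟩, fun hi => hi.1⟩
    rintro rfl
    exact hi.ne (congrArg Fin.val (hT.edge_right_unique h' h))
  have h4 : (Finset.univ.filter fun e : hT.param.Edge × hT.param.Edge =>
      (e.2.1.1 : ℕ) < e.1.1.1).card = (Finset.univ.filter fun e : hT.param.Edge × hT.param.Edge =>
        e.2.1.1 < e.1.1.1 ∧ e.2.1.2 < e.1.1.2).card + hT.param.numCrossings := by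
    rw [h3, Finset.card_union_of_disjoint, h2]
    rw [Finset.disjoint_filter]
    exact fun x _ h h' => lt_asymm h.2 h'.2
  have h5 := Finset.card_filter_add_card_filter_not (s := Finset.univ)
    (fun e : hT.param.Edge × hT.param.Edge => e.2.1.1 < e.1.1.1 ∧ e.2.1.2 < e.1.1.2)
  rw [Finset.card_univ, Fintype.card_prod, hE] at h5
  rw [hE] at h1
  rw [Fintype.card_subtype, mul_add_one, ← h1]
  omega

theorem OrbitParam.topologicalKrullDim_orbit (ω : OrbitParam p q r) :
    topologicalKrullDim ω.orbit =
      ((p * (p - 1) / 2 + q * (q - 1) / 2 + ω.aPlus + ω.aMinus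
        + ω.numEdges * (ω.numEdges + 1) / 2 + ω.numCrossings : ℕ) : WithBot ℕ∞) := by
  classical
  obtain ⟨T, hT, rfl⟩ := ω.exists_pattern
  let e : hT.param.EquationIndex ≃ Fin (Fintype.card hT.param.EquationIndex) :=
    Fintype.equivFin _
  let E := LinearEquiv.funCongrLeft ℂ ℂ e.symm
  rw [hT.topologicalKrullDim_orbit (E.toLinearMap ∘ₗ hT.param.isotropyEquations)
    (E.surjective.comp hT.isotropyEquations_surjective) fun b => by
      rw [LinearMap.comp_apply, LinearEquiv.coe_coe, LinearEquiv.map_eq_zero_iff,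
        hT.isotropyEquations_eq_zero_iff]]
  rw [Fintype.card_sum, Fintype.card_sum, card_lt_or p, card_lt_or q, hT.card_edge_pairs]
  congr 1
  rw [OrbitParam.aPlus, OrbitParam.aMinus]
  omega

end

theorem theorem1 (p q r : ℕ) :
    -- every orbit is the orbit attached to a unique parameter
    (∀ x : DoubleFlagVariety p q r, ∃! ω : OrbitParam p q r,
      MulAction.orbit (GL (Fin p) ℂ × GL (Fin q) ℂ) x = ω.orbit) ∧
    -- the dimension of the orbits
    (∀ ω : OrbitParam p q r,
      topologicalKrullDim ω.orbit =
        ((p * (p - 1) / 2 + q * (q - 1) / 2 + ω.aPlus + ω.aMinus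
          + ω.numEdges * (ω.numEdges + 1) / 2 + ω.numCrossings : ℕ) : WithBot ℕ∞)) ∧
    -- the orbits are described by rank conditions
    (∀ ω : OrbitParam p q r,
      ω.orbit = {x : DoubleFlagVariety p q r | ∀ (i : Fin (p + 1)) (j : Fin (q + 1)),
        Module.finrank ℂ (x.W ⊓ x.flagSum i j : Submodule ℂ (Fin p ⊕ Fin q → ℂ))
          = ω.rankMat i j}) ∧
    -- the inclusion relations between the closures of the orbits
    (∀ ω ω' : OrbitParam p q r,
      closure ω.orbit ⊆ closure ω'.orbit ↔
        ∀ (i : Fin (p + 1)) (j : Fin (q + 1)), ω'.rankMat i j ≤ ω.rankMat i j) :=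
  ⟨existsUnique_orbit_eq, OrbitParam.topologicalKrullDim_orbit, OrbitParam.orbit_eq_setOf,
    OrbitParam.closure_subset_iff⟩
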